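/- Let $d\in\mathbb N$, $\tau>0$, $\sigma\in(0,1]$, and let $\mathbb T^d=\mathbb R^d/\mathbb Z^d$. For $q\ge 1$ put $$\|g\|_{B^{\sigma,\infty}_q}=\|g\|_{L^q(\mathbb T^d)}+\sup_{r\in(0,1]^d}\frac{\|g(\cdot+r)-g\|_{L^q(\mathbb T^d)}}{|r|^\sigma}.$$ For every viscosity $\nu>0$ let $u^\nu\in L^\infty([0,\tau];L^2(\mathbb T^d))\cap L^2([0,\tau];H^1(\mathbb T^d))$ be a Leray solution, with pressure $p^\nu\in L^1((0,\tau)\times\mathbb T^d)$, of the incompressible Navier–Stokes equations $$\partial_t u^\nu+\nabla\cdot(u^\nu\otimes u^\nu)=-\nabla p^\nu+\nu\Delta u^\nu+f^\nu,\qquad \nabla\cdot u^\nu=0,\qquad u^\nu|_{t=0}=u_0^\nu,$$ with solenoidal $u_0^\nu\in L^2(\mathbb T^d)$ and solenoidal $f^\nu\in L^2([0,\tau];L^2(\mathbb T^d))$; that is, the equations hold in the sense of distributions and, for $s=0$ and for almost every $s\in(0,\tau)$, $$\tfrac12\|u^\nu(t)\|_{L^2}^2+\nu\int_s^t\|\nabla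 u^\nu\|_{L^2}^2\,dr\le\tfrac12\|u^\nu(s)\|_{L^2}^2+\int_s^t\!\int_{\mathbb T^d}u^\nu\cdot f^\nu\,dx\,dr\quad\text{for a.e. }t\in(s,\tau),$$ where $u^\nu(0)=u^\nu_0$. Suppose that $$\sup_{\nu>0}\|u_0^\nu\|_{B^{\sigma,\infty}_2}<\infty,\qquad \sup_{\nu>0}\|f^\nu\|_{L^2([0,\tau];B^{\sigma,\infty}_2)}<\infty,\qquad \sup_{\nu>0}\|u^\nu\|_{L^3([0,\tau];B^{\sigma,\infty}_3)}<\infty.$$ Let $\varepsilon[u^\nu]=\nu|\nabla u^\nu|^2+D[u^\nu]$ be the total energy dissipation, where $D[u^\nu]$ is the distribution on $(0,\tau)\times\mathbb T^d$ determined by the local energy balance $$\partial_t\big(\tfrac12|u^\nu|^2\big)+\nabla\cdot\Big[\big(\tfrac12|u^\nu|^2+p^\nu\big)u^\nu-\nu\nabla\big(\tfrac12|u^\nu|^2\big)\Big]=-\varepsilon[u^\nu]+u^\nu\cdot f^\nu .$$ Then for every $\nu_0>0$ there is a constant $C$, independent of $\nu$, such that for almost every $T\in[0,\tau]$ and all $\nu\in(0,\nu_0]$,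 $$\int_0^T\!\int_{\mathbb T^d}\varepsilon[u^\nu]\,dx\,dt\le C\,\nu^{\frac{3\sigma-1}{\sigma+1}};$$ if $\sigma\ge\frac13$, then $C$ can be chosen such that this holds for all $\nu>0$. Here the left side is the mass given to $(0,T)$ by the spatially integrated distribution $\varepsilon[u^\nu]$, that is, the supremum of $\langle\varepsilon[u^\nu],\psi\otimes 1\rangle$ over $\psi\in C_c^\infty((0,T))$ with $0\le\psi\le1$. Moreover, whenever $D[u^\nu]$ is a nonnegative Radon measure on $(0,\tau)\times\mathbb T^d$, the same bound holds for $\nu\int_0^T\!\int_{\mathbb T^d}|\nabla u^\nu|^2\,dx\,dt+D[u^\nu]\big((0,T]\times\mathbb T^d\big)$. -/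

import Mathlib

open Set MeasureTheory
open scoped ENNReal NNReal ContDiff RealInnerProductSpace

noncomputable section

/-! ### The flat unit torus
Functions on the torus are functions on Euclidean space which are `1`-periodic in every coordinate;
they are integrated over the fundamental cell. -/

/-- Euclidean `d`-space. -/
abbrev Euc (d : ℕ) : Type := EuclideanSpace ℝ (Fin d)

/-- The fundamental cell `[0,1)^d`. -/
def cell (d : ℕ) : Set (Euc d) := {x | ∀ i, x i ∈ Ico (0 : ℝ) 1}

/-- Integration over the torus. -/
def torusMeasure (d : ℕ) : Measure (Euc d) := volume.restrict (cell d)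

/-- Integration over `(0,τ) ×` torus. -/
def spaceTime (d : ℕ) (τ : ℝ) : Measure (ℝ × Euc d) :=
  (volume.restrict (Ioo 0 τ)).prod (torusMeasure d)

/-- `1`-periodicity in every coordinate. -/
def TorusPeriodic {d : ℕ} {F : Type*} (g : Euc d → F) : Prop :=
  ∀ (i : Fin d) (x : Euc d), g (x + EuclideanSpace.single i (1 : ℝ)) = g x

/-- The partial derivative `∂_j g`. -/
def partialDeriv {d : ℕ} (g : Euc d → ℝ) (j : Fin d) (x : Euc d) : ℝ :=
  fderiv ℝ g x (EuclideanSpace.single j (1 : ℝ))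

/-! ### Besov spaces -/

/-- The norm of `B_q^{σ,∞}` of the torus,
`‖g‖_{L^q} + sup_{r ∈ (0,1]^d} ‖g(· + r) - g‖_{L^q} / |r|^σ`. -/
def besovNorm {d : ℕ} (q : ℝ≥0∞) (σ : ℝ) (g : Euc d → Euc d) : ℝ≥0∞ :=
  eLpNorm g q (torusMeasure d) +
    ⨆ r ∈ {r : Euc d | ∀ i, r i ∈ Ioc (0 : ℝ) 1},
      eLpNorm (fun x => g (x + r) - g x) q (torusMeasure d) / ENNReal.ofReal (‖r‖ ^ σ)

/-- The norm of `L^m([0,τ]; B_q^{σ,∞})`. -/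
def timeBesovNorm {d : ℕ} (τ m : ℝ) (q : ℝ≥0∞) (σ : ℝ) (v : ℝ → Euc d → Euc d) : ℝ≥0∞ :=
  (∫⁻ t in Ioo 0 τ, besovNorm q σ (v t) ^ m) ^ (1 / m)

/-! ### Leray solutions -/

/-- `∇ · v = 0` on the torus, in the sense of distributions. -/
def WeaklyDivFree {d : ℕ} (v : Euc d → Euc d) : Prop :=
  ∀ φ : Euc d → ℝ, ContDiff ℝ ∞ φ → TorusPeriodic φ →
    ∫ x, fderiv ℝ φ x (v x) ∂(torusMeasure d) = 0

/-- `A i j` is the distributional derivative `∂_j v_i` on the torus. -/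
def IsWeakGradient {d : ℕ} (v : Euc d → Euc d) (A : Euc d → Fin d → Fin d → ℝ) : Prop :=
  ∀ φ : Euc d → ℝ, ContDiff ℝ ∞ φ → TorusPeriodic φ → ∀ i j : Fin d,
    ∫ x, v x i * partialDeriv φ j x ∂(torusMeasure d)
      = -∫ x, A x i j * φ x ∂(torusMeasure d)

/-- The squared Frobenius norm `|∇v|²` at a point. -/
def gradSq {d : ℕ} (a : Fin d → Fin d → ℝ) : ℝ := ∑ i, ∑ j, a i j ^ 2

/-- Smooth vector test fields on `[0,τ) ×` torus with compact support (they may be nonzero at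
time `0`). -/
structure IsVectorTest {d : ℕ} (τ : ℝ) (φ : ℝ → Euc d → Euc d) : Prop where
  smooth : ContDiff ℝ ∞ (fun z : ℝ × Euc d => φ z.1 z.2)
  periodic : ∀ t, TorusPeriodic (φ t)
  support : ∃ b < τ, ∀ t, b ≤ t → ∀ x, φ t x = 0

/-- Smooth scalar test functions with compact support in `(0,τ) ×` torus. -/
structure IsScalarTest {d : ℕ} (τ : ℝ) (φ : ℝ → Euc d → ℝ) : Prop where
  smooth : ContDiff ℝ ∞ (fun z : ℝ × Euc d => φ z.1 z.2)
  periodic : ∀ t, TorusPeriodic (φ t)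
  support : ∃ a b, 0 < a ∧ b < τ ∧ ∀ t, t ∉ Icc a b → ∀ x, φ t x = 0

/-- `u`, with pressure `p` and spatial gradient `A`, is a Leray solution on `[0,τ] ×` torus of the
incompressible Navier-Stokes equations with viscosity `ν`, initial datum `u₀` and force `f`. -/
structure IsLeraySolution {d : ℕ} (τ ν : ℝ) (u₀ : Euc d → Euc d) (f u : ℝ → Euc d → Euc d)
    (A : ℝ → Euc d → Fin d → Fin d → ℝ) (p : ℝ → Euc d → ℝ) : Prop where
  data_periodic : TorusPeriodic u₀
  data_memLp : MemLp u₀ 2 (torusMeasure d)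
  data_divFree : WeaklyDivFree u₀
  force_periodic : ∀ t, TorusPeriodic (f t)
  force_memLp : MemLp (fun z : ℝ × Euc d => f z.1 z.2) 2 (spaceTime d τ)
  force_divFree : ∀ᵐ t ∂(volume.restrict (Ioo 0 τ)), WeaklyDivFree (f t)
  /-- `u ∈ L^∞([0,τ]; L²)` -/
  periodic : ∀ t, TorusPeriodic (u t)
  measurable : AEStronglyMeasurable (fun z : ℝ × Euc d => u z.1 z.2) (spaceTime d τ)
  bounded : ∃ K : ℝ≥0, ∀ᵐ t ∂(volume.restrict (Ioo 0 τ)), eLpNorm (u t) 2 (torusMeasure d) ≤ K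
  /-- `u ∈ L²([0,τ]; H¹)` -/
  grad_periodic : ∀ t, TorusPeriodic (A t)
  grad_memLp : MemLp (fun z : ℝ × Euc d => A z.1 z.2) 2 (spaceTime d τ)
  grad_eq : ∀ᵐ t ∂(volume.restrict (Ioo 0 τ)), IsWeakGradient (u t) (A t)
  pressure_periodic : ∀ t, TorusPeriodic (p t)
  pressure_integrable : Integrable (fun z : ℝ × Euc d => p z.1 z.2) (spaceTime d τ)
  divFree : ∀ᵐ t ∂(volume.restrict (Ioo 0 τ)), WeaklyDivFree (u t)
  /-- `∂_t u + ∇ · (u ⊗ u) = -∇p + ν Δu + f` and `u = u₀` at time `0`, in the sense of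
  distributions. -/
  momentum : ∀ φ : ℝ → Euc d → Euc d, IsVectorTest τ φ →
    (∫ z, (⟪u z.1 z.2, deriv (fun s => φ s z.2) z.1⟫
          + ⟪u z.1 z.2, fderiv ℝ (φ z.1) z.2 (u z.1 z.2)⟫
          + p z.1 z.2 * ∑ i, partialDeriv (fun x => φ z.1 x i) i z.2
          - ν * ∑ i, ∑ j, A z.1 z.2 i j * partialDeriv (fun x => φ z.1 x i) j z.2
          + ⟪f z.1 z.2, φ z.1 z.2⟫) ∂(spaceTime d τ))
      + ∫ x, ⟪u₀ x, φ 0 x⟫ ∂(torusMeasure d) = 0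
  /-- energy inequality from time `0` -/
  energy_zero : ∀ᵐ t ∂(volume.restrict (Ioo 0 τ)),
    1 / 2 * ∫ x, ‖u t x‖ ^ 2 ∂(torusMeasure d)
        + ν * ∫ r in Ioo 0 t, ∫ x, gradSq (A r x) ∂(torusMeasure d)
      ≤ 1 / 2 * ∫ x, ‖u₀ x‖ ^ 2 ∂(torusMeasure d)
        + ∫ r in Ioo 0 t, ∫ x, ⟪u r x, f r x⟫ ∂(torusMeasure d)
  /-- energy inequality from almost every later time `s` -/
  energy : ∀ᵐ s ∂(volume.restrict (Ioo 0 τ)), ∀ᵐ t ∂(volume.restrict (Ioo 0 τ)), s < t →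
    1 / 2 * ∫ x, ‖u t x‖ ^ 2 ∂(torusMeasure d)
        + ν * ∫ r in Ioo s t, ∫ x, gradSq (A r x) ∂(torusMeasure d)
      ≤ 1 / 2 * ∫ x, ‖u s x‖ ^ 2 ∂(torusMeasure d)
        + ∫ r in Ioo s t, ∫ x, ⟪u r x, f r x⟫ ∂(torusMeasure d)

/-! ### Energy dissipation -/

/-- The distribution `D[u]` on `(0,τ) ×` torus, determined by the local energy balance
`∂_t(½|u|²) + ∇·[(½|u|² + p) u - ν ∇(½|u|²)] = -ν|∇u|² - D[u] + u·f`: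
this is the pairing of `D[u]` with a test function `φ`. -/
def singularDissipation {d : ℕ} (τ ν : ℝ) (f u : ℝ → Euc d → Euc d)
    (A : ℝ → Euc d → Fin d → Fin d → ℝ) (p : ℝ → Euc d → ℝ) (φ : ℝ → Euc d → ℝ) : ℝ :=
  ∫ z, (1 / 2 * ‖u z.1 z.2‖ ^ 2 * deriv (fun s => φ s z.2) z.1
      + (1 / 2 * ‖u z.1 z.2‖ ^ 2 + p z.1 z.2) * fderiv ℝ (φ z.1) z.2 (u z.1 z.2)
      - ν * ∑ j, (∑ i, u z.1 z.2 i * A z.1 z.2 i j) * partialDeriv (φ z.1) j z.2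
      - ν * gradSq (A z.1 z.2) * φ z.1 z.2
      + ⟪u z.1 z.2, f z.1 z.2⟫ * φ z.1 z.2) ∂(spaceTime d τ)

/-- The distribution `ε[u] = ν|∇u|² + D[u]` on `(0,τ) ×` torus, paired with `φ`. -/
def dissipation {d : ℕ} (τ ν : ℝ) (f u : ℝ → Euc d → Euc d)
    (A : ℝ → Euc d → Fin d → Fin d → ℝ) (p : ℝ → Euc d → ℝ) (φ : ℝ → Euc d → ℝ) : ℝ :=
  (∫ z, ν * gradSq (A z.1 z.2) * φ z.1 z.2 ∂(spaceTime d τ)) + singularDissipation τ ν f u A p φ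

/-- Smooth functions of time with values in `[0,1]` and compact support in `(0,T)`. -/
def IsTimeCutoff (T : ℝ) (ψ : ℝ → ℝ) : Prop :=
  ContDiff ℝ ∞ ψ ∧ (∀ t, ψ t ∈ Icc (0 : ℝ) 1) ∧
    ∃ a b, 0 < a ∧ b < T ∧ ∀ t, t ∉ Icc a b → ψ t = 0

/-- The total dissipation `∫_0^T ∫ ε[u] dx dt`, i.e. the mass which the spatially integrated
distribution `ε[u]` (a nonnegative distribution in time) gives to `(0,T)`. It makes sense whether or
not `D[u]` is a measure in space-time. -/
def totalDissipation {d : ℕ} (τ ν : ℝ) (f u : ℝ → Euc d → Euc d)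
    (A : ℝ → Euc d → Fin d → Fin d → ℝ) (p : ℝ → Euc d → ℝ) (T : ℝ) : EReal :=
  ⨆ ψ ∈ {ψ : ℝ → ℝ | IsTimeCutoff T ψ}, ((dissipation τ ν f u A p (fun t _ => ψ t) : ℝ) : EReal)

/-- The nonnegative Radon measure `D` on `(0,τ) ×` torus represents the distribution `D[u]`. -/
def IsSingularDissipationMeasure {d : ℕ} (τ ν : ℝ) (f u : ℝ → Euc d → Euc d)
    (A : ℝ → Euc d → Fin d → Fin d → ℝ) (p : ℝ → Euc d → ℝ) (D : Measure (ℝ × Euc d)) : Prop :=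
  (∀ a b, 0 < a → b < τ → D (Icc a b ×ˢ cell d) < ⊤) ∧
    ∀ φ : ℝ → Euc d → ℝ, IsScalarTest τ φ →
      ∫ z in Ioo 0 τ ×ˢ cell d, φ z.1 z.2 ∂D = singularDissipation τ ν f u A p φ

end

/-! Let G(t) be the kinetic energy at time t minus the work done by the force up to t (`netEnergy`).
Tested with a function ψ of time alone, the local energy balance loses all its spatial flux terms,
the pressure included, and the viscous term cancels, so that ⟨ε[u], ψ⟩ = ∫ ψ' G
(`IsLeraySolution.dissipation_eq`). The Leray inequalities say that G is almost everywhere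
nonincreasing and at most the initial energy E₀. Hence ⟨ε[u], ψ⟩ ≤ R for every cutoff ψ as soon as G
≥ E₀ - R almost everywhere (`integral_deriv_cutoff_mul_le`), and everything reduces to a lower bound
for G with R = C ν^((3σ-1)/(σ+1)).

That bound comes from averaging u at a scale ℓ. Averaging does not increase the energy, and the
averaged field satisfies an exact energy balance, obtained by testing the momentum equation with a
mollifier (`IsLeraySolution.hasWeakTimeDeriv_avgEnergy`,
`IsMollifier.integral_avg_mul_avgMomentum`). So E₀ - G(t) is at most the sum of four errors
(`IsLeraySolution.energy_deficit_le`, `IsMollifier.ofReal_power_deficit_le`): the initial energy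
lost by averaging, the energy flux through scale ℓ, ν times the enstrophy of the average, and the
difference between the true and the averaged work.

In the manner of Constantin, E and Titi each error is expressed by increments of size at most √d ℓ.
The flux is cubic in increments with one derivative on the kernel, hence O(ℓ^(3σ-1)); the viscous
term is O(ν ℓ^(2σ-2)); the losses of energy and work are O(ℓ^(2σ)). The choice ν = ℓ^(σ+1) equates
the first two, and the third is no larger because σ ≤ 1 and ℓ ≤ 1. This settles ν ≤ 1. For ν > 1 the
deficit E₀ - G is bounded by a constant (`IsLeraySolution.netEnergy_deficit_le_const`), which
suffices when the exponent is nonnegative or ν ≤ ν₀.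

If D[u] is a measure, the same bound is applied to a cutoff equal to 1 on [a,T] and supported in
(0,τ), and then a tends to 0. -/

/-! ### Integration of periodic functions -/

/-- The standard basis of Euclidean space, whose integral span is the period lattice. -/
noncomputable abbrev torusBasis (d : ℕ) : Module.Basis (Fin d) ℝ (Euc d) :=
  (EuclideanSpace.basisFun (Fin d) ℝ).toBasis

theorem cell_eq_fundamentalDomain (d : ℕ) : cell d = ZSpan.fundamentalDomain (torusBasis d) := by
  ext x
  simp [cell, ZSpan.fundamentalDomain]

theorem measurableSet_cell (d : ℕ) : MeasurableSet (cell d) := by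
  rw [cell_eq_fundamentalDomain]
  exact ZSpan.fundamentalDomain_measurableSet _

theorem isAddFundamentalDomain_cell (d : ℕ) :
    IsAddFundamentalDomain (Submodule.span ℤ (Set.range (torusBasis d))).toAddSubgroup (cell d) volume := by
  rw [cell_eq_fundamentalDomain]
  exact ZSpan.isAddFundamentalDomain' _ _

instance countable_torusLattice (d : ℕ) :
    Countable (Submodule.span ℤ (Set.range (torusBasis d))).toAddSubgroup :=
  inferInstanceAs (Countable (Submodule.span ℤ (Set.range (torusBasis d))))

theorem cell_eq_preimage (d : ℕ) :
    cell d = (MeasurableEquiv.toLp 2 (Fin d → ℝ)).symm ⁻¹' (Set.univ.pi fun _ => Ico (0 : ℝ) 1) := by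
  ext x
  simp [cell]

theorem volume_cell (d : ℕ) : volume (cell d) = 1 := by
  rw [cell_eq_preimage,
    (EuclideanSpace.volume_preserving_symm_measurableEquiv_toLp (Fin d)).measure_preimage_equiv,
    Real.volume_pi_Ico]
  simp

instance isProbabilityMeasure_torusMeasure (d : ℕ) : IsProbabilityMeasure (torusMeasure d) :=
  ⟨by rw [torusMeasure, Measure.restrict_apply_univ, volume_cell]⟩

theorem TorusPeriodic.add_lattice {d : ℕ} {F : Type*} {g : Euc d → F} (hg : TorusPeriodic g)
    {v : Euc d} (hv : v ∈ Submodule.span ℤ (Set.range (torusBasis d))) (x : Euc d) :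
    g (v + x) = g x := by
  revert x
  induction hv using Submodule.span_induction with
  | mem v hv =>
    obtain ⟨i, rfl⟩ := hv
    intro x
    simpa [add_comm] using hg i x
  | zero => simp
  | add v w _ _ hv hw => intro x; rw [add_assoc, hv, hw]
  | smul n v _ hv =>
    induction n using Int.induction_on with
    | zero => simp
    | succ n ih => intro x; rw [add_smul, one_smul, add_assoc, ih, hv]
    | pred n ih => intro x; rw [← hv, ← add_assoc, sub_smul, one_smul, add_sub_cancel, ih]

theorem TorusPeriodic.vadd {d : ℕ} {F : Type*} {g : Euc d → F} (hg : TorusPeriodic g)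
    (v : (Submodule.span ℤ (Set.range (torusBasis d))).toAddSubgroup) (x : Euc d) : g (v +ᵥ x) = g x :=
  hg.add_lattice v.2 x

section

open scoped Pointwise

theorem isAddFundamentalDomain_vadd_cell {d : ℕ} (r : Euc d) :
    IsAddFundamentalDomain (Submodule.span ℤ (Set.range (torusBasis d))).toAddSubgroup (r +ᵥ cell d) volume :=
  (isAddFundamentalDomain_cell d).vadd_of_comm r

/-- A translate of the cell is another fundamental domain of the lattice, and an invariant function
has the same integral over any two of them. -/
theorem TorusPeriodic.lintegral_add_right {d : ℕ} {g : Euc d → ℝ≥0∞} (hg : TorusPeriodic g)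
    (r : Euc d) : ∫⁻ x, g (x + r) ∂(torusMeasure d) = ∫⁻ x, g x ∂(torusMeasure d) := by
  rw [torusMeasure, (isAddFundamentalDomain_cell d).setLIntegral_eq
    (isAddFundamentalDomain_vadd_cell r) g hg.vadd,
    ← Set.image_vadd, ← (measurePreserving_vadd r volume).setLIntegral_comp_emb (measurableEmbedding_const_vadd r)]
  simp [add_comm]

theorem TorusPeriodic.integral_add_right {d : ℕ} {F : Type*} [NormedAddCommGroup F]
    [NormedSpace ℝ F] {g : Euc d → F} (hg : TorusPeriodic g)
    (r : Euc d) : ∫ x, g (x + r) ∂(torusMeasure d) = ∫ x, g x ∂(torusMeasure d) := by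
  rw [torusMeasure, (isAddFundamentalDomain_cell d).setIntegral_eq
    (isAddFundamentalDomain_vadd_cell r) hg.vadd,
    ← Set.image_vadd, (measurePreserving_vadd r volume).setIntegral_image_emb (measurableEmbedding_const_vadd r)]
  simp [add_comm]

end

/-! ### Reduction modulo the lattice -/

/-- The representative of `x` in the fundamental cell. -/
noncomputable def torusFract {d : ℕ} (x : Euc d) : Euc d := ZSpan.fract (torusBasis d) x

theorem TorusPeriodic.torusFract {d : ℕ} {F : Type*} {g : Euc d → F} (hg : TorusPeriodic g)
    (x : Euc d) : g (torusFract x) = g x := by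
  rw [_root_.torusFract, ZSpan.fract_apply, sub_eq_neg_add]
  exact hg.add_lattice (neg_mem (Submodule.coe_mem _)) x

theorem torusFract_apply {d : ℕ} (x : Euc d) (i : Fin d) : torusFract x i = Int.fract (x i) := by
  exact ZSpan.repr_fract_apply (torusBasis d) x i

theorem torusFract_mem_cell {d : ℕ} (x : Euc d) : torusFract x ∈ cell d := by
  rw [cell_eq_fundamentalDomain]
  exact ZSpan.fract_mem_fundamentalDomain _ x

theorem torusFract_of_mem_cell {d : ℕ} {x : Euc d} (hx : x ∈ cell d) : torusFract x = x := by
  rw [cell_eq_fundamentalDomain] at hx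
  exact ZSpan.fract_eq_self.2 hx

theorem torusPeriodic_torusFract {d : ℕ} : TorusPeriodic (torusFract (d := d)) := by
  intro i x
  refine PiLp.ext fun j => ?_
  rw [torusFract_apply, torusFract_apply]
  by_cases h : j = i <;> simp [h]

theorem measurable_torusFract {d : ℕ} : Measurable (torusFract (d := d)) := by
  have h : (torusFract (d := d)) = fun x => WithLp.toLp 2 fun i => Int.fract (x i) :=
    funext fun x => PiLp.ext fun i => torusFract_apply x i
  rw [h]
  fun_prop

/-- Translations of the torus preserve its measure. -/
theorem measurePreserving_torusFract_add {d : ℕ} (r : Euc d) :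
    MeasurePreserving (fun x => torusFract (x + r)) (torusMeasure d) (torusMeasure d) := by
  have hm : Measurable fun x : Euc d => torusFract (x + r) :=
    measurable_torusFract.comp (measurable_id.add_const r)
  refine ⟨hm, Measure.ext fun s hs => ?_⟩
  rw [Measure.map_apply hm hs, ← lintegral_indicator_one (hm hs), ← lintegral_indicator_one hs]
  have hp : TorusPeriodic fun x : Euc d => s.indicator (1 : Euc d → ℝ≥0∞) (torusFract x) :=
    fun i x => by simp only [torusPeriodic_torusFract i x]
  refine (hp.lintegral_add_right r).trans ?_
  refine setLIntegral_congr_fun (measurableSet_cell d) fun x hx => ?_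
  simp only [torusFract_of_mem_cell hx]

/-- Addition on the torus. -/
theorem measurePreserving_torusFract_add_prod {d : ℕ} :
    MeasurePreserving (fun z : Euc d × Euc d => torusFract (z.1 + z.2))
      ((torusMeasure d).prod (torusMeasure d)) (torusMeasure d) := by
  have h := MeasurePreserving.skew_product (f := id) (MeasurePreserving.id (torusMeasure d))
    (g := fun r x : Euc d => torusFract (r + x)) (μb := torusMeasure d) (μd := torusMeasure d)
    (measurable_torusFract.comp (measurable_fst.add measurable_snd))
    (Filter.Eventually.of_forall fun r => by
      simpa only [add_comm] using (measurePreserving_torusFract_add r).map_eq)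
  exact measurePreserving_snd.comp h

/-- Measurability of g is known on the cell only, while a sum of two of its points may leave it.
Folding the sum back with `torusFract` does not change g and preserves the measure. -/
theorem TorusPeriodic.aestronglyMeasurable_add {d : ℕ} {F : Type*} [TopologicalSpace F]
    {g : Euc d → F} (hg : TorusPeriodic g) (hm : AEStronglyMeasurable g (torusMeasure d)) :
    AEStronglyMeasurable (fun z : Euc d × Euc d => g (z.1 + z.2))
      ((torusMeasure d).prod (torusMeasure d)) := by
  have := hm.comp_measurePreserving measurePreserving_torusFract_add_prod
  simpa only [Function.comp_def, hg.torusFract] using this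

theorem TorusPeriodic.aestronglyMeasurable_add_right {d : ℕ} {F : Type*} [TopologicalSpace F]
    {g : Euc d → F} (hg : TorusPeriodic g) (hm : AEStronglyMeasurable g (torusMeasure d))
    (r : Euc d) : AEStronglyMeasurable (fun x => g (x + r)) (torusMeasure d) := by
  have := hm.comp_measurePreserving (measurePreserving_torusFract_add r)
  simpa only [Function.comp_def, hg.torusFract] using this

theorem TorusPeriodic.memLp_add_right {d : ℕ} {F : Type*} [NormedAddCommGroup F] {q : ℝ≥0∞}
    {g : Euc d → F} (hg : TorusPeriodic g) (hm : MemLp g q (torusMeasure d))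
    (r : Euc d) : MemLp (fun x => g (x + r)) q (torusMeasure d) := by
  have := hm.comp_measurePreserving (measurePreserving_torusFract_add r)
  simpa only [Function.comp_def, hg.torusFract] using this

theorem TorusPeriodic.integrable_add_right {d : ℕ} {F : Type*} [NormedAddCommGroup F]
    {g : Euc d → F} (hg : TorusPeriodic g) (hm : Integrable g (torusMeasure d))
    (r : Euc d) : Integrable (fun x => g (x + r)) (torusMeasure d) :=
  memLp_one_iff_integrable.1 (hg.memLp_add_right (memLp_one_iff_integrable.2 hm) r)

theorem TorusPeriodic.comp {d : ℕ} {F F' : Type*} {g : Euc d → F} (hg : TorusPeriodic g)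
    (φ : F → F') : TorusPeriodic fun x => φ (g x) := fun i x => by simp only [hg i x]

theorem TorusPeriodic.comp₂ {d : ℕ} {F F' F'' : Type*} {g : Euc d → F} {g' : Euc d → F'}
    (hg : TorusPeriodic g) (hg' : TorusPeriodic g') (φ : F → F' → F'') :
    TorusPeriodic fun x => φ (g x) (g' x) := fun i x => by simp only [hg i x, hg' i x]

theorem TorusPeriodic.shift {d : ℕ} {F : Type*} {g : Euc d → F} (hg : TorusPeriodic g) (r : Euc d) :
    TorusPeriodic fun x => g (x + r) := fun i x => by
  simp only [add_right_comm x _ r, hg i]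

theorem TorusPeriodic.fderiv {d : ℕ} {g : Euc d → ℝ} (hg : TorusPeriodic g) :
    TorusPeriodic (fderiv ℝ g) := fun i x => by
  rw [← fderiv_comp_add_right]
  congr 1
  exact funext fun y => hg i y

theorem TorusPeriodic.partialDeriv {d : ℕ} {g : Euc d → ℝ} (hg : TorusPeriodic g) (j : Fin d) :
    TorusPeriodic (partialDeriv g j) := hg.fderiv.comp fun L => L (EuclideanSpace.single j 1)

/-! ### Continuous periodic functions and their derivatives -/

/-- The closed unit cube. -/
def closedCell (d : ℕ) : Set (Euc d) := {x | ∀ i, x i ∈ Icc (0 : ℝ) 1}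

theorem isCompact_closedCell (d : ℕ) : IsCompact (closedCell d) := by
  have h : closedCell d
      = (WithLp.toLp 2 : (Fin d → ℝ) → Euc d) '' (Set.univ.pi fun _ => Icc (0 : ℝ) 1) := by
    ext x
    constructor
    · exact fun hx => ⟨x.ofLp, fun i _ => hx i, rfl⟩
    · rintro ⟨y, hy, rfl⟩ i
      exact hy i trivial
  rw [h]
  exact (isCompact_univ_pi fun _ => isCompact_Icc).image (PiLp.continuous_toLp 2 _)

theorem cell_subset_closedCell (d : ℕ) : cell d ⊆ closedCell d :=
  fun _ hx i => Ico_subset_Icc_self (hx i)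

/-- A continuous periodic function is bounded. -/
theorem TorusPeriodic.exists_bound {d : ℕ} {F : Type*} [NormedAddCommGroup F] {g : Euc d → F}
    (hg : TorusPeriodic g) (hc : Continuous g) : ∃ M, ∀ x, ‖g x‖ ≤ M := by
  obtain ⟨M, hM⟩ := (isCompact_closedCell d).exists_bound_of_continuousOn hc.continuousOn
  exact ⟨M, fun x => hg.torusFract x ▸ hM _ (cell_subset_closedCell d (torusFract_mem_cell x))⟩

theorem TorusPeriodic.integrable_of_continuous {d : ℕ} {g : Euc d → ℝ}
    (hg : TorusPeriodic g) (hc : Continuous g) : Integrable g (torusMeasure d) := by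
  obtain ⟨M, hM⟩ := hg.exists_bound hc
  exact Integrable.of_bound hc.aestronglyMeasurable M (Filter.Eventually.of_forall hM)

theorem partialDeriv_contDiff {d : ℕ} {g : Euc d → ℝ} (hg : ContDiff ℝ ∞ g) (j : Fin d) :
    ContDiff ℝ ∞ (partialDeriv g j) :=
  (hg.fderiv_right (m := ∞) le_rfl).clm_apply contDiff_const

/-- Partial derivatives of smooth periodic functions have mean zero. -/
theorem integral_partialDeriv_eq_zero {d : ℕ} {g : Euc d → ℝ} (hg : ContDiff ℝ ∞ g)
    (hp : TorusPeriodic g) (j : Fin d) : ∫ x, partialDeriv g j x ∂(torusMeasure d) = 0 := by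
  have hc := (partialDeriv_contDiff hg j).continuous
  obtain ⟨M, hM⟩ := (hp.partialDeriv j).exists_bound hc
  have hd : ∀ x : Euc d, ∀ t : ℝ, HasDerivAt
      (fun s : ℝ => g (x + s • EuclideanSpace.single j (1 : ℝ)))
      (partialDeriv g j (x + t • EuclideanSpace.single j (1 : ℝ))) t := fun x t => by
    have h1 : HasDerivAt (fun s : ℝ => x + s • EuclideanSpace.single j (1 : ℝ))
        (EuclideanSpace.single j (1 : ℝ)) t := by
      simpa using ((hasDerivAt_id t).smul_const (EuclideanSpace.single j (1 : ℝ))).const_add x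
    exact ((hg.differentiable (by simp)) _).hasFDerivAt.comp_hasDerivAt t h1
  -- The integral of the translate by t along the j-th axis is constant in t; differentiating under
  -- the integral sign at t = 0 must therefore give zero.
  have h := hasDerivAt_integral_of_dominated_loc_of_deriv_le (μ := torusMeasure d) (𝕜 := ℝ)
    (F := fun (t : ℝ) x => g (x + t • EuclideanSpace.single j (1 : ℝ)))
    (F' := fun (t : ℝ) x => partialDeriv g j (x + t • EuclideanSpace.single j (1 : ℝ)))
    (x₀ := 0) (s := univ) (bound := fun _ => M) Filter.univ_mem
    (Filter.Eventually.of_forall fun t =>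
      (hg.continuous.comp (continuous_id.add continuous_const)).aestronglyMeasurable)
    ((hp.shift _).integrable_of_continuous (hg.continuous.comp (continuous_id.add continuous_const)))
    (hc.comp (continuous_id.add continuous_const)).aestronglyMeasurable
    (Filter.Eventually.of_forall fun x t _ => hM _) (integrable_const M)
    (Filter.Eventually.of_forall fun x t _ => hd x t)
  have h0 := h.2
  simp only [hp.integral_add_right, zero_smul, add_zero] at h0
  exact h0.unique (hasDerivAt_const _ _)

/-! ### Functions of time -/

/-- Smooth test functions of time with compact support in `[0,τ)`. -/
structure IsTimeTest (τ : ℝ) (η : ℝ → ℝ) : Prop where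
  smooth : ContDiff ℝ ∞ η
  support : ∃ b < τ, ∀ t, b ≤ t → η t = 0

theorem IsTimeTest.eq_zero {τ : ℝ} {η : ℝ → ℝ} (hη : IsTimeTest τ η) : η τ = 0 := by
  obtain ⟨b, hb, h⟩ := hη.support
  exact h τ hb.le

theorem IsTimeTest.exists_bound {τ : ℝ} {η : ℝ → ℝ} (hη : IsTimeTest τ η) :
    ∃ M, ∀ t ∈ Ioo 0 τ, |η t| ≤ M ∧ |deriv η t| ≤ M := by
  obtain ⟨M₁, h₁⟩ := (isCompact_Icc (a := 0) (b := τ)).exists_bound_of_continuousOn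
    hη.smooth.continuous.continuousOn
  obtain ⟨M₂, h₂⟩ := (isCompact_Icc (a := 0) (b := τ)).exists_bound_of_continuousOn
    (hη.smooth.continuous_deriv (by simp)).continuousOn
  exact ⟨max M₁ M₂, fun t ht => ⟨(h₁ t (Ioo_subset_Icc_self ht)).trans (le_max_left _ _),
    (h₂ t (Ioo_subset_Icc_self ht)).trans (le_max_right _ _)⟩⟩

/-- `g' = h` on `(0,τ)` with initial value `c`, in the sense of distributions. -/
def HasWeakTimeDeriv (τ : ℝ) (g h : ℝ → ℝ) (c : ℝ) : Prop :=
  ∀ η, IsTimeTest τ η → (∫ t in Ioo 0 τ, (deriv η t * g t + η t * h t)) + η 0 * c = 0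

/-- Integration by parts for absolutely continuous functions: the boundary term at τ vanishes with
the test, the one at 0 produces the initial value. -/
theorem hasWeakTimeDeriv_of_absolutelyContinuous {τ : ℝ} (hτ : 0 < τ) {H h : ℝ → ℝ}
    (hH : AbsolutelyContinuousOnInterval H 0 τ)
    (hd : ∀ᵐ t, t ∈ uIcc 0 τ → HasDerivAt H (h t) t) : HasWeakTimeDeriv τ H h (H 0) := by
  intro η hη
  have hη' : AbsolutelyContinuousOnInterval η 0 τ :=
    (hη.smooth.of_le (by simp)).contDiffOn.absolutelyContinuousOnInterval
  have h1 := hη'.integral_deriv_mul_eq_sub hH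
  rw [hη.eq_zero, zero_mul, zero_sub, intervalIntegral.integral_of_le hτ.le,
    integral_Ioc_eq_integral_Ioo] at h1
  have h2 : ∫ t in Ioo 0 τ, (deriv η t * H t + η t * h t)
      = ∫ t in Ioo 0 τ, (deriv η t * H t + η t * deriv H t) := by
    refine setIntegral_congr_ae measurableSet_Ioo ?_
    filter_upwards [hd] with t ht hmem
    rw [(ht (by rw [uIcc_of_le hτ.le]; exact Ioo_subset_Icc_self hmem)).deriv]
  rw [h2, h1, neg_add_cancel]

theorem absolutelyContinuous_primitive {τ : ℝ} (hτ : 0 < τ) {h : ℝ → ℝ}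
    (hh : IntegrableOn h (Ioo 0 τ)) (c : ℝ) :
    AbsolutelyContinuousOnInterval (fun t => c + ∫ s in (0 : ℝ)..t, h s) 0 τ ∧
      ∀ᵐ t, t ∈ uIcc 0 τ → HasDerivAt (fun t => c + ∫ s in (0 : ℝ)..t, h s) (h t) t := by
  have hi : IntervalIntegrable h volume 0 τ :=
    (intervalIntegrable_iff_integrableOn_Ioo_of_le hτ.le).2 hh
  have hc : AbsolutelyContinuousOnInterval (fun _ : ℝ => c) 0 τ :=
    contDiffOn_const.absolutelyContinuousOnInterval
  refine ⟨hc.add (hi.absolutelyContinuousOnInterval_intervalIntegral left_mem_uIcc), ?_⟩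
  filter_upwards [hi.ae_hasDerivAt_integral] with t ht hmem
  exact (ht hmem 0 left_mem_uIcc).const_add c

/-- A function with an integrable weak derivative is the primitive of it. -/
theorem HasWeakTimeDeriv.ae_eq {τ : ℝ} (hτ : 0 < τ) {g h : ℝ → ℝ} {c : ℝ}
    (hg : IntegrableOn g (Ioo 0 τ)) (hh : IntegrableOn h (Ioo 0 τ))
    (hw : HasWeakTimeDeriv τ g h c) :
    ∀ᵐ t ∂(volume.restrict (Ioo 0 τ)), g t = c + ∫ s in (0 : ℝ)..t, h s := by
  obtain ⟨hac, hder⟩ := absolutelyContinuous_primitive hτ hh c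
  set H : ℝ → ℝ := fun t => c + ∫ s in (0 : ℝ)..t, h s with hHdef
  have hH0 : H 0 = c := by simp [hHdef]
  have hHi : IntegrableOn H (Ioo 0 τ) := by
    have hc := hac.continuousOn
    rw [uIcc_of_le hτ.le] at hc
    exact hc.integrableOn_Icc.mono_set Ioo_subset_Icc_self
  -- g and the primitive H solve the same weak equation with the same initial value, so both h and c
  -- drop out of the difference.
  have key : ∀ η, IsTimeTest τ η → ∫ t in Ioo 0 τ, deriv η t * (g t - H t) = 0 := by
    intro η hη
    have h1 := hw η hη
    have h2 := hasWeakTimeDeriv_of_absolutelyContinuous hτ hac hder η hη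
    rw [hH0] at h2
    obtain ⟨M, hM⟩ := hη.exists_bound
    have hdm : AEStronglyMeasurable (deriv η) (volume.restrict (Ioo 0 τ)) :=
      (hη.smooth.continuous_deriv (by simp)).aestronglyMeasurable
    have hm : AEStronglyMeasurable η (volume.restrict (Ioo 0 τ)) :=
      hη.smooth.continuous.aestronglyMeasurable
    have hb1 : ∀ᵐ t ∂(volume.restrict (Ioo 0 τ)), ‖deriv η t‖ ≤ M :=
      ae_restrict_of_forall_mem measurableSet_Ioo fun t ht => (hM t ht).2
    have hb2 : ∀ᵐ t ∂(volume.restrict (Ioo 0 τ)), ‖η t‖ ≤ M :=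
      ae_restrict_of_forall_mem measurableSet_Ioo fun t ht => (hM t ht).1
    have i1 : Integrable (fun t => deriv η t * g t) (volume.restrict (Ioo 0 τ)) :=
      hg.bdd_mul hdm hb1
    have i2 : Integrable (fun t => deriv η t * H t) (volume.restrict (Ioo 0 τ)) :=
      hHi.bdd_mul hdm hb1
    have i3 : Integrable (fun t => η t * h t) (volume.restrict (Ioo 0 τ)) :=
      hh.bdd_mul hm hb2
    rw [integral_add i1 i3] at h1
    rw [integral_add i2 i3] at h2
    simp_rw [mul_sub]
    rw [integral_sub i1 i2]
    linarith
  have hloc : LocallyIntegrableOn (fun t => g t - H t) (Ioo 0 τ) :=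
    (hg.sub hHi).locallyIntegrableOn
  -- Du Bois-Reymond: every bump ζ inside (0,τ) is the derivative of an admissible test, because
  -- tests need not vanish at time 0. So no constant of integration is left over.
  have hz := isOpen_Ioo.ae_eq_zero_of_integral_contDiff_smul_eq_zero hloc (μ := volume) ?_
  · rw [ae_restrict_iff' measurableSet_Ioo]
    filter_upwards [hz] with t ht hmem
    linarith [ht hmem]
  · intro ζ hζ hcomp hsupp
    -- the primitive of `ζ` that vanishes near `τ`
    set η : ℝ → ℝ := fun t => -∫ s in t..τ, ζ s with hη
    have hηd : ∀ t, HasDerivAt η (ζ t) t := fun t => by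
      have := intervalIntegral.integral_hasDerivAt_left (f := ζ) (a := t) (b := τ)
        (hζ.continuous.intervalIntegrable _ _)
        (hζ.continuous.stronglyMeasurableAtFilter _ _) hζ.continuous.continuousAt
      simpa only [neg_neg] using this.fun_neg
    have hηd' : deriv η = ζ := funext fun t => (hηd t).deriv
    have htest : IsTimeTest τ η := by
      refine ⟨?_, ?_⟩
      · rw [contDiff_infty_iff_deriv]
        exact ⟨fun t => (hηd t).differentiableAt, hηd' ▸ hζ⟩
      · obtain ⟨b, hb1, hb2⟩ : ∃ b < τ, ∀ t, b ≤ t → ζ t = 0 := by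
          rcases (tsupport ζ).eq_empty_or_nonempty with he | hne
          · exact ⟨τ - 1, by linarith, fun t _ => image_eq_zero_of_notMem_tsupport (by simp [he])⟩
          · have hmx := hcomp.isCompact.sSup_mem hne
            have hlt : sSup (tsupport ζ) < τ := (hsupp hmx).2
            refine ⟨(sSup (tsupport ζ) + τ) / 2, by linarith, fun t ht =>
              image_eq_zero_of_notMem_tsupport fun hmem => ?_⟩
            have := le_csSup hcomp.isCompact.bddAbove hmem
            linarith
        refine ⟨b, hb1, fun t ht => ?_⟩
        simp only [hη, neg_eq_zero]
        refine intervalIntegral.integral_zero_ae (Filter.Eventually.of_forall fun s hs => hb2 s ?_)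
        exact (le_min ht hb1.le).trans hs.1.le
    have := key η htest
    rw [hηd'] at this
    rw [← this, ← integral_indicator measurableSet_Ioo]
    congr 1
    ext t
    by_cases ht : t ∈ Ioo 0 τ
    · simp [indicator_of_mem ht]
    · rw [indicator_of_notMem ht, image_eq_zero_of_notMem_tsupport fun h => ht (hsupp h), zero_smul]

/-- The chain rule for the square of a function with an integrable weak derivative. -/
theorem HasWeakTimeDeriv.sq {τ : ℝ} (hτ : 0 < τ) {g h : ℝ → ℝ} {c : ℝ}
    (hg : IntegrableOn g (Ioo 0 τ)) (hh : IntegrableOn h (Ioo 0 τ))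
    (hw : HasWeakTimeDeriv τ g h c) :
    HasWeakTimeDeriv τ (fun t => g t ^ 2) (fun t => 2 * (g t * h t)) (c ^ 2) := by
  obtain ⟨hac, hder⟩ := absolutelyContinuous_primitive hτ hh c
  have hae := hw.ae_eq hτ hg hh
  -- g equals its primitive almost everywhere, and the square of an absolutely continuous function
  -- is absolutely continuous with the classical product rule.
  have hsq := hasWeakTimeDeriv_of_absolutelyContinuous hτ
    (h := fun t => h t * (c + ∫ s in (0 : ℝ)..t, h s) + (c + ∫ s in (0 : ℝ)..t, h s) * h t)
    (hac.fun_mul hac) (by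
      filter_upwards [hder] with t ht hmem
      exact (ht hmem).mul (ht hmem))
  intro η hη
  have h1 := hsq η hη
  simp only [intervalIntegral.integral_same, add_zero] at h1
  refine Eq.trans ?_ h1
  rw [pow_two c]
  congr 1
  refine integral_congr_ae ?_
  filter_upwards [hae] with t ht
  rw [ht]
  ring

/-! ### Decrease of an almost everywhere nonincreasing function -/

theorem IsTimeCutoff.hasCompactSupport {T : ℝ} {ψ : ℝ → ℝ} (hψ : IsTimeCutoff T ψ) :
    HasCompactSupport ψ := by
  obtain ⟨_, _, a, b, _, _, h⟩ := hψ
  exact HasCompactSupport.intro (K := Icc a b) isCompact_Icc fun t ht => h t ht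

/-- Moving the shift onto g leaves ψ(t)(g(t-h) - g(t)), whose second factor is nonnegative on [a,b];
so ψ may be replaced by 1 there. The integral then telescopes to the windows (a-h,a) and (b-h,b),
each of length h, on which g lies between E₀ - R and E₀. -/
theorem integral_comp_sub_sub_le {τ R E₀ : ℝ} {g ψ : ℝ → ℝ} (hgi : Integrable g)
    (hup : ∀ᵐ t, t ∈ Ioo 0 τ → g t ≤ E₀) (hlow : ∀ᵐ t, t ∈ Ioo 0 τ → E₀ - R ≤ g t)
    {a b h : ℝ} (hh : 0 < h) (hha : h < a) (hhb : h < b) (hb : b < τ) (hab : a ≤ b)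
    (hψc : Continuous ψ) (hψ01 : ∀ t, ψ t ∈ Icc (0 : ℝ) 1) (hψs : ∀ t, t ∉ Icc a b → ψ t = 0)
    (hmono : ∀ᵐ t, t ∈ Icc a b → g t ≤ g (t - h)) :
    (∫ t, ψ (t + h) * g t) - ∫ t, ψ t * g t ≤ h * R := by
  have hgs : Integrable fun t => g (t - h) := hgi.comp_sub_right h
  have hb : ∀ᵐ t, ‖ψ t‖ ≤ 1 := Filter.Eventually.of_forall fun t => by
    rw [Real.norm_eq_abs, abs_of_nonneg (hψ01 t).1]; exact (hψ01 t).2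
  have i1 : Integrable fun t => ψ t * g t := hgi.bdd_mul hψc.aestronglyMeasurable hb
  have i2 : Integrable fun t => ψ t * g (t - h) := hgs.bdd_mul hψc.aestronglyMeasurable hb
  have e1 : ∫ t, ψ (t + h) * g t = ∫ t, ψ t * g (t - h) := by
    rw [← integral_sub_right_eq_self (fun t => ψ (t + h) * g t) h]
    simp
  rw [e1, ← integral_sub i2 i1]
  have e2 : ∫ t, (ψ t * g (t - h) - ψ t * g t) ≤ ∫ t in Icc a b, (g (t - h) - g t) := by
    rw [← integral_indicator measurableSet_Icc]
    refine integral_mono_ae (i2.sub i1) ((hgs.sub hgi).indicator measurableSet_Icc) ?_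
    filter_upwards [hmono] with t ht
    by_cases hmem : t ∈ Icc a b
    · rw [indicator_of_mem hmem]
      nlinarith [ht hmem, (hψ01 t).2, (hψ01 t).1]
    · rw [indicator_of_notMem hmem, hψs t hmem]
      simp
  refine e2.trans ?_
  rw [integral_sub hgs.integrableOn hgi.integrableOn, integral_Icc_eq_integral_Ioc,
    integral_Icc_eq_integral_Ioc, ← intervalIntegral.integral_of_le hab,
    ← intervalIntegral.integral_of_le hab, intervalIntegral.integral_comp_sub_right]
  have ii : ∀ x y, IntervalIntegrable g volume x y := fun x y => hgi.intervalIntegrable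
  have e3 : (∫ x in (a - h)..(b - h), g x) - ∫ x in a..b, g x
      = (∫ x in (a - h)..a, g x) - ∫ x in (b - h)..b, g x :=
    intervalIntegral.integral_interval_sub_interval_comm (ii _ _) (ii _ _) (ii _ _)
  rw [e3]
  have u1 : ∫ x in (a - h)..a, g x ≤ ∫ _x in (a - h)..a, E₀ := by
    refine intervalIntegral.integral_mono_ae_restrict (by linarith) (ii _ _)
      intervalIntegrable_const ?_
    filter_upwards [ae_restrict_of_ae hup, ae_restrict_mem measurableSet_Icc] with t ht hmem
    exact ht ⟨by linarith [hmem.1], by linarith [hmem.2]⟩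
  have u2 : ∫ _x in (b - h)..b, (E₀ - R) ≤ ∫ x in (b - h)..b, g x := by
    refine intervalIntegral.integral_mono_ae_restrict (by linarith) intervalIntegrable_const
      (ii _ _) ?_
    filter_upwards [ae_restrict_of_ae hlow, ae_restrict_mem measurableSet_Icc] with t ht hmem
    exact ht ⟨by linarith [hmem.1], by linarith [hmem.2]⟩
  simp only [intervalIntegral.integral_const, smul_eq_mul, sub_sub_cancel] at u1 u2
  linarith

/-- The shift acts on the smooth factor, so mere integrability of g is enough. This turns the finite
differences of `integral_comp_sub_sub_le` into a bound for ∫ ψ' g. -/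
theorem hasDerivAt_integral_comp_add {ψ g : ℝ → ℝ} (hψ : ContDiff ℝ ∞ ψ)
    (hc : HasCompactSupport ψ) (hg : Integrable g) :
    HasDerivAt (fun h => ∫ t, ψ (t + h) * g t) (∫ t, deriv ψ t * g t) 0 := by
  have hdc := hψ.continuous_deriv (by simp)
  obtain ⟨M, hM⟩ := hc.deriv.exists_bound_of_continuous hdc
  obtain ⟨M₀, hM₀⟩ := hc.exists_bound_of_continuous hψ.continuous
  have := hasDerivAt_integral_of_dominated_loc_of_deriv_le (μ := volume) (𝕜 := ℝ)
    (F := fun (h : ℝ) t => ψ (t + h) * g t) (F' := fun (h : ℝ) t => deriv ψ (t + h) * g t)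
    (x₀ := 0) (s := univ) (bound := fun t => M * ‖g t‖) Filter.univ_mem
    (Filter.Eventually.of_forall fun h =>
      (hψ.continuous.comp (continuous_id.add continuous_const)).aestronglyMeasurable.mul hg.1)
    (hg.bdd_mul (hψ.continuous.comp (continuous_id.add continuous_const)).aestronglyMeasurable
      (Filter.Eventually.of_forall fun t => hM₀ _))
    ((hdc.comp (continuous_id.add continuous_const)).aestronglyMeasurable.mul hg.1)
    (Filter.Eventually.of_forall fun t h _ => by
      rw [norm_mul]; exact mul_le_mul_of_nonneg_right (hM _) (norm_nonneg _))
    (hg.norm.const_mul M)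
    (Filter.Eventually.of_forall fun t h _ =>
      (((hψ.differentiable (by simp)) (t + h)).hasDerivAt.comp_const_add t h).mul_const (g t))
  simpa using this.2

/-- The shear (s,h) ↦ (s,s+h) preserves Lebesgue measure. Measurability is needed to pass from
iterated null sets to a null set of the plane. -/
theorem ae_ae_add_of_ae_ae {P : ℝ → ℝ → Prop} (hP : MeasurableSet {z : ℝ × ℝ | P z.1 z.2})
    (h : ∀ᵐ s, ∀ᵐ t, P s t) : ∀ᵐ h, ∀ᵐ s, P s (s + h) := by
  have h1 : ∀ᵐ z : ℝ × ℝ ∂(volume.prod volume), P z.1 z.2 :=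
    (Measure.ae_prod_iff_ae_ae hP).2 h
  have h2 : ∀ᵐ z : ℝ × ℝ ∂(volume.prod volume), P z.1 (z.1 + z.2) :=
    (measurePreserving_prod_add (volume : Measure ℝ) volume).quasiMeasurePreserving.ae h1
  have h3 : ∀ᵐ z : ℝ × ℝ ∂(volume.prod volume), P z.2 (z.2 + z.1) :=
    (Measure.measurePreserving_swap (μ := (volume : Measure ℝ))
      (ν := (volume : Measure ℝ))).quasiMeasurePreserving.ae h2
  exact Measure.ae_ae_of_ae_prod h3

/-- The total variation of a nonincreasing function, tested with a cutoff. -/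
theorem integral_deriv_cutoff_mul_le {τ R E₀ : ℝ} {G ψ : ℝ → ℝ} (hG : IntegrableOn G (Ioo 0 τ))
    (hmono : ∀ᵐ s ∂(volume.restrict (Ioo 0 τ)), ∀ᵐ t ∂(volume.restrict (Ioo 0 τ)),
      s < t → G t ≤ G s)
    (hup : ∀ᵐ t ∂(volume.restrict (Ioo 0 τ)), G t ≤ E₀)
    (hlow : ∀ᵐ t ∂(volume.restrict (Ioo 0 τ)), E₀ - R ≤ G t) (hR : 0 ≤ R)
    (hψ : IsTimeCutoff τ ψ) : ∫ t in Ioo 0 τ, deriv ψ t * G t ≤ R := by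
  have hcs := hψ.hasCompactSupport
  obtain ⟨hψs, hψ01, a, b, ha, hb, hsupp⟩ := hψ
  rcases lt_or_ge b a with hab | hab
  · have h0 : ψ = 0 := funext fun t => hsupp t (by simp [hab])
    simpa [h0] using hR
  -- A Borel representative, extended by zero: it makes the set of monotone pairs measurable, and
  -- shifts of g are defined on the whole line.
  set g : ℝ → ℝ := (Ioo 0 τ).indicator (hG.1.mk G) with hg
  have hgm : Measurable g := hG.1.stronglyMeasurable_mk.measurable.indicator measurableSet_Ioo
  have hgG : ∀ᵐ t, t ∈ Ioo 0 τ → G t = g t := by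
    filter_upwards [(ae_restrict_iff' measurableSet_Ioo).1 hG.1.ae_eq_mk] with t ht hmem
    rw [hg, indicator_of_mem hmem, ht hmem]
  have hgi : Integrable g :=
    (integrable_indicator_iff measurableSet_Ioo).2 (hG.congr hG.1.ae_eq_mk)
  rw [ae_restrict_iff' measurableSet_Ioo] at hup hlow hmono
  have hup' : ∀ᵐ t, t ∈ Ioo 0 τ → g t ≤ E₀ := by
    filter_upwards [hup, hgG] with t h1 h2 hmem
    exact h2 hmem ▸ h1 hmem
  have hlow' : ∀ᵐ t, t ∈ Ioo 0 τ → E₀ - R ≤ g t := by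
    filter_upwards [hlow, hgG] with t h1 h2 hmem
    exact h2 hmem ▸ h1 hmem
  have hmono' : ∀ᵐ s, ∀ᵐ t, s ∈ Ioo 0 τ → t ∈ Ioo 0 τ → s < t → g t ≤ g s := by
    filter_upwards [hmono, hgG] with s h1 h2
    by_cases hs : s ∈ Ioo 0 τ
    · filter_upwards [(ae_restrict_iff' measurableSet_Ioo).1 (h1 hs), hgG] with t h3 h4 _ ht hst
      rw [← h2 hs, ← h4 ht]
      exact h3 ht hst
    · exact Filter.Eventually.of_forall fun t h => absurd h hs
  have hshift := ae_ae_add_of_ae_ae (P := fun s t => s ∈ Ioo 0 τ → t ∈ Ioo 0 τ → s < t → g t ≤ g s)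
    (by
      have e : {z : ℝ × ℝ | z.1 ∈ Ioo 0 τ → z.2 ∈ Ioo 0 τ → z.1 < z.2 → g z.2 ≤ g z.1}
          = (Prod.fst ⁻¹' Ioo 0 τ)ᶜ ∪ ((Prod.snd ⁻¹' Ioo 0 τ)ᶜ ∪ ({z | z.1 < z.2}ᶜ
            ∪ {z | g z.2 ≤ g z.1})) := by
        ext z
        simp only [mem_ofPred_eq, mem_union, mem_compl_iff, mem_preimage]
        tauto
      rw [e]
      exact (measurable_fst measurableSet_Ioo).compl.union
        ((measurable_snd measurableSet_Ioo).compl.union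
          ((measurableSet_lt measurable_fst measurable_snd).compl.union
            (measurableSet_le (hgm.comp measurable_snd) (hgm.comp measurable_fst))))) hmono'
  set J : ℝ → ℝ := fun h => ∫ t, ψ (t + h) * g t with hJ
  have hJ' := hasDerivAt_integral_comp_add hψs hcs hgi
  have hkey : ∀ᵐ h, 0 < h → h < a → J h - J 0 ≤ h * R := by
    filter_upwards [hshift] with h hh h0 hha
    have : ∀ᵐ t, t ∈ Icc a b → g t ≤ g (t - h) := by
      have h1 := (measurePreserving_sub_right (volume : Measure ℝ) h).quasiMeasurePreserving.ae hh
      filter_upwards [h1] with t ht hmem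
      rw [sub_add_cancel] at ht
      exact ht ⟨by linarith [hmem.1], by linarith [hmem.2]⟩
        ⟨by linarith [hmem.1], by linarith [hmem.2]⟩ (by linarith)
    have := integral_comp_sub_sub_le hgi hup' hlow' h0 hha (hha.trans_le hab) hb hab
      hψs.continuous hψ01 hsupp this
    simpa [hJ] using this
  -- Monotonicity along a shift h is known for almost every h only. As J is differentiable at 0, its
  -- slope needs to be bounded only for some arbitrarily small h > 0.
  have hfreq : ∃ᶠ h in nhdsWithin (0 : ℝ) (Ioi 0), slope J 0 h ≤ R := by
    rw [Filter.frequently_iff]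
    intro U hU
    obtain ⟨δ, hδ, hsub⟩ := mem_nhdsGT_iff_exists_Ioo_subset.1 hU
    have hne : ∃ h ∈ Ioo 0 (min δ a), J h - J 0 ≤ h * R := by
      by_contra! hcon
      have hnull : volume (Ioo 0 (min δ a)) = 0 := by
        refine measure_mono_null (fun h hh => ?_) hkey
        simp only [mem_compl_iff, mem_ofPred_eq, not_forall]
        exact ⟨hh.1, hh.2.trans_le (min_le_right _ _), not_le.2 (hcon h hh)⟩
      rw [Real.volume_Ioo, ENNReal.ofReal_eq_zero] at hnull
      have : 0 < min δ a := lt_min hδ ha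
      linarith
    obtain ⟨h, hh, hle⟩ := hne
    refine ⟨h, hsub ⟨hh.1, hh.2.trans_le (min_le_left _ _)⟩, ?_⟩
    rw [slope_def_field, sub_zero, div_le_iff₀ hh.1, mul_comm R]
    exact hle
  have htend := (hasDerivAt_iff_tendsto_slope.1 hJ').mono_left
    (nhdsWithin_mono (0 : ℝ) fun x (hx : 0 < x) => hx.ne')
  have hle : ∫ t, deriv ψ t * g t ≤ R := le_of_tendsto_of_frequently htend hfreq
  convert! hle using 1
  rw [← integral_indicator measurableSet_Ioo]
  refine integral_congr_ae ?_
  filter_upwards [hgG] with t ht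
  by_cases hmem : t ∈ Ioo 0 τ
  · rw [indicator_of_mem hmem, ht hmem]
  · rw [indicator_of_notMem hmem, hg, indicator_of_notMem hmem, mul_zero]

/-! ### Mollifiers on the torus -/

/-- The cube `(0,ℓ)^d`. -/
def smallCube (d : ℕ) (ℓ : ℝ) : Set (Euc d) := {x | ∀ i, x i ∈ Ioo (0 : ℝ) ℓ}

/-- A periodic mollifier at scale `ℓ`, supported modulo the lattice in `(0,ℓ)^d`. -/
structure IsMollifier {d : ℕ} (ℓ M : ℝ) (k : Euc d → ℝ) : Prop where
  smooth : ContDiff ℝ ∞ k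
  periodic : TorusPeriodic k
  nonneg : ∀ x, 0 ≤ k x
  integral_eq_one : ∫ x, k x ∂(torusMeasure d) = 1
  eq_zero : ∀ x ∈ cell d, x ∉ smallCube d ℓ → k x = 0
  partialDeriv_eq_zero : ∀ j, ∀ x ∈ cell d, x ∉ smallCube d ℓ → partialDeriv k j x = 0
  le : ∀ x, k x ≤ M / ℓ ^ d
  abs_partialDeriv_le : ∀ j x, |partialDeriv k j x| ≤ M / ℓ ^ (d + 1)

/-- A fixed profile χ supported in [1/4,3/4] is rescaled to [0,ℓ] and made periodic through the
fractional part. M bounds χ and χ', hence does not depend on ℓ. -/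
theorem exists_periodic_bump : ∃ M : ℝ, 0 ≤ M ∧ ∀ ℓ : ℝ, 0 < ℓ → ℓ ≤ 1 → ∃ θ : ℝ → ℝ,
    ContDiff ℝ ∞ θ ∧ (∀ t, θ (t + 1) = θ t) ∧ (∀ t, 0 ≤ θ t) ∧ (∫ t in Ico (0 : ℝ) 1, θ t = 1) ∧
    (∀ t ∈ Ico (0 : ℝ) 1, t ∉ Ioo 0 ℓ → θ t = 0 ∧ deriv θ t = 0) ∧
    (∀ t, θ t ≤ M / ℓ) ∧ ∀ t, |deriv θ t| ≤ M / ℓ ^ 2 := by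
  let f : ContDiffBump (1 / 2 : ℝ) := ⟨1 / 8, 1 / 4, by norm_num, by norm_num⟩
  set χ : ℝ → ℝ := f.normed volume with hχ
  have hχs : ContDiff ℝ ∞ χ := f.contDiff_normed
  have hχt : tsupport χ = Icc (1 / 4) (3 / 4) := by
    rw [hχ, f.tsupport_normed_eq, Real.closedBall_eq_Icc]
    norm_num [f]
  have hχ0 : ∀ t, t ∉ Icc (1 / 4 : ℝ) (3 / 4) → χ t = 0 := fun t ht =>
    image_eq_zero_of_notMem_tsupport (hχt ▸ ht)
  have hχ0' : ∀ t, t ∉ Icc (1 / 4 : ℝ) (3 / 4) → deriv χ t = 0 := fun t ht =>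
    image_eq_zero_of_notMem_tsupport fun h => ht (hχt ▸ tsupport_deriv_subset h)
  have hχc : HasCompactSupport χ := f.hasCompactSupport_normed
  obtain ⟨M₁, hM₁⟩ := hχc.exists_bound_of_continuous hχs.continuous
  obtain ⟨M₂, hM₂⟩ := hχc.deriv.exists_bound_of_continuous (hχs.continuous_deriv (by simp))
  have hM0 : 0 ≤ max M₁ M₂ := (norm_nonneg _).trans ((hM₁ 0).trans (le_max_left _ _))
  refine ⟨max M₁ M₂, hM0, fun ℓ hℓ hℓ1 => ?_⟩
  set θ : ℝ → ℝ := fun t => ℓ⁻¹ * χ (ℓ⁻¹ * Int.fract t) with hθ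
  have hone : 1 ≤ ℓ⁻¹ := one_le_inv_iff₀.2 ⟨hℓ, hℓ1⟩
  -- The fractional part jumps at n, but the formula valid on [n,n+1) persists down to n - 1/8 since
  -- both sides vanish there: the fractional part exceeds 7/8 > 3/4 and ℓ⁻¹ ≥ 1. This gives
  -- smoothness across the integers.
  have hloc : ∀ (n : ℤ) (t : ℝ), t ∈ Ioo ((n : ℝ) - 1 / 8) (n + 1) →
      θ t = ℓ⁻¹ * χ (ℓ⁻¹ * (t - n)) := by
    intro n t ht
    rcases le_or_gt (n : ℝ) t with h | h
    · have : ⌊t⌋ = n := Int.floor_eq_iff.2 ⟨h, ht.2⟩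
      simp only [hθ, Int.fract, this]
    · have hfl : ⌊t⌋ = n - 1 :=
        Int.floor_eq_iff.2 ⟨by push_cast; linarith [ht.1], by push_cast; linarith⟩
      have h1 : χ (ℓ⁻¹ * (t - n)) = 0 := hχ0 _ fun hmem => by
        have : ℓ⁻¹ * (t - n) ≤ 0 :=
          mul_nonpos_of_nonneg_of_nonpos (by positivity) (by linarith)
        linarith [hmem.1]
      have h2 : χ (ℓ⁻¹ * Int.fract t) = 0 := hχ0 _ fun hmem => by
        have h3 : 7 / 8 < Int.fract t := by
          simp only [Int.fract, hfl]; push_cast; linarith [ht.1]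
        nlinarith [hmem.2]
      simp only [hθ, h1, h2]
  have hev : ∀ t : ℝ, θ =ᶠ[nhds t] fun s => ℓ⁻¹ * χ (ℓ⁻¹ * (s - ⌊t⌋)) := fun t =>
    Filter.eventuallyEq_of_mem (Ioo_mem_nhds (by linarith [Int.floor_le t]) (Int.lt_floor_add_one t))
      fun s hs => hloc ⌊t⌋ s hs
  have hderiv : ∀ t, deriv θ t = ℓ⁻¹ * (ℓ⁻¹ * deriv χ (ℓ⁻¹ * Int.fract t)) := by
    intro t
    rw [(hev t).deriv_eq]
    have h1 : HasDerivAt (fun s : ℝ => ℓ⁻¹ * (s - ⌊t⌋)) ℓ⁻¹ t := by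
      simpa using ((hasDerivAt_id t).sub_const (⌊t⌋ : ℝ)).const_mul ℓ⁻¹
    have h2 := (((hχs.differentiable (by simp)) (ℓ⁻¹ * (t - ⌊t⌋))).hasDerivAt.comp t h1).const_mul
      ℓ⁻¹
    rw [mul_comm (deriv χ _)] at h2
    exact h2.deriv
  have hfr : ∀ t ∈ Ico (0 : ℝ) 1, Int.fract t = t := fun t ht => Int.fract_eq_self.2 ht
  refine ⟨θ, ?_, ?_, ?_, ?_, ?_, ?_, ?_⟩
  · rw [contDiff_iff_contDiffAt]
    intro t
    refine ContDiffAt.congr_of_eventuallyEq ?_ (hev t)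
    fun_prop
  · intro t
    simp [hθ]
  · intro t
    have := f.nonneg_normed (μ := volume) (ℓ⁻¹ * Int.fract t)
    positivity
  · have e1 : ∫ t in Ico (0 : ℝ) 1, θ t = ∫ t in Ico (0 : ℝ) 1, ℓ⁻¹ * χ (ℓ⁻¹ * t) :=
      setIntegral_congr_fun measurableSet_Ico fun t ht => by simp only [hθ, hfr t ht]
    have e2 : ∫ t in Ico (0 : ℝ) 1, ℓ⁻¹ * χ (ℓ⁻¹ * t) = ∫ t, ℓ⁻¹ * χ (ℓ⁻¹ * t) := by
      refine setIntegral_eq_integral_of_forall_compl_eq_zero fun t ht => ?_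
      rw [hχ0, mul_zero]
      intro hmem
      refine ht ⟨?_, ?_⟩
      · by_contra! h
        nlinarith [hmem.1]
      · by_contra! h
        nlinarith [hmem.2]
    rw [e1, e2, integral_const_mul, Measure.integral_comp_mul_left, f.integral_normed]
    simp [abs_of_pos hℓ, hℓ.ne']
  · intro t ht hnt
    have : ℓ⁻¹ * t ∉ Icc (1 / 4 : ℝ) (3 / 4) := by
      intro hmem
      refine hnt ⟨?_, ?_⟩
      · by_contra! h
        nlinarith [hmem.1]
      · have := mul_le_mul_of_nonneg_left hmem.2 hℓ.le
        rw [mul_inv_cancel_left₀ hℓ.ne'] at this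
        linarith
    rw [hderiv]
    simp only [hθ, hfr t ht, hχ0 _ this, hχ0' _ this, mul_zero, and_self]
  · intro t
    rw [div_eq_inv_mul]
    exact mul_le_mul_of_nonneg_left ((le_abs_self _).trans ((hM₁ _).trans (le_max_left _ _)))
      (by positivity)
  · intro t
    rw [hderiv, abs_mul, abs_mul, abs_of_pos (inv_pos.2 hℓ), ← mul_assoc, ← sq, inv_pow,
      div_eq_inv_mul]
    exact mul_le_mul_of_nonneg_left ((hM₂ _).trans (le_max_right _ _)) (by positivity)

theorem integral_torus_prod {d : ℕ} (θ : ℝ → ℝ) :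
    ∫ x, ∏ i, θ (x i) ∂(torusMeasure d) = ∏ _i : Fin d, ∫ t in Ico (0 : ℝ) 1, θ t := by
  have h := (EuclideanSpace.volume_preserving_symm_measurableEquiv_toLp
    (Fin d)).setIntegral_preimage_emb (MeasurableEquiv.measurableEmbedding _)
      (fun y : Fin d → ℝ => ∏ i, θ (y i)) (Set.univ.pi fun _ => Ico (0 : ℝ) 1)
  rw [torusMeasure, cell_eq_preimage]
  refine h.trans ?_
  rw [volume_pi, Measure.restrict_pi_pi]
  exact integral_fintype_prod_eq_prod (fun _ => θ)

theorem hasDerivAt_line {d : ℕ} {g : Euc d → ℝ} {x : Euc d} (hg : DifferentiableAt ℝ g x)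
    (j : Fin d) : HasDerivAt (fun s : ℝ => g (x + s • EuclideanSpace.single j (1 : ℝ)))
      (partialDeriv g j x) 0 := by
  have h1 : HasDerivAt (fun s : ℝ => x + s • EuclideanSpace.single j (1 : ℝ))
      (EuclideanSpace.single j (1 : ℝ)) 0 := by
    simpa using ((hasDerivAt_id (0 : ℝ)).smul_const (EuclideanSpace.single j (1 : ℝ))).const_add x
  refine HasFDerivAt.comp_hasDerivAt (f := fun s : ℝ => x + s • EuclideanSpace.single j (1 : ℝ))
    (0 : ℝ) (l := g) ?_ h1
  simpa using hg.hasFDerivAt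

theorem partialDeriv_prod {d : ℕ} {θ : ℝ → ℝ} (hθ : ContDiff ℝ ∞ θ) (j : Fin d) (x : Euc d) :
    partialDeriv (fun x : Euc d => ∏ i, θ (x i)) j x
      = deriv θ (x j) * ∏ i ∈ Finset.univ.erase j, θ (x i) := by
  have hs : ContDiff ℝ ∞ (fun x : Euc d => ∏ i, θ (x i)) :=
    contDiff_prod fun i _ => hθ.comp (by fun_prop)
  have h := hasDerivAt_line (hs.differentiable (by simp) x) j
  have e : (fun s : ℝ => ∏ i, θ ((x + s • EuclideanSpace.single j (1 : ℝ)) i))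
      = fun s => θ (x j + s) * ∏ i ∈ Finset.univ.erase j, θ (x i) := by
    funext s
    rw [← Finset.mul_prod_erase _ _ (Finset.mem_univ j)]
    congr 1
    · simp
    · refine Finset.prod_congr rfl fun i hi => ?_
      simp [Finset.ne_of_mem_erase hi]
  rw [e] at h
  have h2 : HasDerivAt (fun s => θ (x j + s) * ∏ i ∈ Finset.univ.erase j, θ (x i))
      (deriv θ (x j) * ∏ i ∈ Finset.univ.erase j, θ (x i)) 0 := by
    refine HasDerivAt.mul_const ?_ _
    have := ((hθ.differentiable (by simp)) (x j + 0)).hasDerivAt.comp_const_add (x j) 0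
    simpa using this
  exact h.unique h2

/-- The kernel is the product of d one-dimensional bumps; a derivative replaces one factor M/ℓ by
M/ℓ², so M^d serves for both bounds. -/
theorem exists_isMollifier (d : ℕ) : ∃ M : ℝ, 0 ≤ M ∧ ∀ ℓ : ℝ, 0 < ℓ → ℓ ≤ 1 →
    ∃ k : Euc d → ℝ, IsMollifier ℓ M k := by
  obtain ⟨M, hM, hex⟩ := exists_periodic_bump
  refine ⟨M ^ d, by positivity, fun ℓ hℓ hℓ1 => ?_⟩
  obtain ⟨θ, hs, hp, h0, hint, hsupp, hle, hdle⟩ := hex ℓ hℓ hℓ1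
  have hprod : ∀ (s : Finset (Fin d)) (x : Euc d), |∏ i ∈ s, θ (x i)| ≤ (M / ℓ) ^ s.card := by
    intro s x
    rw [abs_of_nonneg (Finset.prod_nonneg fun i _ => h0 _)]
    exact (Finset.prod_le_prod (fun i _ => h0 _) fun i _ => hle _).trans_eq (Finset.prod_const _)
  refine ⟨fun x => ∏ i, θ (x i), contDiff_prod fun i _ => hs.comp (by fun_prop), ?_,
    fun x => Finset.prod_nonneg fun i _ => h0 _, ?_, ?_, ?_, ?_, ?_⟩
  · intro j x
    refine Finset.prod_congr rfl fun i _ => ?_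
    by_cases h : i = j
    · subst h; simp [hp]
    · simp [h]
  · rw [integral_torus_prod, hint, Finset.prod_const_one]
  · intro x hx hxc
    simp only [smallCube, mem_ofPred_eq, not_forall] at hxc
    obtain ⟨i, hi⟩ := hxc
    exact Finset.prod_eq_zero (Finset.mem_univ i) (hsupp _ (hx i) hi).1
  · intro j x hx hxc
    simp only [smallCube, mem_ofPred_eq, not_forall] at hxc
    obtain ⟨i, hi⟩ := hxc
    rw [partialDeriv_prod hs]
    by_cases h : i = j
    · subst h; rw [(hsupp _ (hx i) hi).2, zero_mul]
    · rw [Finset.prod_eq_zero (Finset.mem_erase.2 ⟨h, Finset.mem_univ i⟩) (hsupp _ (hx i) hi).1,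
        mul_zero]
  · intro x
    have := (le_abs_self _).trans (hprod Finset.univ x)
    simpa [div_pow] using this
  · intro j x
    rw [partialDeriv_prod hs, abs_mul]
    refine (mul_le_mul (hdle _) (hprod _ x) (abs_nonneg _) (by positivity)).trans (le_of_eq ?_)
    rw [Finset.card_erase_of_mem (Finset.mem_univ j), Finset.card_univ, Fintype.card_fin, div_pow,
      div_mul_div_comm, ← pow_succ', ← pow_add]
    -- The index j forces d > 0, so that (d - 1) + 1 = d in the exponents.
    have := j.pos
    congr 2 <;> omega

/-! ### Averages of functions on the torus -/

/-- The correlation `y ↦ ∫ k(x - y) g(x) dx` on the torus. -/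
noncomputable def torusAvg {d : ℕ} (k g : Euc d → ℝ) (y : Euc d) : ℝ :=
  ∫ x, k (x - y) * g x ∂(torusMeasure d)

theorem TorusPeriodic.shift_sub {d : ℕ} {F : Type*} {g : Euc d → F} (hg : TorusPeriodic g)
    (r : Euc d) : TorusPeriodic fun x => g (x - r) := by
  simpa only [sub_eq_add_neg] using hg.shift (-r)

/-- In this form a kernel supported in (0,ℓ)^d sees g only at y + r with all coordinates of r
positive, which are the increments that `besovNorm` controls. -/
theorem torusAvg_eq_shift {d : ℕ} {k g : Euc d → ℝ} (hk : TorusPeriodic k) (hg : TorusPeriodic g)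
    (y : Euc d) : torusAvg k g y = ∫ r, k r * g (y + r) ∂(torusMeasure d) := by
  have h := ((hk.shift_sub y).comp₂ hg (· * ·)).integral_add_right y
  simp only [add_sub_cancel_right] at h
  rw [torusAvg, ← h]
  simp only [add_comm]

theorem torusPeriodic_torusAvg {d : ℕ} {k : Euc d → ℝ} (hk : TorusPeriodic k) (g : Euc d → ℝ) :
    TorusPeriodic (torusAvg k g) := by
  intro i y
  refine integral_congr_ae (Filter.Eventually.of_forall fun x => ?_)
  have := hk i (x - (y + EuclideanSpace.single i (1 : ℝ)))
  rw [← sub_sub, sub_add_cancel] at this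
  simp only [this, ← sub_sub]

theorem partialDeriv_comp_sub {d : ℕ} (k : Euc d → ℝ) (y : Euc d) (j : Fin d) (x : Euc d) :
    partialDeriv (fun x => k (x - y)) j x = partialDeriv k j (x - y) := by
  rw [partialDeriv, fderiv_comp_sub, partialDeriv]

theorem fderiv_apply_eq_sum {d : ℕ} (φ : Euc d → ℝ) (x w : Euc d) :
    fderiv ℝ φ x w = ∑ i, w i * partialDeriv φ i x := by
  have h : w = ∑ i, w i • EuclideanSpace.single i (1 : ℝ) := by
    have := (EuclideanSpace.basisFun (Fin d) ℝ).sum_repr w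
    simpa using this.symm
  conv_lhs => rw [h]
  simp [partialDeriv]

theorem integrable_kernel_mul {d : ℕ} {k g : Euc d → ℝ} (hk : Continuous k) (hp : TorusPeriodic k)
    (hg : Integrable g (torusMeasure d)) (y : Euc d) :
    Integrable (fun x => k (x - y) * g x) (torusMeasure d) := by
  obtain ⟨M, hM⟩ := hp.exists_bound hk
  exact hg.bdd_mul (hk.comp (continuous_id.sub continuous_const)).aestronglyMeasurable
    (Filter.Eventually.of_forall fun x => hM _)

theorem abs_torusAvg_le {d : ℕ} {k g : Euc d → ℝ} {M : ℝ} (hM : ∀ x, |k x| ≤ M)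
    (hg : Integrable g (torusMeasure d)) (y : Euc d) :
    |torusAvg k g y| ≤ M * ∫ x, |g x| ∂(torusMeasure d) := by
  rw [← integral_const_mul, ← Real.norm_eq_abs]
  refine norm_integral_le_of_norm_le (hg.abs.const_mul M) (Filter.Eventually.of_forall fun x => ?_)
  rw [norm_mul]
  exact mul_le_mul_of_nonneg_right (hM _) (abs_nonneg _)

/-- The average is a convolution on the whole space, evaluated at 0, whose kernel depends smoothly
on the parameter y. Compact support of the kernel is enforced by a cutoff η that equals 1 on the
reflected cell and so does not affect the integral. -/
theorem contDiff_torusAvg {d : ℕ} {k g : Euc d → ℝ} (hk : ContDiff ℝ ∞ k)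
    (hg : Integrable g (torusMeasure d)) : ContDiff ℝ ∞ (torusAvg k g) := by
  obtain ⟨R, hR⟩ := (isCompact_closedCell d).isBounded.subset_closedBall (0 : Euc d)
  let η : ContDiffBump (0 : Euc d) := ⟨max R 1, max R 1 + 1, by positivity, by linarith⟩
  have hη : ∀ x ∈ cell d, η (-x) = 1 := fun x hx => η.one_of_mem_closedBall (by
    have := hR (cell_subset_closedCell d hx)
    rw [mem_closedBall_zero_iff] at this ⊢
    rw [norm_neg]
    exact this.trans (le_max_left _ _))
  have hloc : LocallyIntegrable ((cell d).indicator g) :=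
    ((integrable_indicator_iff (measurableSet_cell d)).2 hg).locallyIntegrable
  have h := contDiffOn_convolution_right_with_param_comp (μ := (volume : Measure (Euc d)))
    (n := ⊤) (𝕜 := ℝ) (ContinuousLinearMap.mul ℝ ℝ) (s := (univ : Set (Euc d)))
    (v := fun _ => (0 : Euc d)) contDiffOn_const (f := (cell d).indicator g)
    (g := fun y z => η z * k (-z - y)) (k := tsupport η) isOpen_univ η.hasCompactSupport
    (fun y z _ hz => by rw [image_eq_zero_of_notMem_tsupport hz, zero_mul]) hloc
    (by
      refine ContDiff.contDiffOn ?_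
      exact (η.contDiff.comp contDiff_snd).mul (hk.comp (contDiff_snd.neg.sub contDiff_fst)))
  rw [contDiffOn_univ] at h
  convert! h using 1
  funext y
  rw [torusAvg, torusMeasure, ← integral_indicator (measurableSet_cell d), convolution_def]
  refine integral_congr_ae (Filter.Eventually.of_forall fun x => ?_)
  by_cases hx : x ∈ cell d
  · simp [indicator_of_mem hx, hη x hx, mul_comm]
  · simp [indicator_of_notMem hx]

theorem partialDeriv_torusAvg {d : ℕ} {k g : Euc d → ℝ} (hk : ContDiff ℝ ∞ k)
    (hp : TorusPeriodic k) (hg : Integrable g (torusMeasure d)) (j : Fin d) (y : Euc d) :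
    partialDeriv (torusAvg k g) j y = -torusAvg (partialDeriv k j) g y := by
  have hc := (partialDeriv_contDiff hk j).continuous
  obtain ⟨M, hM⟩ := (hp.partialDeriv j).exists_bound hc
  have hd : ∀ x : Euc d, ∀ t : ℝ, HasDerivAt
      (fun s : ℝ => k (x - (y + s • EuclideanSpace.single j (1 : ℝ))))
      (-partialDeriv k j (x - (y + t • EuclideanSpace.single j (1 : ℝ)))) t := fun x t => by
    have h1 : HasDerivAt (fun s : ℝ => x - (y + s • EuclideanSpace.single j (1 : ℝ)))
        (-EuclideanSpace.single j (1 : ℝ)) t := by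
      simpa using (((hasDerivAt_id t).smul_const
        (EuclideanSpace.single j (1 : ℝ))).const_add y).const_sub x
    have := ((hk.differentiable (by simp))
      (x - (y + t • EuclideanSpace.single j (1 : ℝ)))).hasFDerivAt.comp_hasDerivAt t h1
    rwa [map_neg] at this
  have hcont : ∀ t : ℝ, Continuous fun x : Euc d => x - (y + t • EuclideanSpace.single j (1 : ℝ)) :=
    fun t => continuous_id.sub continuous_const
  have h := hasDerivAt_integral_of_dominated_loc_of_deriv_le (μ := torusMeasure d) (𝕜 := ℝ)
    (F := fun (t : ℝ) x => k (x - (y + t • EuclideanSpace.single j (1 : ℝ))) * g x)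
    (F' := fun (t : ℝ) x => -partialDeriv k j (x - (y + t • EuclideanSpace.single j (1 : ℝ))) * g x)
    (x₀ := 0) (s := univ) (bound := fun x => M * ‖g x‖) Filter.univ_mem
    (Filter.Eventually.of_forall fun t =>
      (hk.continuous.comp (hcont t)).aestronglyMeasurable.mul hg.1)
    (integrable_kernel_mul hk.continuous hp hg _)
    ((hc.comp (hcont 0)).aestronglyMeasurable.neg.mul hg.1)
    (Filter.Eventually.of_forall fun x t _ => by
      rw [norm_mul, norm_neg]; exact mul_le_mul_of_nonneg_right (hM _) (norm_nonneg _))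
    (hg.norm.const_mul M)
    (Filter.Eventually.of_forall fun x t _ => (hd x t).mul_const (g x))
  have h0 := h.2
  have h1 := hasDerivAt_line ((contDiff_torusAvg hk hg).differentiable (by simp) y) j
  rw [h1.unique h0, torusAvg, ← integral_neg]
  simp

/-- Integration by parts for averages. -/
theorem integral_torusAvg_mul_torusAvg_partialDeriv {d : ℕ} {k a b : Euc d → ℝ}
    (hk : ContDiff ℝ ∞ k) (hp : TorusPeriodic k) (ha : Integrable a (torusMeasure d))
    (hb : Integrable b (torusMeasure d)) (j : Fin d) :
    ∫ y, torusAvg k a y * torusAvg (partialDeriv k j) b y ∂(torusMeasure d)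
      = -∫ y, torusAvg (partialDeriv k j) a y * torusAvg k b y ∂(torusMeasure d) := by
  have sa := contDiff_torusAvg hk ha
  have sb := contDiff_torusAvg hk hb
  have hk' := partialDeriv_contDiff hk j
  have pa := torusPeriodic_torusAvg hp a
  have pb := torusPeriodic_torusAvg hp b
  have h := integral_partialDeriv_eq_zero (sa.mul sb) (pa.comp₂ pb (· * ·)) j
  have e : ∀ y, partialDeriv (fun y => torusAvg k a y * torusAvg k b y) j y
      = -(torusAvg k a y * torusAvg (partialDeriv k j) b y
        + torusAvg (partialDeriv k j) a y * torusAvg k b y) := by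
    intro y
    rw [partialDeriv, fderiv_fun_mul (sa.differentiable (by simp) y)
      (sb.differentiable (by simp) y)]
    have h1 := partialDeriv_torusAvg hk hp ha j y
    have h2 := partialDeriv_torusAvg hk hp hb j y
    simp only [partialDeriv] at h1 h2
    simp only [add_apply, smul_apply, smul_eq_mul, h1, h2]
    ring
  simp only [e] at h
  rw [integral_neg, neg_eq_zero, integral_add] at h
  · linarith
  · exact (pa.comp₂ (torusPeriodic_torusAvg (hp.partialDeriv j) b) (· * ·)).integrable_of_continuous
      (sa.continuous.mul (contDiff_torusAvg hk' hb).continuous)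
  · exact ((torusPeriodic_torusAvg (hp.partialDeriv j) a).comp₂ pb (· * ·)).integrable_of_continuous
      ((contDiff_torusAvg hk' ha).continuous.mul sb.continuous)

theorem TorusPeriodic.integrable_add {d : ℕ} {g : Euc d → ℝ} (hg : TorusPeriodic g)
    (hi : Integrable g (torusMeasure d)) :
    Integrable (fun z : Euc d × Euc d => g (z.1 + z.2))
      ((torusMeasure d).prod (torusMeasure d)) := by
  have := measurePreserving_torusFract_add_prod.integrable_comp_of_integrable hi
  simpa only [Function.comp_def, hg.torusFract] using this

theorem integrable_kernel_mul_add {d : ℕ} {k g : Euc d → ℝ} (hk : Continuous k)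
    (hp : TorusPeriodic k) (hg : TorusPeriodic g) (hi : Integrable g (torusMeasure d)) :
    Integrable (fun z : Euc d × Euc d => k z.2 * g (z.1 + z.2))
      ((torusMeasure d).prod (torusMeasure d)) := by
  obtain ⟨M, hM⟩ := hp.exists_bound hk
  exact (hg.integrable_add hi).bdd_mul (hk.comp continuous_snd).aestronglyMeasurable
    (Filter.Eventually.of_forall fun x => hM _)

theorem integral_torusAvg {d : ℕ} {k g : Euc d → ℝ} (hk : Continuous k) (hp : TorusPeriodic k)
    (hg : TorusPeriodic g) (hi : Integrable g (torusMeasure d)) :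
    ∫ y, torusAvg k g y ∂(torusMeasure d)
      = (∫ r, k r ∂(torusMeasure d)) * ∫ x, g x ∂(torusMeasure d) := by
  simp only [torusAvg_eq_shift hp hg]
  rw [integral_integral_swap (integrable_kernel_mul_add hk hp hg hi), ← integral_mul_const]
  refine integral_congr_ae (Filter.Eventually.of_forall fun r => ?_)
  simp only [integral_const_mul, hg.integral_add_right]

/-- The weak gradient is tested with the translated kernel x ↦ k(x - y). -/
theorem IsWeakGradient.torusAvg {d : ℕ} {v : Euc d → Euc d} {A : Euc d → Fin d → Fin d → ℝ}
    (h : IsWeakGradient v A) {k : Euc d → ℝ} (hk : ContDiff ℝ ∞ k) (hp : TorusPeriodic k)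
    (i j : Fin d) (y : Euc d) :
    torusAvg k (fun x => A x i j) y = -torusAvg (_root_.partialDeriv k j) (fun x => v x i) y := by
  have := h (fun x => k (x - y)) (hk.comp (contDiff_id.sub contDiff_const)) (hp.shift_sub y) i j
  simp only [partialDeriv_comp_sub] at this
  simp only [_root_.torusAvg]
  simp only [mul_comm (k _), mul_comm (_root_.partialDeriv k j _)]
  linarith

/-- Averages of divergence free fields are divergence free. -/
theorem WeaklyDivFree.integral_torusAvg {d : ℕ} {v : Euc d → Euc d} (hv : WeaklyDivFree v)
    (hvp : TorusPeriodic v) (hvi : ∀ i, Integrable (fun x => v x i) (torusMeasure d))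
    {k g : Euc d → ℝ} (hk : Continuous k) (hp : TorusPeriodic k) (hg : ContDiff ℝ ∞ g)
    (hgp : TorusPeriodic g) :
    ∫ y, ∑ i, torusAvg k (fun x => v x i) y * partialDeriv g i y ∂(torusMeasure d) = 0 := by
  have hint : ∀ i, Integrable (fun z : Euc d × Euc d =>
      (k z.2 * v (z.1 + z.2) i) * partialDeriv g i z.1)
        ((torusMeasure d).prod (torusMeasure d)) := fun i => by
    have hc := (partialDeriv_contDiff hg i).continuous
    obtain ⟨M, hM⟩ := (hgp.partialDeriv i).exists_bound hc
    exact (integrable_kernel_mul_add hk hp (hvp.comp (· i)) (hvi i)).mul_bdd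
      (hc.comp continuous_fst).aestronglyMeasurable
      (Filter.Eventually.of_forall fun z => hM _)
  have e : ∀ y, ∑ i, torusAvg k (fun x => v x i) y * partialDeriv g i y
      = ∑ i, ∫ r, (k r * v (y + r) i) * partialDeriv g i y ∂(torusMeasure d) := fun y =>
    Finset.sum_congr rfl fun i _ => by
      rw [torusAvg_eq_shift hp (hvp.comp (· i)), integral_mul_const]
  simp only [e]
  have h1 := integral_finsetSum Finset.univ fun i _ => (hint i).integral_prod_left
  have h2 := integral_finsetSum Finset.univ fun i _ => (hint i).integral_prod_right
  have h3 : ∀ i, ∫ y, ∫ r, (k r * v (y + r) i) * partialDeriv g i y ∂(torusMeasure d)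
      ∂(torusMeasure d) = ∫ r, ∫ y, (k r * v (y + r) i) * partialDeriv g i y ∂(torusMeasure d)
      ∂(torusMeasure d) := fun i => integral_integral_swap
    (f := fun y r => (k r * v (y + r) i) * partialDeriv g i y) (hint i)
  refine h1.trans ((Finset.sum_congr rfl fun i _ => h3 i).trans (h2.symm.trans ?_))
  refine (integral_congr_ae ?_).trans (integral_zero _ _)
  have hae : ∀ᵐ r ∂(torusMeasure d), ∀ i, Integrable (fun y =>
      (k r * v (y + r) i) * partialDeriv g i y) (torusMeasure d) :=
    ae_all_iff.2 fun i => (hint i).prod_left_ae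
  filter_upwards [hae] with r hr
  rw [← integral_finsetSum _ fun i _ => hr i]
  -- After Fubini r is fixed; translating by r turns the inner integral into the divergence
  -- condition for v tested with g(· - r).
  have h0 := hv (fun x => g (x - r)) (hg.comp (contDiff_id.sub contDiff_const)) (hgp.shift_sub r)
  have hper : TorusPeriodic fun x => fderiv ℝ (fun x => g (x - r)) x (v x) := by
    have := (hgp.shift_sub r).fderiv.comp₂ hvp (fun L w => L w)
    exact this
  rw [← hper.integral_add_right r] at h0
  simp only [fderiv_apply_eq_sum, partialDeriv_comp_sub, add_sub_cancel_right] at h0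
  rw [← mul_zero (k r), ← h0, ← integral_const_mul]
  simp only [Finset.mul_sum, mul_assoc]

/-! ### Increments and Besov norms -/

/-- The uniform distribution on the cube `(0,ℓ)^d`. -/
noncomputable def cubeMeasure (d : ℕ) (ℓ : ℝ) : Measure (Euc d) :=
  ENNReal.ofReal (ℓ ^ d)⁻¹ • (torusMeasure d).restrict (smallCube d ℓ)

theorem smallCube_subset_cell {d : ℕ} {ℓ : ℝ} (hℓ1 : ℓ ≤ 1) : smallCube d ℓ ⊆ cell d :=
  fun _ hx i => ⟨(hx i).1.le, (hx i).2.trans_le hℓ1⟩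

theorem smallCube_eq_preimage (d : ℕ) (ℓ : ℝ) : smallCube d ℓ =
    (MeasurableEquiv.toLp 2 (Fin d → ℝ)).symm ⁻¹' (Set.univ.pi fun _ => Ioo (0 : ℝ) ℓ) := by
  ext x
  simp [smallCube]

theorem measurableSet_smallCube (d : ℕ) (ℓ : ℝ) : MeasurableSet (smallCube d ℓ) := by
  rw [smallCube_eq_preimage]
  exact (MeasurableEquiv.measurable _) (MeasurableSet.univ_pi fun _ => measurableSet_Ioo)

theorem isProbabilityMeasure_cubeMeasure {d : ℕ} {ℓ : ℝ} (hℓ : 0 < ℓ) (hℓ1 : ℓ ≤ 1) :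
    IsProbabilityMeasure (cubeMeasure d ℓ) := by
  refine ⟨?_⟩
  have h : torusMeasure d (smallCube d ℓ) = ENNReal.ofReal (ℓ ^ d) := by
    rw [torusMeasure, Measure.restrict_apply (measurableSet_smallCube d ℓ),
      inter_eq_left.2 (smallCube_subset_cell hℓ1), smallCube_eq_preimage,
      (EuclideanSpace.volume_preserving_symm_measurableEquiv_toLp (Fin d)).measure_preimage_equiv,
      Real.volume_pi_Ioo]
    simp [ENNReal.ofReal_pow hℓ.le]
  rw [cubeMeasure, Measure.smul_apply, Measure.restrict_apply_univ, h, smul_eq_mul,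
    ← ENNReal.ofReal_mul (by positivity), inv_mul_cancel₀ (by positivity), ENNReal.ofReal_one]

theorem cubeMeasure_absolutelyContinuous (d : ℕ) (ℓ : ℝ) : cubeMeasure d ℓ ≪ torusMeasure d :=
  (Measure.restrict_le_self.absolutelyContinuous).smul_left _

theorem ae_cubeMeasure (d : ℕ) (ℓ : ℝ) : ∀ᵐ r ∂(cubeMeasure d ℓ), r ∈ smallCube d ℓ :=
  Measure.ae_smul_measure (ae_restrict_mem (measurableSet_smallCube d ℓ)) _

/-- Integrals against a kernel concentrated on `(0,ℓ)^d` are bounded by averages. -/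
theorem lintegral_kernel_mul_le {d : ℕ} {ℓ a : ℝ} (ha : 0 ≤ a) {k : Euc d → ℝ}
    (hk : ∀ x, |k x| ≤ a / ℓ ^ d) (hk0 : ∀ x ∈ cell d, x ∉ smallCube d ℓ → k x = 0)
    (F : Euc d → ℝ≥0∞) :
    ∫⁻ r, ‖k r‖ₑ * F r ∂(torusMeasure d) ≤ ENNReal.ofReal a * ∫⁻ r, F r ∂(cubeMeasure d ℓ) := by
  rw [cubeMeasure, lintegral_smul_measure, smul_eq_mul, ← mul_assoc, ← ENNReal.ofReal_mul ha,
    ← div_eq_mul_inv, ← lintegral_const_mul' _ _ ENNReal.ofReal_ne_top,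
    ← lintegral_indicator (measurableSet_smallCube d ℓ)]
  refine lintegral_mono_ae ?_
  filter_upwards [ae_restrict_mem (measurableSet_cell d)] with r hr
  by_cases hm : r ∈ smallCube d ℓ
  · rw [indicator_of_mem hm]
    gcongr
    rw [Real.enorm_eq_ofReal_abs]
    exact ENNReal.ofReal_le_ofReal (hk r)
  · rw [indicator_of_notMem hm, hk0 r hr hm, enorm_zero, zero_mul]

theorem sq_lintegral_enorm_le {α E : Type*} [MeasurableSpace α] [NormedAddCommGroup E]
    {μ : Measure α} [IsProbabilityMeasure μ] {w : α → E} (hw : AEStronglyMeasurable w μ) :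
    (∫⁻ x, ‖w x‖ₑ ∂μ) ^ 2 ≤ ∫⁻ x, ‖w x‖ₑ ^ 2 ∂μ := by
  have h := eLpNorm_le_eLpNorm_of_exponent_le (p := 1) (q := 2) (by norm_num) hw
  have h2 := eLpNorm_nnreal_pow_eq_lintegral (μ := μ) (f := w) (p := 2) (by norm_num)
  rw [eLpNorm_one_eq_lintegral_enorm] at h
  have h3 := pow_le_pow_left' h 2
  refine h3.trans (le_of_eq ?_)
  simpa using h2

/-- On a probability space the L¹ and L² norms are at most the L³ norm. This merges the linear
gradient bound and the quadratic stress bound into a cubic one. -/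
theorem lintegral_enorm_mul_sq_le {α E : Type*} [MeasurableSpace α] [NormedAddCommGroup E]
    {μ : Measure α} [IsProbabilityMeasure μ] {w : α → E} (hw : AEStronglyMeasurable w μ) :
    (∫⁻ x, ‖w x‖ₑ ∂μ) * ∫⁻ x, ‖w x‖ₑ ^ 2 ∂μ ≤ ∫⁻ x, ‖w x‖ₑ ^ 3 ∂μ := by
  have h1 := eLpNorm_le_eLpNorm_of_exponent_le (p := 1) (q := 3) (by norm_num) hw
  have h2 := eLpNorm_le_eLpNorm_of_exponent_le (p := 2) (q := 3) (by norm_num) hw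
  have e2 := eLpNorm_nnreal_pow_eq_lintegral (μ := μ) (f := w) (p := 2) (by norm_num)
  have e3 := eLpNorm_nnreal_pow_eq_lintegral (μ := μ) (f := w) (p := 3) (by norm_num)
  rw [eLpNorm_one_eq_lintegral_enorm] at h1
  have h3 := mul_le_mul' h1 (pow_le_pow_left' h2 2)
  rw [← pow_succ'] at h3
  have e2' : eLpNorm w 2 μ ^ 2 = ∫⁻ x, ‖w x‖ₑ ^ 2 ∂μ := by simpa using e2
  have e3' : eLpNorm w 3 μ ^ 3 = ∫⁻ x, ‖w x‖ₑ ^ 3 ∂μ := by simpa using e3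
  rwa [e2', e3'] at h3

theorem eLpNorm_le_besovNorm {d : ℕ} (q : ℝ≥0∞) (σ : ℝ) (g : Euc d → Euc d) :
    eLpNorm g q (torusMeasure d) ≤ besovNorm q σ g := le_self_add

theorem besovNorm_mono_exponent {d : ℕ} {p q : ℝ≥0∞} (hpq : p ≤ q) (σ : ℝ) {g : Euc d → Euc d}
    (hg : TorusPeriodic g) (hm : AEStronglyMeasurable g (torusMeasure d)) :
    besovNorm p σ g ≤ besovNorm q σ g := by
  refine add_le_add (eLpNorm_le_eLpNorm_of_exponent_le hpq hm) (iSup₂_mono fun r _ => ?_)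
  exact ENNReal.div_le_div_right
    (eLpNorm_le_eLpNorm_of_exponent_le hpq ((hg.aestronglyMeasurable_add_right hm r).sub hm)) _

theorem norm_le_of_mem_smallCube {d : ℕ} {ℓ : ℝ} (hℓ : 0 ≤ ℓ) {r : Euc d}
    (hr : r ∈ smallCube d ℓ) : ‖r‖ ≤ √d * ℓ := by
  rw [EuclideanSpace.norm_eq]
  refine Real.sqrt_le_iff.2 ⟨by positivity, ?_⟩
  rw [mul_pow, Real.sq_sqrt (Nat.cast_nonneg d)]
  calc ∑ i, ‖r i‖ ^ 2 ≤ ∑ _i : Fin d, ℓ ^ 2 := Finset.sum_le_sum fun i _ => by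
        rw [Real.norm_eq_abs, sq_abs]
        exact pow_le_pow_left₀ (hr i).1.le (hr i).2.le 2
    _ = d * ℓ ^ 2 := by simp

theorem eLpNorm_increment_le {d : ℕ} {q : ℝ≥0∞} {σ ℓ : ℝ} (hσ : 0 ≤ σ) (hℓ : 0 < ℓ) (hℓ1 : ℓ ≤ 1)
    (g : Euc d → Euc d) {r : Euc d} (hr : r ∈ smallCube d ℓ) :
    eLpNorm (fun x => g (x + r) - g x) q (torusMeasure d)
      ≤ ENNReal.ofReal (√d ^ σ * ℓ ^ σ) * besovNorm q σ g := by
  -- For d = 0 the increment vanishes. For d > 0 a point of the open cube is nonzero, so the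
  -- denominator |r|^σ can be cleared.
  rcases Nat.eq_zero_or_pos d with rfl | hd
  · have h0 : (fun x => g (x + r) - g x) = 0 := funext fun x => Subsingleton.elim _ _
    rw [h0, eLpNorm_zero]
    exact zero_le
  have hrpos : 0 < ‖r‖ := norm_pos_iff.2 fun h => by
    have := (hr ⟨0, hd⟩).1
    simp [h] at this
  have h1 : eLpNorm (fun x => g (x + r) - g x) q (torusMeasure d) / ENNReal.ofReal (‖r‖ ^ σ)
      ≤ besovNorm q σ g :=
    (le_iSup₂_of_le (f := fun r (_ : r ∈ {r : Euc d | ∀ i, r i ∈ Ioc (0 : ℝ) 1}) =>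
      eLpNorm (fun x => g (x + r) - g x) q (torusMeasure d) / ENNReal.ofReal (‖r‖ ^ σ)) r
      (fun i => ⟨(hr i).1, (hr i).2.le.trans hℓ1⟩) le_rfl).trans le_add_self
  have hpos : 0 < ‖r‖ ^ σ := Real.rpow_pos_of_pos hrpos σ
  rw [ENNReal.div_le_iff_le_mul (Or.inl (by simpa using hpos)) (Or.inl ENNReal.ofReal_ne_top)] at h1
  refine h1.trans ?_
  rw [mul_comm, ← Real.mul_rpow (Real.sqrt_nonneg _) hℓ.le]
  gcongr
  exact norm_le_of_mem_smallCube hℓ.le hr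

theorem TorusPeriodic.aestronglyMeasurable_increment {d : ℕ} {g : Euc d → Euc d}
    (hg : TorusPeriodic g) (hm : AEStronglyMeasurable g (torusMeasure d)) (ℓ : ℝ) :
    AEStronglyMeasurable (fun z : Euc d × Euc d => g (z.1 + z.2) - g z.1)
      ((torusMeasure d).prod (cubeMeasure d ℓ)) := by
  exact AEStronglyMeasurable.mono_ac
    (Measure.AbsolutelyContinuous.rfl.prod (cubeMeasure_absolutelyContinuous d ℓ))
    ((hg.aestronglyMeasurable_add hm).sub hm.comp_fst)

/-- Averaged increments are controlled by the Besov norm. -/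
theorem lintegral_increment_le {d n : ℕ} (hn : n ≠ 0) {σ ℓ : ℝ} (hσ : 0 ≤ σ) (hℓ : 0 < ℓ)
    (hℓ1 : ℓ ≤ 1) {g : Euc d → Euc d} (hg : TorusPeriodic g)
    (hm : AEStronglyMeasurable g (torusMeasure d)) :
    ∫⁻ y, ∫⁻ r, ‖g (y + r) - g y‖ₑ ^ n ∂(cubeMeasure d ℓ) ∂(torusMeasure d)
      ≤ (ENNReal.ofReal (√d ^ σ * ℓ ^ σ) * besovNorm n σ g) ^ n := by
  have := isProbabilityMeasure_cubeMeasure (d := d) hℓ hℓ1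
  rw [lintegral_lintegral_swap
    (((hg.aestronglyMeasurable_increment hm ℓ).enorm.pow_const n))]
  have hb : ∀ᵐ r ∂(cubeMeasure d ℓ), ∫⁻ y, ‖g (y + r) - g y‖ₑ ^ n ∂(torusMeasure d)
      ≤ (ENNReal.ofReal (√d ^ σ * ℓ ^ σ) * besovNorm n σ g) ^ n := by
    filter_upwards [ae_cubeMeasure d ℓ] with r hr
    have h1 := eLpNorm_nnreal_pow_eq_lintegral (μ := torusMeasure d)
      (f := fun y => g (y + r) - g y) (p := n) (by exact_mod_cast hn)
    have h2 : eLpNorm (fun y => g (y + r) - g y) n (torusMeasure d) ^ n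
        = ∫⁻ y, ‖g (y + r) - g y‖ₑ ^ n ∂(torusMeasure d) := by simpa using h1
    rw [← h2]
    exact pow_le_pow_left' (eLpNorm_increment_le hσ hℓ hℓ1 g hr) n
  refine (lintegral_mono_ae hb).trans ?_
  rw [lintegral_const, measure_univ, mul_one]

/-! ### Square integrable vector fields -/

theorem memLp_coord {α : Type*} [MeasurableSpace α] {μ : Measure α} {d : ℕ} {q : ℝ≥0∞}
    {v : α → Euc d} (hv : MemLp v q μ) (i : Fin d) : MemLp (fun x => v x i) q μ :=
  hv.of_le ((EuclideanSpace.proj (𝕜 := ℝ) i).continuous.comp_aestronglyMeasurable hv.1)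
    (Filter.Eventually.of_forall fun x => PiLp.norm_apply_le (v x) i)

theorem integrable_coord_mul {α : Type*} [MeasurableSpace α] {μ : Measure α} {d : ℕ}
    {v w : α → Euc d} (hv : MemLp v 2 μ) (hw : MemLp w 2 μ) (i j : Fin d) :
    Integrable (fun x => v x i * w x j) μ :=
  (memLp_coord hv i).integrable_mul (memLp_coord hw j)

theorem inner_eq_sum {d : ℕ} (v w : Euc d) : ⟪v, w⟫ = ∑ i, v i * w i := by
  simp [PiLp.inner_apply, mul_comm]

theorem integral_inner_eq_sum {α : Type*} [MeasurableSpace α] {μ : Measure α} {d : ℕ}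
    {v w : α → Euc d} (hv : MemLp v 2 μ) (hw : MemLp w 2 μ) :
    ∫ x, ⟪v x, w x⟫ ∂μ = ∑ i, ∫ x, v x i * w x i ∂μ := by
  simp only [inner_eq_sum]
  exact integral_finsetSum _ fun i _ => integrable_coord_mul hv hw i i

theorem integral_norm_sq_eq_sum {α : Type*} [MeasurableSpace α] {μ : Measure α} {d : ℕ}
    {v : α → Euc d} (hv : MemLp v 2 μ) :
    ∫ x, ‖v x‖ ^ 2 ∂μ = ∑ i, ∫ x, v x i * v x i ∂μ := by
  simp only [← real_inner_self_eq_norm_sq]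
  exact integral_inner_eq_sum hv hv

theorem abs_coord_le {d : ℕ} (v : Euc d) (i : Fin d) : |v i| ≤ ‖v‖ := PiLp.norm_apply_le v i

/-! ### Increments and averages -/

/-- With c = g(y) this is how increments enter: a differentiated kernel has mean zero, so its
average of g is an average of increments; the kernel itself has mean one and gives the average minus
g(y). -/
theorem torusAvg_sub_const {d : ℕ} {κ g : Euc d → ℝ} (hκ : Continuous κ) (hp : TorusPeriodic κ)
    (hg : TorusPeriodic g) (hi : Integrable g (torusMeasure d)) (c : ℝ) (y : Euc d) :
    ∫ r, κ r * (g (y + r) - c) ∂(torusMeasure d)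
      = torusAvg κ g y - c * ∫ r, κ r ∂(torusMeasure d) := by
  have hi' : Integrable (fun r => κ r * g (y + r)) (torusMeasure d) := by
    have := integrable_kernel_mul hκ hp (hg.integrable_add_right hi y) 0
    simpa [add_comm] using this
  rw [torusAvg_eq_shift hp hg, ← integral_const_mul,
    ← integral_sub hi' ((hp.integrable_of_continuous hκ).const_mul c)]
  exact integral_congr_ae (Filter.Eventually.of_forall fun r => by simp only; ring)

theorem enorm_integral_kernel_mul_le {d : ℕ} {ℓ a : ℝ} (ha : 0 ≤ a) {κ w : Euc d → ℝ}
    (hκ : ∀ x, |κ x| ≤ a / ℓ ^ d) (hκ0 : ∀ x ∈ cell d, x ∉ smallCube d ℓ → κ x = 0) :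
    ‖∫ r, κ r * w r ∂(torusMeasure d)‖ₑ ≤ ENNReal.ofReal a * ∫⁻ r, ‖w r‖ₑ ∂(cubeMeasure d ℓ) := by
  refine (enorm_integral_le_lintegral_enorm _).trans ?_
  simp only [enorm_mul]
  exact lintegral_kernel_mul_le ha hκ hκ0 _

section Mollifier

variable {d : ℕ} {ℓ M : ℝ} {k : Euc d → ℝ}

theorem IsMollifier.abs_le (hk : IsMollifier ℓ M k) (x : Euc d) : |k x| ≤ M / ℓ ^ d := by
  rw [abs_of_nonneg (hk.nonneg x)]
  exact hk.le x

theorem IsMollifier.abs_partialDeriv_le' (hk : IsMollifier ℓ M k) (j : Fin d) (x : Euc d) :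
    |partialDeriv k j x| ≤ M / ℓ / ℓ ^ d := by
  rw [div_div, ← pow_succ']
  exact hk.abs_partialDeriv_le j x

theorem enorm_increment_coord_le (v : Euc d → Euc d) (y r : Euc d) (i : Fin d) :
    ‖v (y + r) i - v y i‖ₑ ≤ ‖v (y + r) - v y‖ₑ := by
  rw [enorm_le_iff_norm_le]
  exact PiLp.norm_apply_le (v (y + r) - v y) i

/-- Since ∂_j k has mean zero, v may be replaced by its increments; the derivative costs one factor
1/ℓ. -/
theorem IsMollifier.enorm_gradient_le (hk : IsMollifier ℓ M k) (hM : 0 ≤ M) (hℓ : 0 < ℓ)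
    {v : Euc d → Euc d} (hp : TorusPeriodic v) (hv : MemLp v 2 (torusMeasure d)) (i j : Fin d)
    (y : Euc d) :
    ‖torusAvg (partialDeriv k j) (fun x => v x i) y‖ₑ
      ≤ ENNReal.ofReal (M / ℓ) * ∫⁻ r, ‖v (y + r) - v y‖ₑ ∂(cubeMeasure d ℓ) := by
  have h := torusAvg_sub_const (partialDeriv_contDiff hk.smooth j).continuous
    (hk.periodic.partialDeriv j) (hp.comp (· i)) ((memLp_coord hv i).integrable (by norm_num))
    (v y i) y
  rw [integral_partialDeriv_eq_zero hk.smooth hk.periodic j, mul_zero, sub_zero] at h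
  rw [← h]
  refine (enorm_integral_kernel_mul_le (by positivity) (hk.abs_partialDeriv_le' j)
    (hk.partialDeriv_eq_zero j)).trans ?_
  gcongr with r
  exact enorm_increment_coord_le v y r i

theorem IsMollifier.enorm_avg_sub_le (hk : IsMollifier ℓ M k) (hM : 0 ≤ M)
    {v : Euc d → Euc d} (hp : TorusPeriodic v) (hv : MemLp v 2 (torusMeasure d)) (i : Fin d)
    (y : Euc d) :
    ‖torusAvg k (fun x => v x i) y - v y i‖ₑ
      ≤ ENNReal.ofReal M * ∫⁻ r, ‖v (y + r) - v y‖ₑ ∂(cubeMeasure d ℓ) := by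
  have h := torusAvg_sub_const hk.smooth.continuous
    hk.periodic (hp.comp (· i)) ((memLp_coord hv i).integrable (by norm_num)) (v y i) y
  rw [hk.integral_eq_one, mul_one] at h
  rw [← h]
  refine (enorm_integral_kernel_mul_le hM hk.abs_le hk.eq_zero).trans ?_
  gcongr with r
  exact enorm_increment_coord_le v y r i

theorem integrable_kernel_mul_shift {κ g : Euc d → ℝ} (hκ : Continuous κ) (hp : TorusPeriodic κ)
    (hg : TorusPeriodic g) (hi : Integrable g (torusMeasure d)) (y : Euc d) :
    Integrable (fun r => κ r * g (y + r)) (torusMeasure d) := by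
  have := integrable_kernel_mul hκ hp (hg.integrable_add_right hi y) 0
  simpa [add_comm] using this

/-- The product of increments, averaged against the mollifier. -/
theorem IsMollifier.integral_increment_mul (hk : IsMollifier ℓ M k)
    {v : Euc d → Euc d} (hp : TorusPeriodic v) (hv : MemLp v 2 (torusMeasure d)) (i j : Fin d)
    (y : Euc d) :
    ∫ r, k r * ((v (y + r) i - v y i) * (v (y + r) j - v y j)) ∂(torusMeasure d)
      = torusAvg k (fun x => v x i * v x j) y - v y i * torusAvg k (fun x => v x j) y
        - v y j * torusAvg k (fun x => v x i) y + v y i * v y j := by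
  have pij : TorusPeriodic fun x => v x i * v x j := hp.comp fun w => w i * w j
  have hi := (memLp_coord hv i).integrable (q := 2) (by norm_num)
  have hj := (memLp_coord hv j).integrable (q := 2) (by norm_num)
  have iij := integrable_kernel_mul_shift hk.smooth.continuous hk.periodic pij
    (integrable_coord_mul hv hv i j) y
  have ii := integrable_kernel_mul_shift hk.smooth.continuous hk.periodic (hp.comp (· i)) hi y
  have ij := integrable_kernel_mul_shift hk.smooth.continuous hk.periodic (hp.comp (· j)) hj y
  have ik := hk.periodic.integrable_of_continuous hk.smooth.continuous
  have i1 : Integrable (fun r => k r * (v (y + r) i * v (y + r) j) - v y i * (k r * v (y + r) j))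
      (torusMeasure d) := iij.sub (ij.const_mul _)
  have i2 : Integrable (fun r => k r * (v (y + r) i * v (y + r) j) - v y i * (k r * v (y + r) j)
      - v y j * (k r * v (y + r) i)) (torusMeasure d) := i1.sub (ii.const_mul _)
  have e : ∀ r, k r * ((v (y + r) i - v y i) * (v (y + r) j - v y j))
      = k r * (v (y + r) i * v (y + r) j) - v y i * (k r * v (y + r) j)
        - v y j * (k r * v (y + r) i) + v y i * v y j * k r := fun r => by ring
  simp only [e]
  rw [torusAvg_eq_shift hk.periodic pij, torusAvg_eq_shift hk.periodic (hp.comp (· i)),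
    torusAvg_eq_shift hk.periodic (hp.comp (· j)), integral_add i2 (ik.const_mul _),
    integral_sub i1 (ii.const_mul _), integral_sub iij (ij.const_mul _), integral_const_mul,
    integral_const_mul, integral_const_mul, hk.integral_eq_one, mul_one]

theorem TorusPeriodic.aestronglyMeasurable_increment_right {v : Euc d → Euc d}
    (hp : TorusPeriodic v) (hm : AEStronglyMeasurable v (torusMeasure d)) (ℓ : ℝ) (y : Euc d) :
    AEStronglyMeasurable (fun r => v (y + r) - v y) (cubeMeasure d ℓ) := by
  have := (hp.aestronglyMeasurable_add_right hm y).mono_ac (cubeMeasure_absolutelyContinuous d ℓ)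
  simp only [add_comm _ y] at this
  exact this.sub aestronglyMeasurable_const

/-- The Constantin-E-Titi identity: a covariance does not change when the constants v_i(y), v_j(y)
are subtracted, so the stress is the average of a product of increments minus the product of
averaged increments. The first contributes M, the second M² by Jensen. -/
theorem IsMollifier.enorm_stress_le (hk : IsMollifier ℓ M k) (hM : 0 ≤ M) (hℓ : 0 < ℓ) (hℓ1 : ℓ ≤ 1)
    {v : Euc d → Euc d} (hp : TorusPeriodic v) (hv : MemLp v 2 (torusMeasure d)) (i j : Fin d)
    (y : Euc d) :
    ‖torusAvg k (fun x => v x i * v x j) y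
        - torusAvg k (fun x => v x i) y * torusAvg k (fun x => v x j) y‖ₑ
      ≤ ENNReal.ofReal (M + M * M) * ∫⁻ r, ‖v (y + r) - v y‖ₑ ^ 2 ∂(cubeMeasure d ℓ) := by
  have := isProbabilityMeasure_cubeMeasure (d := d) hℓ hℓ1
  have e : torusAvg k (fun x => v x i * v x j) y
        - torusAvg k (fun x => v x i) y * torusAvg k (fun x => v x j) y
      = (∫ r, k r * ((v (y + r) i - v y i) * (v (y + r) j - v y j)) ∂(torusMeasure d))
        - (torusAvg k (fun x => v x i) y - v y i) * (torusAvg k (fun x => v x j) y - v y j) := by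
    rw [hk.integral_increment_mul hp hv]
    ring
  rw [e]
  refine enorm_sub_le.trans ?_
  rw [ENNReal.ofReal_add hM (by positivity), add_mul]
  refine add_le_add ?_ ?_
  · refine (enorm_integral_kernel_mul_le hM hk.abs_le hk.eq_zero).trans ?_
    gcongr with r
    rw [enorm_mul, sq]
    exact mul_le_mul' (enorm_increment_coord_le v y r i) (enorm_increment_coord_le v y r j)
  · rw [enorm_mul, ENNReal.ofReal_mul hM]
    refine (mul_le_mul' (hk.enorm_avg_sub_le hM hp hv i y)
      (hk.enorm_avg_sub_le hM hp hv j y)).trans ?_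
    rw [mul_mul_mul_comm, ← sq (∫⁻ _, _ ∂_)]
    gcongr
    exact sq_lintegral_enorm_le (hp.aestronglyMeasurable_increment_right hv.1 ℓ y)

/-! ### Flux, enstrophy and energy defect at scale ℓ -/

/-- The energy flux through the scale of the mollifier. -/
noncomputable def energyFlux (k : Euc d → ℝ) (v : Euc d → Euc d) : ℝ :=
  ∫ y, ∑ i, ∑ j, torusAvg (partialDeriv k j) (fun x => v x i) y
    * (torusAvg k (fun x => v x i * v x j) y
        - torusAvg k (fun x => v x i) y * torusAvg k (fun x => v x j) y) ∂(torusMeasure d)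

/-- The enstrophy of the averaged field. -/
noncomputable def avgEnstrophy (k : Euc d → ℝ) (v : Euc d → Euc d) : ℝ :=
  ∫ y, ∑ i, ∑ j, torusAvg (partialDeriv k j) (fun x => v x i) y ^ 2 ∂(torusMeasure d)

/-- Twice the energy that is lost by averaging. -/
noncomputable def energyDefect (k : Euc d → ℝ) (v : Euc d → Euc d) : ℝ :=
  ∫ y, ‖v y‖ ^ 2 ∂(torusMeasure d)
    - ∫ y, ∑ i, torusAvg k (fun x => v x i) y ^ 2 ∂(torusMeasure d)

/-- Pointwise, the gradient is linear and the stress quadratic in averaged increments, hence the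
flux is cubic with a factor 1/ℓ; integrating over the torus brings in the cube of the L³ Besov norm.
-/
theorem IsMollifier.enorm_energyFlux_le (hk : IsMollifier ℓ M k) (hM : 0 ≤ M) (hℓ : 0 < ℓ)
    (hℓ1 : ℓ ≤ 1) {σ : ℝ} (hσ : 0 ≤ σ) {v : Euc d → Euc d} (hp : TorusPeriodic v)
    (hv : MemLp v 2 (torusMeasure d)) :
    ‖energyFlux k v‖ₑ ≤ ENNReal.ofReal (d * d * (M / ℓ * (M + M * M)))
      * (ENNReal.ofReal (√d ^ σ * ℓ ^ σ) * besovNorm 3 σ v) ^ 3 := by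
  have := isProbabilityMeasure_cubeMeasure (d := d) hℓ hℓ1
  refine (enorm_integral_le_lintegral_enorm _).trans ?_
  have hb : ∀ y, ‖∑ i, ∑ j, torusAvg (partialDeriv k j) (fun x => v x i) y
      * (torusAvg k (fun x => v x i * v x j) y
        - torusAvg k (fun x => v x i) y * torusAvg k (fun x => v x j) y)‖ₑ
      ≤ ENNReal.ofReal (d * d * (M / ℓ * (M + M * M)))
        * ∫⁻ r, ‖v (y + r) - v y‖ₑ ^ 3 ∂(cubeMeasure d ℓ) := by
    intro y
    have h1 : ∀ i j, ‖torusAvg (partialDeriv k j) (fun x => v x i) y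
        * (torusAvg k (fun x => v x i * v x j) y
          - torusAvg k (fun x => v x i) y * torusAvg k (fun x => v x j) y)‖ₑ
        ≤ ENNReal.ofReal (M / ℓ * (M + M * M))
          * ∫⁻ r, ‖v (y + r) - v y‖ₑ ^ 3 ∂(cubeMeasure d ℓ) := by
      intro i j
      rw [enorm_mul, ENNReal.ofReal_mul (by positivity)]
      refine (mul_le_mul' (hk.enorm_gradient_le hM hℓ hp hv i j y)
        (hk.enorm_stress_le hM hℓ hℓ1 hp hv i j y)).trans ?_
      rw [mul_mul_mul_comm]
      gcongr
      exact lintegral_enorm_mul_sq_le (hp.aestronglyMeasurable_increment_right hv.1 ℓ y)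
    refine (enorm_sum_le _ _).trans ((Finset.sum_le_sum fun i _ => (enorm_sum_le _ _).trans
      (Finset.sum_le_sum fun j _ => h1 i j)).trans (le_of_eq ?_))
    simp only [Finset.sum_const, Finset.card_univ, Fintype.card_fin, nsmul_eq_mul]
    rw [ENNReal.ofReal_mul (p := (d : ℝ) * d) (by positivity),
      ENNReal.ofReal_mul (p := (d : ℝ)) (by positivity), ENNReal.ofReal_natCast]
    ring
  refine (lintegral_mono hb).trans ?_
  rw [lintegral_const_mul' _ _ ENNReal.ofReal_ne_top]
  gcongr
  exact_mod_cast lintegral_increment_le (n := 3) (by norm_num) hσ hℓ hℓ1 hp hv.1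

theorem ofReal_integral_le_lintegral {α : Type*} [MeasurableSpace α] {μ : Measure α} (g : α → ℝ) :
    ENNReal.ofReal (∫ x, g x ∂μ) ≤ ∫⁻ x, ‖g x‖ₑ ∂μ := by
  refine (ENNReal.ofReal_le_ofReal (le_abs_self _)).trans ?_
  rw [← Real.enorm_eq_ofReal_abs]
  exact enorm_integral_le_lintegral_enorm _

theorem IsMollifier.ofReal_avgEnstrophy_le (hk : IsMollifier ℓ M k) (hM : 0 ≤ M) (hℓ : 0 < ℓ)
    (hℓ1 : ℓ ≤ 1) {σ : ℝ} (hσ : 0 ≤ σ) {v : Euc d → Euc d} (hp : TorusPeriodic v)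
    (hv : MemLp v 2 (torusMeasure d)) :
    ENNReal.ofReal (avgEnstrophy k v) ≤ ENNReal.ofReal (d * d * (M / ℓ * (M / ℓ)))
      * (ENNReal.ofReal (√d ^ σ * ℓ ^ σ) * besovNorm 2 σ v) ^ 2 := by
  have := isProbabilityMeasure_cubeMeasure (d := d) hℓ hℓ1
  refine (ofReal_integral_le_lintegral _).trans ?_
  have hb : ∀ y, ‖∑ i, ∑ j, torusAvg (partialDeriv k j) (fun x => v x i) y ^ 2‖ₑ
      ≤ ENNReal.ofReal (d * d * (M / ℓ * (M / ℓ)))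
        * ∫⁻ r, ‖v (y + r) - v y‖ₑ ^ 2 ∂(cubeMeasure d ℓ) := by
    intro y
    have h1 : ∀ i j, ‖torusAvg (partialDeriv k j) (fun x => v x i) y ^ 2‖ₑ
        ≤ ENNReal.ofReal (M / ℓ * (M / ℓ))
          * ∫⁻ r, ‖v (y + r) - v y‖ₑ ^ 2 ∂(cubeMeasure d ℓ) := by
      intro i j
      rw [sq, enorm_mul, ENNReal.ofReal_mul (by positivity)]
      refine (mul_le_mul' (hk.enorm_gradient_le hM hℓ hp hv i j y)
        (hk.enorm_gradient_le hM hℓ hp hv i j y)).trans ?_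
      rw [mul_mul_mul_comm, ← sq (∫⁻ _, _ ∂_)]
      gcongr
      exact sq_lintegral_enorm_le (hp.aestronglyMeasurable_increment_right hv.1 ℓ y)
    refine (enorm_sum_le _ _).trans ((Finset.sum_le_sum fun i _ => (enorm_sum_le _ _).trans
      (Finset.sum_le_sum fun j _ => h1 i j)).trans (le_of_eq ?_))
    simp only [Finset.sum_const, Finset.card_univ, Fintype.card_fin, nsmul_eq_mul]
    rw [ENNReal.ofReal_mul (p := (d : ℝ) * d) (by positivity),
      ENNReal.ofReal_mul (p := (d : ℝ)) (by positivity), ENNReal.ofReal_natCast]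
    ring
  refine (lintegral_mono hb).trans ?_
  rw [lintegral_const_mul' _ _ ENNReal.ofReal_ne_top]
  gcongr
  exact_mod_cast lintegral_increment_le (n := 2) (by norm_num) hσ hℓ hℓ1 hp hv.1

theorem IsMollifier.integral_avg_norm_sq (hk : IsMollifier ℓ M k) {v : Euc d → Euc d}
    (hp : TorusPeriodic v) (hv : MemLp v 2 (torusMeasure d)) :
    ∫ y, ‖v y‖ ^ 2 ∂(torusMeasure d)
      = ∫ y, ∑ i, torusAvg k (fun x => v x i * v x i) y ∂(torusMeasure d) := by
  have hi := fun i => integrable_coord_mul hv hv i i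
  rw [integral_norm_sq_eq_sum hv, integral_finsetSum]
  · refine Finset.sum_congr rfl fun i _ => ?_
    rw [integral_torusAvg hk.smooth.continuous hk.periodic (hp.comp fun w => w i * w i) (hi i),
      hk.integral_eq_one, one_mul]
  · exact fun i _ => (torusPeriodic_torusAvg hk.periodic _).integrable_of_continuous
      (contDiff_torusAvg hk.smooth (hi i)).continuous

/-- Jensen's inequality, by expanding the nonnegative average of (g - c)² around the mean c. -/
theorem IsMollifier.sq_avg_le (hk : IsMollifier ℓ M k) {g : Euc d → ℝ}
    (hg : MemLp g 2 (torusMeasure d)) (y : Euc d) :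
    torusAvg k g y ^ 2 ≤ torusAvg k (fun x => g x * g x) y := by
  set c := torusAvg k g y with hc
  have i1 : Integrable (fun x => k (x - y) * (g x * g x)) (torusMeasure d) :=
    integrable_kernel_mul hk.smooth.continuous hk.periodic (hg.integrable_mul hg) y
  have i2 := integrable_kernel_mul hk.smooth.continuous hk.periodic
    (hg.integrable (by norm_num)) y
  have i3 : Integrable (fun x => k (x - y)) (torusMeasure d) :=
    (hk.periodic.shift_sub y).integrable_of_continuous
      (hk.smooth.continuous.comp (continuous_id.sub continuous_const))
  have h3 : ∫ x, k (x - y) ∂(torusMeasure d) = 1 := by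
    rw [← hk.integral_eq_one, ← hk.periodic.integral_add_right (-y)]
    rfl
  have h0 : 0 ≤ ∫ x, k (x - y) * (g x - c) ^ 2 ∂(torusMeasure d) :=
    integral_nonneg fun x => mul_nonneg (hk.nonneg _) (sq_nonneg _)
  have e : ∫ x, k (x - y) * (g x - c) ^ 2 ∂(torusMeasure d)
      = torusAvg k (fun x => g x * g x) y - 2 * c * torusAvg k g y
        + c ^ 2 * ∫ x, k (x - y) ∂(torusMeasure d) := by
    have i4 : Integrable (fun x => k (x - y) * (g x * g x) - 2 * c * (k (x - y) * g x))
        (torusMeasure d) := i1.sub (i2.const_mul _)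
    have e1 : ∀ x, k (x - y) * (g x - c) ^ 2
        = k (x - y) * (g x * g x) - 2 * c * (k (x - y) * g x) + c ^ 2 * k (x - y) :=
      fun x => by ring
    simp only [e1]
    rw [integral_add i4 (i3.const_mul _), integral_sub i1 (i2.const_mul _), integral_const_mul,
      integral_const_mul, torusAvg, torusAvg]
  rw [e, h3, ← hc] at h0
  nlinarith

/-- Averaging preserves the integral of |v|², so the defect is the integral of the trace of the
stress. Both its sign and its size can then be read off pointwise. -/
theorem IsMollifier.energyDefect_eq (hk : IsMollifier ℓ M k) {v : Euc d → Euc d}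
    (hp : TorusPeriodic v) (hv : MemLp v 2 (torusMeasure d)) :
    energyDefect k v = ∫ y, ∑ i, (torusAvg k (fun x => v x i * v x i) y
      - torusAvg k (fun x => v x i) y ^ 2) ∂(torusMeasure d) := by
  rw [energyDefect, hk.integral_avg_norm_sq hp hv, ← integral_sub]
  · simp only [Finset.sum_sub_distrib]
  · exact integrable_finsetSum _ fun i _ =>
      (torusPeriodic_torusAvg hk.periodic _).integrable_of_continuous
        (contDiff_torusAvg hk.smooth (integrable_coord_mul hv hv i i)).continuous
  · exact integrable_finsetSum _ fun i _ =>
      ((torusPeriodic_torusAvg hk.periodic _).comp (· ^ 2)).integrable_of_continuous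
        ((contDiff_torusAvg hk.smooth
          ((memLp_coord hv i).integrable (by norm_num))).continuous.pow 2)

theorem IsMollifier.energyDefect_nonneg (hk : IsMollifier ℓ M k) {v : Euc d → Euc d}
    (hp : TorusPeriodic v) (hv : MemLp v 2 (torusMeasure d)) : 0 ≤ energyDefect k v := by
  rw [hk.energyDefect_eq hp hv]
  exact integral_nonneg fun y => Finset.sum_nonneg fun i _ =>
    sub_nonneg.2 (hk.sq_avg_le (memLp_coord hv i) y)

theorem IsMollifier.ofReal_energyDefect_le (hk : IsMollifier ℓ M k) (hM : 0 ≤ M) (hℓ : 0 < ℓ)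
    (hℓ1 : ℓ ≤ 1) {σ : ℝ} (hσ : 0 ≤ σ) {v : Euc d → Euc d} (hp : TorusPeriodic v)
    (hv : MemLp v 2 (torusMeasure d)) :
    ENNReal.ofReal (energyDefect k v) ≤ ENNReal.ofReal (d * (M + M * M))
      * (ENNReal.ofReal (√d ^ σ * ℓ ^ σ) * besovNorm 2 σ v) ^ 2 := by
  rw [hk.energyDefect_eq hp hv]
  refine (ofReal_integral_le_lintegral _).trans ?_
  have hb : ∀ y, ‖∑ i, (torusAvg k (fun x => v x i * v x i) y
      - torusAvg k (fun x => v x i) y ^ 2)‖ₑ ≤ ENNReal.ofReal (d * (M + M * M))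
        * ∫⁻ r, ‖v (y + r) - v y‖ₑ ^ 2 ∂(cubeMeasure d ℓ) := by
    intro y
    simp only [sq (torusAvg _ _ _)]
    refine (enorm_sum_le _ _).trans ((Finset.sum_le_sum fun i _ =>
      hk.enorm_stress_le hM hℓ hℓ1 hp hv i i y).trans (le_of_eq ?_))
    simp only [Finset.sum_const, Finset.card_univ, Fintype.card_fin, nsmul_eq_mul]
    rw [ENNReal.ofReal_mul (p := (d : ℝ)) (by positivity), ENNReal.ofReal_natCast, mul_assoc]
  refine (lintegral_mono hb).trans ?_
  rw [lintegral_const_mul' _ _ ENNReal.ofReal_ne_top]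
  gcongr
  exact_mod_cast lintegral_increment_le (n := 2) (by norm_num) hσ hℓ hℓ1 hp hv.1

end Mollifier

/-! ### The energy balance of the averaged field at a fixed time -/

theorem integrable_fun_sub {α : Type*} [MeasurableSpace α] {μ : Measure α} {g h : α → ℝ}
    (hg : Integrable g μ) (hh : Integrable h μ) : Integrable (fun x => g x - h x) μ := hg.sub hh

section Balance

variable {d : ℕ} {ℓ M : ℝ} {k : Euc d → ℝ}

theorem torusAvg_sub {a b : Euc d → ℝ} (hk : Continuous k) (hp : TorusPeriodic k)
    (ha : Integrable a (torusMeasure d)) (hb : Integrable b (torusMeasure d)) (y : Euc d) :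
    torusAvg k (fun x => a x - b x) y = torusAvg k a y - torusAvg k b y := by
  rw [torusAvg, torusAvg, torusAvg, ← integral_sub (integrable_kernel_mul hk hp ha y)
    (integrable_kernel_mul hk hp hb y)]
  simp only [mul_sub]

theorem IsMollifier.continuous_avg (hk : IsMollifier ℓ M k) {a : Euc d → ℝ}
    (ha : Integrable a (torusMeasure d)) : Continuous (torusAvg k a) :=
  (contDiff_torusAvg hk.smooth ha).continuous

theorem IsMollifier.integrable_avg_mul (hk : IsMollifier ℓ M k) {a b : Euc d → ℝ}
    (ha : Integrable a (torusMeasure d)) (hb : Integrable b (torusMeasure d)) :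
    Integrable (fun y => torusAvg k a y * torusAvg k b y) (torusMeasure d) :=
  ((torusPeriodic_torusAvg hk.periodic a).comp₂ (torusPeriodic_torusAvg hk.periodic b)
    (· * ·)).integrable_of_continuous ((hk.continuous_avg ha).mul (hk.continuous_avg hb))

/-- Averaging loses at most half the energy defects from a covariance. -/
theorem IsMollifier.integral_inner_sub_le (hk : IsMollifier ℓ M k) {v w : Euc d → Euc d}
    (hp : TorusPeriodic v) (hv : MemLp v 2 (torusMeasure d)) (hq : TorusPeriodic w)
    (hw : MemLp w 2 (torusMeasure d)) :
    ∫ x, ⟪v x, w x⟫ ∂(torusMeasure d)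
      - ∫ y, ∑ i, torusAvg k (fun x => v x i) y * torusAvg k (fun x => w x i) y ∂(torusMeasure d)
      ≤ 1 / 2 * (energyDefect k v + energyDefect k w) := by
  -- The defect is a nonnegative quadratic form; expanding it at v - w bounds the polar form by half
  -- the sum of the two defects.
  have h := hk.energyDefect_nonneg (hp.comp₂ hq (· - ·)) (hv.sub hw)
  have hvi := fun i => (memLp_coord hv i).integrable (q := 2) (by norm_num)
  have hwi := fun i => (memLp_coord hw i).integrable (q := 2) (by norm_num)
  have e1 : ∫ y, ‖v y - w y‖ ^ 2 ∂(torusMeasure d) = ∫ y, ‖v y‖ ^ 2 ∂(torusMeasure d)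
      - 2 * ∫ y, ⟪v y, w y⟫ ∂(torusMeasure d) + ∫ y, ‖w y‖ ^ 2 ∂(torusMeasure d) := by
    have i1 : Integrable (fun y => ‖v y‖ ^ 2) (torusMeasure d) := hv.integrable_norm_pow (by simp)
    have i2 : Integrable (fun y => ‖w y‖ ^ 2) (torusMeasure d) := hw.integrable_norm_pow (by simp)
    have i3 : Integrable (fun y => ⟪v y, w y⟫) (torusMeasure d) := by
      simp only [inner_eq_sum]
      exact integrable_finsetSum _ fun i _ => integrable_coord_mul hv hw i i
    have i4 : Integrable (fun y => ‖v y‖ ^ 2 - 2 * ⟪v y, w y⟫) (torusMeasure d) :=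
      i1.sub (i3.const_mul 2)
    simp only [norm_sub_sq_real]
    rw [integral_add i4 i2, integral_sub i1 (i3.const_mul 2), integral_const_mul]
  have e2 : ∫ y, ∑ i, torusAvg k (fun x => (v x - w x) i) y ^ 2 ∂(torusMeasure d)
      = ∫ y, ∑ i, torusAvg k (fun x => v x i) y ^ 2 ∂(torusMeasure d)
        - 2 * (∫ y, ∑ i, torusAvg k (fun x => v x i) y * torusAvg k (fun x => w x i) y
          ∂(torusMeasure d)) + ∫ y, ∑ i, torusAvg k (fun x => w x i) y ^ 2 ∂(torusMeasure d) := by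
    have i1 : ∀ v : Euc d → Euc d, MemLp v 2 (torusMeasure d) →
        Integrable (fun y => ∑ i, torusAvg k (fun x => v x i) y ^ 2) (torusMeasure d) :=
      fun v hv => integrable_finsetSum _ fun i _ => by
        simp only [sq]
        exact hk.integrable_avg_mul ((memLp_coord hv i).integrable (by norm_num))
          ((memLp_coord hv i).integrable (by norm_num))
    have i3 : Integrable (fun y => ∑ i, torusAvg k (fun x => v x i) y
        * torusAvg k (fun x => w x i) y) (torusMeasure d) :=
      integrable_finsetSum _ fun i _ => hk.integrable_avg_mul (hvi i) (hwi i)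
    have e3 : ∀ y, ∑ i, torusAvg k (fun x => (v x - w x) i) y ^ 2
        = ∑ i, torusAvg k (fun x => v x i) y ^ 2
          - 2 * (∑ i, torusAvg k (fun x => v x i) y * torusAvg k (fun x => w x i) y)
          + ∑ i, torusAvg k (fun x => w x i) y ^ 2 := by
      intro y
      rw [Finset.mul_sum, ← Finset.sum_sub_distrib, ← Finset.sum_add_distrib]
      refine Finset.sum_congr rfl fun i _ => ?_
      have := torusAvg_sub hk.smooth.continuous hk.periodic (hvi i) (hwi i) y
      simp only [PiLp.sub_apply]
      rw [this]
      ring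
    have i4 : Integrable (fun y => ∑ i, torusAvg k (fun x => v x i) y ^ 2
          - 2 * (∑ i, torusAvg k (fun x => v x i) y * torusAvg k (fun x => w x i) y))
          (torusMeasure d) := (i1 v hv).sub (i3.const_mul 2)
    simp only [e3]
    rw [integral_add i4 (i1 w hw), integral_sub (i1 v hv) (i3.const_mul 2), integral_const_mul]
  simp only [energyDefect] at h ⊢
  rw [e1, e2] at h
  linarith

/-- The time derivative of the `i`-th component of the averaged field. -/
noncomputable def avgMomentum (ν : ℝ) (k : Euc d → ℝ) (v f : Euc d → Euc d)
    (A : Euc d → Fin d → Fin d → ℝ) (p : Euc d → ℝ) (i : Fin d) (y : Euc d) : ℝ :=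
  (∑ j, torusAvg (partialDeriv k j) (fun x => v x i * v x j) y) + torusAvg (partialDeriv k i) p y
    - ν * (∑ j, torusAvg (partialDeriv k j) (fun x => A x i j) y) + torusAvg k (fun x => f x i) y

/-- The averaged field does not advect its own energy out of the torus. -/
theorem IsMollifier.integral_gradient_mul_avg_mul_avg (hk : IsMollifier ℓ M k) {v : Euc d → Euc d}
    (hp : TorusPeriodic v) (hv : MemLp v 2 (torusMeasure d)) (hdiv : WeaklyDivFree v) :
    ∫ y, ∑ i, ∑ j, torusAvg (partialDeriv k j) (fun x => v x i) y
      * (torusAvg k (fun x => v x i) y * torusAvg k (fun x => v x j) y) ∂(torusMeasure d) = 0 := by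
  have hvi := fun i => (memLp_coord hv i).integrable (q := 2) (by norm_num)
  have hs : ∀ i, ContDiff ℝ ∞ fun y => torusAvg k (fun x => v x i) y ^ 2 :=
    fun i => (contDiff_torusAvg hk.smooth (hvi i)).pow 2
  have hg : ContDiff ℝ ∞ fun y => ∑ i, torusAvg k (fun x => v x i) y ^ 2 :=
    ContDiff.sum fun i _ => hs i
  have hgp : TorusPeriodic fun y => ∑ i, torusAvg k (fun x => v x i) y ^ 2 := fun j y =>
    Finset.sum_congr rfl fun i _ => by
      rw [torusPeriodic_torusAvg hk.periodic (fun x => v x i) j y]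
  -- The divergence free average is tested against the gradient of its own squared length; the
  -- integral in question is -1/2 of that.
  have h := hdiv.integral_torusAvg hp hvi hk.smooth.continuous hk.periodic hg hgp
  have e : ∀ j y, partialDeriv (fun y => ∑ i, torusAvg k (fun x => v x i) y ^ 2) j y
      = -2 * ∑ i, torusAvg (partialDeriv k j) (fun x => v x i) y * torusAvg k (fun x => v x i) y := by
    intro j y
    have h1 := hasDerivAt_line (hg.differentiable (by simp) y) j
    have h2 : ∀ i ∈ (Finset.univ : Finset (Fin d)), HasDerivAt
        (fun s : ℝ => torusAvg k (fun x => v x i) (y + s • EuclideanSpace.single j (1 : ℝ)) ^ 2)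
        (2 * torusAvg k (fun x => v x i) y
          * -torusAvg (partialDeriv k j) (fun x => v x i) y) 0 := fun i _ => by
      have h3 := hasDerivAt_line
        ((contDiff_torusAvg hk.smooth (hvi i)).differentiable (by simp) y) j
      rw [partialDeriv_torusAvg hk.smooth hk.periodic (hvi i)] at h3
      simpa using h3.fun_pow 2
    rw [h1.unique (HasDerivAt.fun_sum h2), Finset.mul_sum]
    exact Finset.sum_congr rfl fun i _ => by ring
  have e2 : ∀ y, ∑ i, ∑ j, torusAvg (partialDeriv k j) (fun x => v x i) y
      * (torusAvg k (fun x => v x i) y * torusAvg k (fun x => v x j) y)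
      = (-1 / 2) * ∑ j, torusAvg k (fun x => v x j) y
        * partialDeriv (fun y => ∑ i, torusAvg k (fun x => v x i) y ^ 2) j y := by
    intro y
    simp only [e]
    rw [Finset.sum_comm, Finset.mul_sum]
    refine Finset.sum_congr rfl fun j _ => ?_
    simp only [Finset.mul_sum]
    exact Finset.sum_congr rfl fun i _ => by ring
  simp only [e2]
  rw [integral_const_mul, h, mul_zero]

/-- The energy balance of the averaged field. -/
theorem IsMollifier.integral_avg_mul_avgMomentum (hk : IsMollifier ℓ M k) {v f : Euc d → Euc d}
    {A : Euc d → Fin d → Fin d → ℝ} {p : Euc d → ℝ} (ν : ℝ)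
    (hp : TorusPeriodic v) (hv : MemLp v 2 (torusMeasure d)) (hdiv : WeaklyDivFree v)
    (hA : ∀ i j, Integrable (fun x => A x i j) (torusMeasure d)) (hgrad : IsWeakGradient v A)
    (hpi : Integrable p (torusMeasure d)) (hf : MemLp f 2 (torusMeasure d)) :
    ∫ y, ∑ i, torusAvg k (fun x => v x i) y * avgMomentum ν k v f A p i y ∂(torusMeasure d)
      = -energyFlux k v - ν * avgEnstrophy k v
        + ∫ y, ∑ i, torusAvg k (fun x => v x i) y * torusAvg k (fun x => f x i) y
          ∂(torusMeasure d) := by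
  have hvi := fun i => (memLp_coord hv i).integrable (q := 2) (by norm_num)
  have hfi := fun i => (memLp_coord hf i).integrable (q := 2) (by norm_num)
  have hvv := fun i j => integrable_coord_mul hv hv i j
  have hk' := fun j => partialDeriv_contDiff hk.smooth j
  have hp' := fun j => hk.periodic.partialDeriv j
  -- integrability of products of averages
  have J : ∀ {κ κ' a b : Euc d → ℝ}, ContDiff ℝ ∞ κ → ContDiff ℝ ∞ κ' → TorusPeriodic κ →
      TorusPeriodic κ' → Integrable a (torusMeasure d) → Integrable b (torusMeasure d) →
      Integrable (fun y => torusAvg κ a y * torusAvg κ' b y) (torusMeasure d) :=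
    fun h1 h2 h3 h4 h5 h6 => ((torusPeriodic_torusAvg h3 _).comp₂ (torusPeriodic_torusAvg h4 _)
      (· * ·)).integrable_of_continuous
        ((contDiff_torusAvg h1 h5).continuous.mul (contDiff_torusAvg h2 h6).continuous)
  have I1 : ∀ i j, Integrable (fun y => torusAvg k (fun x => v x i) y
      * torusAvg (partialDeriv k j) (fun x => v x i * v x j) y) (torusMeasure d) :=
    fun i j => J hk.smooth (hk' j) hk.periodic (hp' j) (hvi i) (hvv i j)
  have I2 : ∀ i, Integrable (fun y => torusAvg k (fun x => v x i) y
      * torusAvg (partialDeriv k i) p y) (torusMeasure d) :=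
    fun i => J hk.smooth (hk' i) hk.periodic (hp' i) (hvi i) hpi
  have I3 : ∀ i j, Integrable (fun y => torusAvg k (fun x => v x i) y
      * torusAvg (partialDeriv k j) (fun x => A x i j) y) (torusMeasure d) :=
    fun i j => J hk.smooth (hk' j) hk.periodic (hp' j) (hvi i) (hA i j)
  have I4 : ∀ i, Integrable (fun y => torusAvg k (fun x => v x i) y
      * torusAvg k (fun x => f x i) y) (torusMeasure d) :=
    fun i => J hk.smooth hk.smooth hk.periodic hk.periodic (hvi i) (hfi i)
  have I5 : ∀ i j, Integrable (fun y => torusAvg (partialDeriv k j) (fun x => v x i) y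
      * torusAvg k (fun x => v x i * v x j) y) (torusMeasure d) :=
    fun i j => J (hk' j) hk.smooth (hp' j) hk.periodic (hvi i) (hvv i j)
  have I6 : ∀ i j, Integrable (fun y => torusAvg (partialDeriv k j) (fun x => v x i) y
      * (torusAvg k (fun x => v x i) y * torusAvg k (fun x => v x j) y)) (torusMeasure d) :=
    fun i j => ((torusPeriodic_torusAvg (hp' j) _).comp₂ ((torusPeriodic_torusAvg hk.periodic
      (fun x => v x i)).comp₂ (torusPeriodic_torusAvg hk.periodic (fun x => v x j)) (· * ·))
      (· * ·)).integrable_of_continuous ((contDiff_torusAvg (hk' j) (hvi i)).continuous.mul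
        ((hk.continuous_avg (hvi i)).mul (hk.continuous_avg (hvi j))))
  -- the four contributions
  have T1 : ∑ i, ∑ j, ∫ y, torusAvg k (fun x => v x i) y
      * torusAvg (partialDeriv k j) (fun x => v x i * v x j) y ∂(torusMeasure d)
      = -energyFlux k v := by
    have h0 := hk.integral_gradient_mul_avg_mul_avg hp hv hdiv
    rw [integral_finsetSum _ fun i _ => integrable_finsetSum _ fun j _ => I6 i j] at h0
    have h1 : energyFlux k v = ∑ i, ∑ j, ((∫ y, torusAvg (partialDeriv k j) (fun x => v x i) y
        * torusAvg k (fun x => v x i * v x j) y ∂(torusMeasure d))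
        - ∫ y, torusAvg (partialDeriv k j) (fun x => v x i) y
      * (torusAvg k (fun x => v x i) y * torusAvg k (fun x => v x j) y) ∂(torusMeasure d)) := by
      simp only [energyFlux, mul_sub]
      rw [integral_finsetSum _ fun i _ => integrable_finsetSum _ fun j _ => integrable_fun_sub (I5 i j) (I6 i j)]
      refine Finset.sum_congr rfl fun i _ => ?_
      rw [integral_finsetSum _ fun j _ => integrable_fun_sub (I5 i j) (I6 i j)]
      exact Finset.sum_congr rfl fun j _ => integral_sub (I5 i j) (I6 i j)
    simp only [fun i => integral_finsetSum Finset.univ fun j _ => I6 i j] at h0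
    rw [h1]
    simp only [Finset.sum_sub_distrib]
    rw [h0, sub_zero, ← Finset.sum_neg_distrib]
    refine Finset.sum_congr rfl fun i _ => ?_
    rw [← Finset.sum_neg_distrib]
    exact Finset.sum_congr rfl fun j _ =>
      integral_torusAvg_mul_torusAvg_partialDeriv hk.smooth hk.periodic (hvi i) (hvv i j) j
  -- The averaged pressure is smooth, so its gradient is orthogonal to the divergence free averaged
  -- velocity.
  have T2 : ∑ i, ∫ y, torusAvg k (fun x => v x i) y * torusAvg (partialDeriv k i) p y
      ∂(torusMeasure d) = 0 := by
    have h := hdiv.integral_torusAvg hp hvi hk.smooth.continuous hk.periodic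
      (contDiff_torusAvg hk.smooth hpi) (torusPeriodic_torusAvg hk.periodic p)
    simp only [partialDeriv_torusAvg hk.smooth hk.periodic hpi, mul_neg,
      Finset.sum_neg_distrib] at h
    rw [integral_neg, neg_eq_zero] at h
    rw [← integral_finsetSum _ fun i _ => I2 i]
    exact h
  -- By parts, and then the average of A i j is minus the average of v_i against ∂_j k; the two
  -- minus signs leave a square.
  have T3 : ∑ i, ∑ j, ∫ y, torusAvg k (fun x => v x i) y
      * torusAvg (partialDeriv k j) (fun x => A x i j) y ∂(torusMeasure d)
      = avgEnstrophy k v := by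
    have I7 : ∀ i j, Integrable (fun y => torusAvg (partialDeriv k j) (fun x => v x i) y ^ 2)
        (torusMeasure d) := fun i j => by
      simp only [sq]
      exact J (hk' j) (hk' j) (hp' j) (hp' j) (hvi i) (hvi i)
    rw [avgEnstrophy, integral_finsetSum _ fun i _ => integrable_finsetSum _ fun j _ => I7 i j]
    refine Finset.sum_congr rfl fun i _ => ?_
    rw [integral_finsetSum _ fun j _ => I7 i j]
    refine Finset.sum_congr rfl fun j _ => ?_
    rw [integral_torusAvg_mul_torusAvg_partialDeriv hk.smooth hk.periodic (hvi i) (hA i j) j,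
      ← integral_neg]
    refine integral_congr_ae (Filter.Eventually.of_forall fun y => ?_)
    simp only [hgrad.torusAvg hk.smooth hk.periodic i j y]
    ring
  have e : ∀ y, ∑ i, torusAvg k (fun x => v x i) y * avgMomentum ν k v f A p i y
      = ∑ i, ((∑ j, torusAvg k (fun x => v x i) y
            * torusAvg (partialDeriv k j) (fun x => v x i * v x j) y)
          + torusAvg k (fun x => v x i) y * torusAvg (partialDeriv k i) p y
          - ν * (∑ j, torusAvg k (fun x => v x i) y
            * torusAvg (partialDeriv k j) (fun x => A x i j) y)
          + torusAvg k (fun x => v x i) y * torusAvg k (fun x => f x i) y) := by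
    intro y
    refine Finset.sum_congr rfl fun i _ => ?_
    rw [avgMomentum, ← Finset.mul_sum, ← Finset.mul_sum]
    ring
  have S1 := fun i => integrable_finsetSum Finset.univ fun j _ => I1 i j
  have S3 := fun i => (integrable_finsetSum Finset.univ fun j _ => I3 i j).const_mul ν
  simp only [e]
  rw [integral_finsetSum _ fun i _ => (integrable_fun_sub ((S1 i).fun_add (I2 i)) (S3 i)).fun_add (I4 i),
    integral_finsetSum _ fun i _ => I4 i, ← T1, ← T3, Finset.mul_sum]
  have T : ∀ i, ∫ y, ((∑ j, torusAvg k (fun x => v x i) y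
            * torusAvg (partialDeriv k j) (fun x => v x i * v x j) y)
          + torusAvg k (fun x => v x i) y * torusAvg (partialDeriv k i) p y
          - ν * (∑ j, torusAvg k (fun x => v x i) y
            * torusAvg (partialDeriv k j) (fun x => A x i j) y)
          + torusAvg k (fun x => v x i) y * torusAvg k (fun x => f x i) y) ∂(torusMeasure d)
      = (∑ j, ∫ y, torusAvg k (fun x => v x i) y
            * torusAvg (partialDeriv k j) (fun x => v x i * v x j) y ∂(torusMeasure d))
        + (∫ y, torusAvg k (fun x => v x i) y * torusAvg (partialDeriv k i) p y ∂(torusMeasure d))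
        - ν * (∑ j, ∫ y, torusAvg k (fun x => v x i) y
            * torusAvg (partialDeriv k j) (fun x => A x i j) y ∂(torusMeasure d))
        + ∫ y, torusAvg k (fun x => v x i) y * torusAvg k (fun x => f x i) y ∂(torusMeasure d) := by
    intro i
    rw [← integral_finsetSum _ fun j _ => I1 i j, ← integral_finsetSum _ fun j _ => I3 i j,
      ← integral_const_mul, ← integral_add (S1 i) (I2 i),
      ← integral_sub ((S1 i).fun_add (I2 i)) (S3 i),
      ← integral_add (integrable_fun_sub ((S1 i).fun_add (I2 i)) (S3 i)) (I4 i)]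
  simp only [T, Finset.sum_add_distrib, Finset.sum_sub_distrib]
  rw [T2]
  ring

end Balance

/-! ### Averages of space-time fields -/

section SpaceTime

variable {d : ℕ} {τ : ℝ}

instance isFiniteMeasure_spaceTime (d : ℕ) (τ : ℝ) : IsFiniteMeasure (spaceTime d τ) := by
  unfold spaceTime
  infer_instance

theorem ae_memLp_two {F : Type*} [NormedAddCommGroup F] {g : ℝ → Euc d → F}
    (hg : MemLp (fun z : ℝ × Euc d => g z.1 z.2) 2 (spaceTime d τ)) :
    ∀ᵐ t ∂(volume.restrict (Ioo 0 τ)), MemLp (g t) 2 (torusMeasure d) := by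
  have h1 := (memLp_two_iff_integrable_sq_norm hg.1).1 hg
  filter_upwards [h1.prod_right_ae, hg.1.prodMk_left] with t h2 h3
  exact (memLp_two_iff_integrable_sq_norm h3).2 h2

theorem memLp_two_of_bounded {F : Type*} [NormedAddCommGroup F] {g : ℝ → Euc d → F}
    (hm : AEStronglyMeasurable (fun z : ℝ × Euc d => g z.1 z.2) (spaceTime d τ)) {K : ℝ≥0}
    (hK : ∀ᵐ t ∂(volume.restrict (Ioo 0 τ)), eLpNorm (g t) 2 (torusMeasure d) ≤ K) :
    MemLp (fun z : ℝ × Euc d => g z.1 z.2) 2 (spaceTime d τ) := by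
  refine ⟨hm, ?_⟩
  have h : eLpNorm (fun z : ℝ × Euc d => g z.1 z.2) 2 (spaceTime d τ) ^ 2 < ⊤ := by
    have e' : eLpNorm (fun z : ℝ × Euc d => g z.1 z.2) 2 (spaceTime d τ) ^ 2
        = ∫⁻ z, ‖g z.1 z.2‖ₑ ^ 2 ∂(spaceTime d τ) := by
      simpa using eLpNorm_nnreal_pow_eq_lintegral (μ := spaceTime d τ)
        (f := fun z : ℝ × Euc d => g z.1 z.2) (p := 2) (by norm_num)
    rw [e', spaceTime, lintegral_prod _ (hm.enorm.pow_const 2)]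
    refine (lintegral_mono_ae (g := fun _ => (K : ℝ≥0∞) ^ 2) ?_).trans_lt ?_
    · filter_upwards [hK] with t ht
      have e2 : eLpNorm (g t) 2 (torusMeasure d) ^ 2 = ∫⁻ x, ‖g t x‖ₑ ^ 2 ∂(torusMeasure d) := by
        simpa using eLpNorm_nnreal_pow_eq_lintegral (μ := torusMeasure d)
          (f := g t) (p := 2) (by norm_num)
      rw [← e2]
      exact pow_le_pow_left' ht 2
    · rw [lintegral_const]
      exact ENNReal.mul_lt_top (by simp) (measure_lt_top _ _)
  exact (ENNReal.pow_lt_top_iff.1 h).resolve_right (by norm_num)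

/-- Averaging over the torus preserves integrability in space-time. -/
theorem integrable_torusAvg {κ : Euc d → ℝ} (hκ : Continuous κ) (hp : TorusPeriodic κ)
    {g : ℝ → Euc d → ℝ} (hg : Integrable (fun z : ℝ × Euc d => g z.1 z.2) (spaceTime d τ)) :
    Integrable (fun z : ℝ × Euc d => torusAvg κ (g z.1) z.2) (spaceTime d τ) := by
  obtain ⟨M, hM⟩ := hp.exists_bound hκ
  have mp : MeasurePreserving (Prod.map Prod.fst id : (ℝ × Euc d) × Euc d → ℝ × Euc d)
      ((spaceTime d τ).prod (torusMeasure d)) (spaceTime d τ) :=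
    (measurePreserving_fst (μ := volume.restrict (Ioo 0 τ)) (ν := torusMeasure d)).prod
      (MeasurePreserving.id (torusMeasure d))
  have h1 := mp.integrable_comp_of_integrable hg
  have h2 : Integrable (fun w : (ℝ × Euc d) × Euc d => κ (w.2 - w.1.2) * g w.1.1 w.2)
      ((spaceTime d τ).prod (torusMeasure d)) :=
    h1.bdd_mul (hκ.comp (continuous_snd.sub (continuous_snd.comp
      continuous_fst))).aestronglyMeasurable (Filter.Eventually.of_forall fun w => hM _)
  exact h2.integral_prod_left

theorem integrable_kernel_mul_spaceTime {κ : Euc d → ℝ} (hκ : Continuous κ) (hp : TorusPeriodic κ)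
    {g : ℝ → Euc d → ℝ} (hg : Integrable (fun z : ℝ × Euc d => g z.1 z.2) (spaceTime d τ))
    (y : Euc d) : Integrable (fun z : ℝ × Euc d => κ (z.2 - y) * g z.1 z.2) (spaceTime d τ) := by
  obtain ⟨M, hM⟩ := hp.exists_bound hκ
  exact hg.bdd_mul (hκ.comp (continuous_snd.sub continuous_const)).aestronglyMeasurable
    (Filter.Eventually.of_forall fun w => hM _)

theorem integrableOn_torusAvg {κ : Euc d → ℝ} (hκ : Continuous κ) (hp : TorusPeriodic κ)
    {g : ℝ → Euc d → ℝ} (hg : Integrable (fun z : ℝ × Euc d => g z.1 z.2) (spaceTime d τ))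
    (y : Euc d) : IntegrableOn (fun t => torusAvg κ (g t) y) (Ioo 0 τ) :=
  (integrable_kernel_mul_spaceTime hκ hp hg y).integral_prod_left

/-- The product of a bounded and an integrable function of time-dependent coefficients. -/
theorem integrable_time_mul {ζ : ℝ → ℝ} (hζ : Continuous ζ) {b : ℝ}
    (hb : ∀ t ∈ Ioo 0 τ, |ζ t| ≤ b) {g : ℝ × Euc d → ℝ} (hg : Integrable g (spaceTime d τ)) :
    Integrable (fun z : ℝ × Euc d => ζ z.1 * g z) (spaceTime d τ) := by
  refine hg.bdd_mul (c := b) (hζ.comp continuous_fst).aestronglyMeasurable ?_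
  have : ∀ᵐ t ∂(volume.restrict (Ioo 0 τ)), ‖ζ t‖ ≤ b :=
    ae_restrict_of_forall_mem measurableSet_Ioo hb
  exact Measure.quasiMeasurePreserving_fst.ae this

end SpaceTime

section Momentum

variable {d : ℕ} {τ ν : ℝ} {u₀ : Euc d → Euc d} {f u : ℝ → Euc d → Euc d}
  {A : ℝ → Euc d → Fin d → Fin d → ℝ} {p : ℝ → Euc d → ℝ}

theorem IsLeraySolution.memLp (h : IsLeraySolution τ ν u₀ f u A p) :
    MemLp (fun z : ℝ × Euc d => u z.1 z.2) 2 (spaceTime d τ) := by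
  obtain ⟨K, hK⟩ := h.bounded
  exact memLp_two_of_bounded h.measurable hK

theorem IsLeraySolution.integrable_grad (h : IsLeraySolution τ ν u₀ f u A p) (i j : Fin d) :
    Integrable (fun z : ℝ × Euc d => A z.1 z.2 i j) (spaceTime d τ) := by
  have h1 := h.grad_memLp.integrable (by norm_num)
  refine h1.norm.mono' ?_ (Filter.Eventually.of_forall fun z =>
    (norm_le_pi_norm (A z.1 z.2 i) j).trans (norm_le_pi_norm (A z.1 z.2) i))
  exact ((continuous_apply j).comp (continuous_apply i)).comp_aestronglyMeasurable h1.1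

/-- This test field reads off the i-th component of the averaged momentum equation at the point y.
-/
theorem isVectorTest_kernel {k : Euc d → ℝ} (hk : ContDiff ℝ ∞ k) (hp : TorusPeriodic k)
    {η : ℝ → ℝ} (hη : IsTimeTest τ η) (y : Euc d) (i : Fin d) :
    IsVectorTest τ fun t x => (η t * k (x - y)) • EuclideanSpace.single i (1 : ℝ) where
  smooth := ((hη.smooth.comp contDiff_fst).mul
    (hk.comp (contDiff_snd.sub contDiff_const))).smul contDiff_const
  periodic t := (hp.shift_sub y).comp fun r => (η t * r) • EuclideanSpace.single i (1 : ℝ)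
  support := by
    obtain ⟨b, hb, h⟩ := hη.support
    exact ⟨b, hb, fun t ht x => by rw [h t ht, zero_mul, zero_smul]⟩

/-- Each component of the averaged velocity is weakly differentiable in time. -/
theorem IsLeraySolution.hasWeakTimeDeriv_torusAvg (h : IsLeraySolution τ ν u₀ f u A p)
    {k : Euc d → ℝ} (hk : ContDiff ℝ ∞ k) (hp : TorusPeriodic k) (y : Euc d) (i : Fin d) :
    HasWeakTimeDeriv τ (fun t => torusAvg k (fun x => u t x i) y)
      (fun t => avgMomentum ν k (u t) (f t) (A t) (p t) i y)
      (torusAvg k (fun x => u₀ x i) y) := by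
  intro η hη
  have hm := h.momentum _ (isVectorTest_kernel hk hp hη y i)
  obtain ⟨b, hb⟩ := hη.exists_bound
  have hk' := fun j => (partialDeriv_contDiff hk j).continuous
  have hp' := fun j => hp.partialDeriv j
  have hu := h.memLp
  have hui : Integrable (fun z : ℝ × Euc d => u z.1 z.2 i) (spaceTime d τ) :=
    (memLp_coord hu i).integrable (by norm_num)
  have hfi : Integrable (fun z : ℝ × Euc d => f z.1 z.2 i) (spaceTime d τ) :=
    (memLp_coord h.force_memLp i).integrable (by norm_num)
  have K1 := integrable_kernel_mul_spaceTime (g := fun t x => u t x i) hk.continuous hp hui y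
  have K2 := fun j => integrable_kernel_mul_spaceTime (g := fun t x => u t x i * u t x j)
    (hk' j) (hp' j) (integrable_coord_mul hu hu i j) y
  have K3 := integrable_kernel_mul_spaceTime (g := p) (hk' i) (hp' i) h.pressure_integrable y
  have K4 := fun j => integrable_kernel_mul_spaceTime (g := fun t x => A t x i j)
    (hk' j) (hp' j) (h.integrable_grad i j) y
  have K5 := integrable_kernel_mul_spaceTime (g := fun t x => f t x i) hk.continuous hp hfi y
  have KH := ((((integrable_finsetSum Finset.univ fun j _ => K2 j).fun_add K3).sub
    ((integrable_finsetSum Finset.univ fun j _ => K4 j).const_mul ν)).fun_add K5)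
  have KG : Integrable (fun z : ℝ × Euc d => deriv η z.1 * (k (z.2 - y) * u z.1 z.2 i)
      + η z.1 * ((∑ j, partialDeriv k j (z.2 - y) * (u z.1 z.2 i * u z.1 z.2 j))
        + partialDeriv k i (z.2 - y) * p z.1 z.2
        - ν * (∑ j, partialDeriv k j (z.2 - y) * A z.1 z.2 i j)
        + k (z.2 - y) * f z.1 z.2 i)) (spaceTime d τ) :=
    (integrable_time_mul (hη.smooth.continuous_deriv (by simp)) (fun t ht => (hb t ht).2) K1).add
      (integrable_time_mul hη.smooth.continuous (fun t ht => (hb t ht).1) KH)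
  have e1 : ∀ z : ℝ × Euc d,
      ⟪u z.1 z.2, deriv (fun s => (η s * k (z.2 - y)) • EuclideanSpace.single i (1 : ℝ)) z.1⟫
          + ⟪u z.1 z.2, fderiv ℝ (fun x => (η z.1 * k (x - y)) • EuclideanSpace.single i (1 : ℝ))
            z.2 (u z.1 z.2)⟫
          + p z.1 z.2 * ∑ i', partialDeriv (fun x =>
            ((η z.1 * k (x - y)) • EuclideanSpace.single i (1 : ℝ) : Euc d) i') i' z.2
          - ν * ∑ i', ∑ j, A z.1 z.2 i' j * partialDeriv (fun x =>
            ((η z.1 * k (x - y)) • EuclideanSpace.single i (1 : ℝ) : Euc d) i') j z.2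
          + ⟪f z.1 z.2, (η z.1 * k (z.2 - y)) • EuclideanSpace.single i (1 : ℝ)⟫
      = deriv η z.1 * (k (z.2 - y) * u z.1 z.2 i)
      + η z.1 * ((∑ j, partialDeriv k j (z.2 - y) * (u z.1 z.2 i * u z.1 z.2 j))
        + partialDeriv k i (z.2 - y) * p z.1 z.2
        - ν * (∑ j, partialDeriv k j (z.2 - y) * A z.1 z.2 i j)
        + k (z.2 - y) * f z.1 z.2 i) := by
    intro z
    have hin : ∀ (w : Euc d) (c : ℝ), ⟪w, c • EuclideanSpace.single i (1 : ℝ)⟫ = c * w i :=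
      fun w c => by simp [inner_smul_right, EuclideanSpace.inner_single_right]
    have d1 : deriv (fun s => (η s * k (z.2 - y)) • EuclideanSpace.single i (1 : ℝ)) z.1
        = (deriv η z.1 * k (z.2 - y)) • EuclideanSpace.single i (1 : ℝ) :=
      ((((hη.smooth.differentiable (by simp)) z.1).hasDerivAt.mul_const _).smul_const _).deriv
    have hkd : DifferentiableAt ℝ (fun x => k (x - y)) z.2 :=
      (hk.comp (contDiff_id.sub contDiff_const)).differentiable (by simp) z.2
    have d2 : ∀ w, fderiv ℝ (fun x => (η z.1 * k (x - y)) • EuclideanSpace.single i (1 : ℝ)) z.2 w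
        = (η z.1 * fderiv ℝ (fun x => k (x - y)) z.2 w) • EuclideanSpace.single i (1 : ℝ) := by
      intro w
      rw [((hkd.hasFDerivAt.const_mul (η z.1)).smul_const
        (EuclideanSpace.single i (1 : ℝ))).fderiv]
      simp
    have d3 : ∀ i' j, partialDeriv (fun x =>
            ((η z.1 * k (x - y)) • EuclideanSpace.single i (1 : ℝ) : Euc d) i') j z.2
        = if i' = i then η z.1 * partialDeriv k j (z.2 - y) else 0 := by
      intro i' j
      by_cases hi : i' = i
      · subst hi
        rw [← partialDeriv_comp_sub k y j z.2]
        simp only [PiLp.smul_apply, PiLp.single_apply, if_true, smul_eq_mul, mul_one, partialDeriv]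
        rw [fderiv_const_mul hkd]
        rfl
      · simp [hi, partialDeriv]
    rw [d1, d2, hin, hin, hin, fderiv_apply_eq_sum]
    simp only [d3, partialDeriv_comp_sub]
    have s1 : ∑ i', ∑ j, A z.1 z.2 i' j * (if i' = i then η z.1 * partialDeriv k j (z.2 - y) else 0)
        = η z.1 * ∑ j, partialDeriv k j (z.2 - y) * A z.1 z.2 i j := by
      rw [Finset.sum_eq_single i]
      · rw [Finset.mul_sum]
        exact Finset.sum_congr rfl fun j _ => by rw [if_pos rfl]; ring
      · intro i' _ hi'
        exact Finset.sum_eq_zero fun j _ => by rw [if_neg hi', mul_zero]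
      · simp
    rw [s1, Finset.sum_ite_eq' Finset.univ i, if_pos (Finset.mem_univ i)]
    have s2 : η z.1 * (∑ j, u z.1 z.2 j * partialDeriv k j (z.2 - y)) * u z.1 z.2 i
        = η z.1 * ∑ j, partialDeriv k j (z.2 - y) * (u z.1 z.2 i * u z.1 z.2 j) := by
      rw [mul_assoc, Finset.sum_mul]
      congr 1
      exact Finset.sum_congr rfl fun j _ => by ring
    rw [s2]
    ring
  have e2 : ∫ x, ⟪u₀ x, (η 0 * k (x - y)) • EuclideanSpace.single i (1 : ℝ)⟫ ∂(torusMeasure d)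
      = η 0 * torusAvg k (fun x => u₀ x i) y := by
    rw [torusAvg, ← integral_const_mul]
    refine integral_congr_ae (Filter.Eventually.of_forall fun x => ?_)
    simp [inner_smul_right, EuclideanSpace.inner_single_right, mul_assoc]
  rw [integral_congr_ae (Filter.Eventually.of_forall e1), e2, spaceTime,
    integral_prod _ KG] at hm
  refine Eq.trans ?_ hm
  congr 1
  refine integral_congr_ae ?_
  filter_upwards [K1.prod_right_ae, ae_all_iff.2 fun j => (K2 j).prod_right_ae, K3.prod_right_ae,
    ae_all_iff.2 fun j => (K4 j).prod_right_ae, K5.prod_right_ae] with t t1 t2 t3 t4 t5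
  have S2 := integrable_finsetSum Finset.univ fun j _ => t2 j
  have S4 := (integrable_finsetSum Finset.univ fun j _ => t4 j).const_mul ν
  rw [integral_add (t1.const_mul _)
    (((integrable_fun_sub (S2.fun_add t3) S4).fun_add t5).const_mul _), integral_const_mul,
    integral_const_mul, integral_add (integrable_fun_sub (S2.fun_add t3) S4) t5,
    integral_sub (S2.fun_add t3) S4, integral_add S2 t3, integral_const_mul,
    integral_finsetSum _ fun j _ => t2 j, integral_finsetSum _ fun j _ => t4 j]
  rfl

end Momentum

/-! ### The energy of the averaged velocity as a function of time -/

section AvgEnergy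

variable {d : ℕ} {τ ν : ℝ} {u₀ : Euc d → Euc d} {f u : ℝ → Euc d → Euc d}
  {A : ℝ → Euc d → Fin d → Fin d → ℝ} {p : ℝ → Euc d → ℝ} {k : Euc d → ℝ}

theorem IsLeraySolution.integrable_coord (h : IsLeraySolution τ ν u₀ f u A p) (i : Fin d) :
    Integrable (fun z : ℝ × Euc d => u z.1 z.2 i) (spaceTime d τ) :=
  (memLp_coord h.memLp i).integrable (by norm_num)

theorem IsLeraySolution.integrable_force_coord (h : IsLeraySolution τ ν u₀ f u A p) (i : Fin d) :
    Integrable (fun z : ℝ × Euc d => f z.1 z.2 i) (spaceTime d τ) :=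
  (memLp_coord h.force_memLp i).integrable (by norm_num)

/-- Averages of a field that is bounded in `L²` are bounded. -/
theorem exists_bound_torusAvg (hu : MemLp (fun z : ℝ × Euc d => u z.1 z.2) 2 (spaceTime d τ))
    {K : ℝ≥0} (hK : ∀ᵐ t ∂(volume.restrict (Ioo 0 τ)), eLpNorm (u t) 2 (torusMeasure d) ≤ K)
    (hk : Continuous k) (hp : TorusPeriodic k) :
    ∃ B, ∀ i, ∀ᵐ z ∂(spaceTime d τ), ‖torusAvg k (fun x => u z.1 x i) z.2‖ ≤ B := by
  obtain ⟨M, hM⟩ := hp.exists_bound hk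
  have hM0 : 0 ≤ M := (norm_nonneg _).trans (hM 0)
  refine ⟨M * K, fun i => ?_⟩
  have h1 : ∀ᵐ t ∂(volume.restrict (Ioo 0 τ)),
      ∀ y, ‖torusAvg k (fun x => u t x i) y‖ ≤ M * K := by
    filter_upwards [ae_memLp_two hu, hK] with t ht htK y
    have hi := (memLp_coord ht i).integrable (q := 2) (by norm_num)
    refine (abs_torusAvg_le hM hi y).trans (mul_le_mul_of_nonneg_left ?_ hM0)
    have h2 : ENNReal.ofReal (∫ x, |u t x i| ∂(torusMeasure d)) ≤ K := by
      refine (ofReal_integral_le_lintegral _).trans ?_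
      refine (lintegral_mono (g := fun x => ‖u t x‖ₑ) fun x => ?_).trans ?_
      · rw [enorm_le_iff_norm_le, Real.norm_eq_abs, abs_abs]
        exact abs_coord_le _ _
      · rw [← eLpNorm_one_eq_lintegral_enorm]
        exact (eLpNorm_le_eLpNorm_of_exponent_le (by norm_num) ht.1).trans htK
    have h3 := (ENNReal.ofReal_le_iff_le_toReal (by simp)).1 h2
    simpa using h3
  have := (Measure.quasiMeasurePreserving_fst (μ := volume.restrict (Ioo 0 τ))
    (ν := torusMeasure d)).ae h1
  filter_upwards [this] with z hz using hz z.2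

theorem IsLeraySolution.integrable_avgMomentum (h : IsLeraySolution τ ν u₀ f u A p)
    (hk : ContDiff ℝ ∞ k) (hp : TorusPeriodic k) (i : Fin d) :
    Integrable (fun z : ℝ × Euc d => avgMomentum ν k (u z.1) (f z.1) (A z.1) (p z.1) i z.2)
      (spaceTime d τ) := by
  have hk' := fun j => (partialDeriv_contDiff hk j).continuous
  have hp' := fun j => hp.partialDeriv j
  exact ((((integrable_finsetSum Finset.univ fun j _ => integrable_torusAvg (hk' j) (hp' j)
    (g := fun t x => u t x i * u t x j) (integrable_coord_mul h.memLp h.memLp i j)).fun_add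
    (integrable_torusAvg (hk' i) (hp' i) h.pressure_integrable)).sub
    ((integrable_finsetSum Finset.univ fun j _ => integrable_torusAvg (hk' j) (hp' j)
      (g := fun t x => A t x i j) (h.integrable_grad i j)).const_mul ν)).fun_add
    (integrable_torusAvg hk.continuous hp (g := fun t x => f t x i) (h.integrable_force_coord i)))

theorem IsLeraySolution.integrableOn_avgMomentum (h : IsLeraySolution τ ν u₀ f u A p)
    (hk : ContDiff ℝ ∞ k) (hp : TorusPeriodic k) (i : Fin d) (y : Euc d) :
    IntegrableOn (fun t => avgMomentum ν k (u t) (f t) (A t) (p t) i y) (Ioo 0 τ) := by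
  have hk' := fun j => (partialDeriv_contDiff hk j).continuous
  have hp' := fun j => hp.partialDeriv j
  exact ((((integrable_finsetSum Finset.univ fun j _ => integrableOn_torusAvg (hk' j) (hp' j)
    (g := fun t x => u t x i * u t x j) (integrable_coord_mul h.memLp h.memLp i j) y).fun_add
    (integrableOn_torusAvg (hk' i) (hp' i) h.pressure_integrable y)).sub
    ((integrable_finsetSum Finset.univ fun j _ => integrableOn_torusAvg (hk' j) (hp' j)
      (g := fun t x => A t x i j) (h.integrable_grad i j) y).const_mul ν)).fun_add
    (integrableOn_torusAvg hk.continuous hp (g := fun t x => f t x i)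
      (h.integrable_force_coord i) y))

theorem IsLeraySolution.integrable_avg_sq (h : IsLeraySolution τ ν u₀ f u A p)
    (hk : ContDiff ℝ ∞ k) (hp : TorusPeriodic k) (i : Fin d) :
    Integrable (fun z : ℝ × Euc d => torusAvg k (fun x => u z.1 x i) z.2 ^ 2) (spaceTime d τ) := by
  obtain ⟨K, hK⟩ := h.bounded
  obtain ⟨B, hB⟩ := exists_bound_torusAvg h.memLp hK hk.continuous hp
  have h1 := integrable_torusAvg hk.continuous hp (g := fun t x => u t x i) (h.integrable_coord i)
  simp only [sq]
  exact h1.bdd_mul h1.1 (hB i)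

theorem IsLeraySolution.integrable_avg_mul_avgMomentum (h : IsLeraySolution τ ν u₀ f u A p)
    (hk : ContDiff ℝ ∞ k) (hp : TorusPeriodic k) (i : Fin d) :
    Integrable (fun z : ℝ × Euc d => torusAvg k (fun x => u z.1 x i) z.2
      * avgMomentum ν k (u z.1) (f z.1) (A z.1) (p z.1) i z.2) (spaceTime d τ) := by
  obtain ⟨K, hK⟩ := h.bounded
  obtain ⟨B, hB⟩ := exists_bound_torusAvg h.memLp hK hk.continuous hp
  have h1 := integrable_torusAvg hk.continuous hp (g := fun t x => u t x i) (h.integrable_coord i)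
  exact (h.integrable_avgMomentum hk hp i).bdd_mul h1.1 (hB i)

/-- The energy of the averaged velocity is weakly differentiable in time. -/
theorem IsLeraySolution.hasWeakTimeDeriv_avgEnergy (h : IsLeraySolution τ ν u₀ f u A p)
    (hτ : 0 < τ) (hk : ContDiff ℝ ∞ k) (hp : TorusPeriodic k) :
    HasWeakTimeDeriv τ (fun t => ∫ y, ∑ i, torusAvg k (fun x => u t x i) y ^ 2 ∂(torusMeasure d))
      (fun t => 2 * ∫ y, ∑ i, torusAvg k (fun x => u t x i) y
        * avgMomentum ν k (u t) (f t) (A t) (p t) i y ∂(torusMeasure d))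
      (∫ y, ∑ i, torusAvg k (fun x => u₀ x i) y ^ 2 ∂(torusMeasure d)) := by
  intro η hη
  obtain ⟨b, hb⟩ := hη.exists_bound
  have S1 := fun i => h.integrable_avg_sq hk hp i
  have S2 := fun i => h.integrable_avg_mul_avgMomentum hk hp i
  have T1 := integrable_time_mul (hη.smooth.continuous_deriv (by simp)) (fun t ht => (hb t ht).2)
    (integrable_finsetSum Finset.univ fun i _ => S1 i)
  have T2 := integrable_time_mul hη.smooth.continuous (fun t ht => (hb t ht).1)
    ((integrable_finsetSum Finset.univ fun i _ => S2 i).const_mul 2)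
  have T := T1.fun_add T2
  -- The weak time derivative is known at each fixed y. Swapping the integrals allows the chain rule
  -- for the square to be applied for every y separately.
  have hswap := integral_integral_swap (μ := volume.restrict (Ioo 0 τ)) (ν := torusMeasure d)
    (f := fun t y => deriv η t * (∑ i, torusAvg k (fun x => u t x i) y ^ 2)
      + η t * (2 * ∑ i, torusAvg k (fun x => u t x i) y
        * avgMomentum ν k (u t) (f t) (A t) (p t) i y)) T
  have e1 : ∫ t in Ioo 0 τ, (deriv η t * (∫ y, ∑ i, torusAvg k (fun x => u t x i) y ^ 2
        ∂(torusMeasure d)) + η t * (2 * ∫ y, ∑ i, torusAvg k (fun x => u t x i) y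
        * avgMomentum ν k (u t) (f t) (A t) (p t) i y ∂(torusMeasure d)))
      = ∫ t in Ioo 0 τ, ∫ y, (deriv η t * (∑ i, torusAvg k (fun x => u t x i) y ^ 2)
      + η t * (2 * ∑ i, torusAvg k (fun x => u t x i) y
        * avgMomentum ν k (u t) (f t) (A t) (p t) i y)) ∂(torusMeasure d) := by
    refine integral_congr_ae ?_
    filter_upwards [(integrable_finsetSum Finset.univ fun i _ => S1 i).prod_right_ae,
      (integrable_finsetSum Finset.univ fun i _ => S2 i).prod_right_ae] with t t1 t2
    rw [integral_add (t1.const_mul _) ((t2.const_mul _).const_mul _), integral_const_mul,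
      integral_const_mul, integral_const_mul]
  have e2 : ∀ y, ∫ t in Ioo 0 τ, (deriv η t * (∑ i, torusAvg k (fun x => u t x i) y ^ 2)
      + η t * (2 * ∑ i, torusAvg k (fun x => u t x i) y
        * avgMomentum ν k (u t) (f t) (A t) (p t) i y))
      = -(η 0 * ∑ i, torusAvg k (fun x => u₀ x i) y ^ 2) := by
    intro y
    have hui := fun i => integrableOn_torusAvg hk.continuous hp (g := fun t x => u t x i)
      (h.integrable_coord i) y
    have hmi := fun i => h.integrableOn_avgMomentum hk hp i y
    have hw := fun i => h.hasWeakTimeDeriv_torusAvg hk hp y i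
    -- boundedness in time follows from the representation as a primitive
    have hbd : ∀ i, ∃ B, ∀ᵐ t ∂(volume.restrict (Ioo 0 τ)),
        ‖torusAvg k (fun x => u t x i) y‖ ≤ B := by
      intro i
      obtain ⟨B, hB⟩ := (absolutelyContinuous_primitive hτ (hmi i)
        (torusAvg k (fun x => u₀ x i) y)).1.exists_bound
      refine ⟨B, ?_⟩
      filter_upwards [(hw i).ae_eq hτ (hui i) (hmi i), ae_restrict_mem measurableSet_Ioo]
        with t ht hmem
      rw [ht]
      exact hB t (by rw [uIcc_of_le hτ.le]; exact Ioo_subset_Icc_self hmem)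
    have i1 : ∀ i, IntegrableOn (fun t => deriv η t * torusAvg k (fun x => u t x i) y ^ 2
        + η t * (2 * (torusAvg k (fun x => u t x i) y
          * avgMomentum ν k (u t) (f t) (A t) (p t) i y))) (Ioo 0 τ) := by
      intro i
      obtain ⟨B, hB⟩ := hbd i
      have j1 : IntegrableOn (fun t => torusAvg k (fun x => u t x i) y ^ 2) (Ioo 0 τ) := by
        simp only [sq]
        exact (hui i).bdd_mul (hui i).1 hB
      have j2 : IntegrableOn (fun t => 2 * (torusAvg k (fun x => u t x i) y
          * avgMomentum ν k (u t) (f t) (A t) (p t) i y)) (Ioo 0 τ) :=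
        ((hmi i).bdd_mul (hui i).1 hB).const_mul 2
      exact (j1.bdd_mul (hη.smooth.continuous_deriv (by simp)).aestronglyMeasurable
        (ae_restrict_of_forall_mem measurableSet_Ioo fun t ht => (hb t ht).2)).add
        (j2.bdd_mul hη.smooth.continuous.aestronglyMeasurable
        (ae_restrict_of_forall_mem measurableSet_Ioo fun t ht => (hb t ht).1))
    have e3 : ∀ t, deriv η t * (∑ i, torusAvg k (fun x => u t x i) y ^ 2)
      + η t * (2 * ∑ i, torusAvg k (fun x => u t x i) y
        * avgMomentum ν k (u t) (f t) (A t) (p t) i y)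
      = ∑ i, (deriv η t * torusAvg k (fun x => u t x i) y ^ 2
        + η t * (2 * (torusAvg k (fun x => u t x i) y
          * avgMomentum ν k (u t) (f t) (A t) (p t) i y))) := by
      intro t
      simp only [Finset.mul_sum, Finset.sum_add_distrib]
    simp only [e3]
    rw [integral_finsetSum _ fun i _ => i1 i, Finset.mul_sum, ← Finset.sum_neg_distrib]
    refine Finset.sum_congr rfl fun i _ => ?_
    have := (hw i).sq hτ (hui i) (hmi i) η hη
    linarith
  rw [e1, hswap]
  simp only [e2]
  rw [integral_neg, integral_const_mul, neg_add_cancel]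

theorem IsLeraySolution.integrableOn_avgEnergy (h : IsLeraySolution τ ν u₀ f u A p)
    (hk : ContDiff ℝ ∞ k) (hp : TorusPeriodic k) :
    IntegrableOn (fun t => ∫ y, ∑ i, torusAvg k (fun x => u t x i) y ^ 2 ∂(torusMeasure d))
      (Ioo 0 τ) :=
  (integrable_finsetSum Finset.univ fun i _ => h.integrable_avg_sq hk hp i).integral_prod_left

theorem IsLeraySolution.integrableOn_avgPower (h : IsLeraySolution τ ν u₀ f u A p)
    (hk : ContDiff ℝ ∞ k) (hp : TorusPeriodic k) :
    IntegrableOn (fun t => ∫ y, ∑ i, torusAvg k (fun x => u t x i) y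
        * avgMomentum ν k (u t) (f t) (A t) (p t) i y ∂(torusMeasure d)) (Ioo 0 τ) :=
  (integrable_finsetSum Finset.univ fun i _ =>
    h.integrable_avg_mul_avgMomentum hk hp i).integral_prod_left

/-- The power of the force. -/
theorem IsLeraySolution.integrable_inner (h : IsLeraySolution τ ν u₀ f u A p) :
    Integrable (fun z : ℝ × Euc d => ⟪u z.1 z.2, f z.1 z.2⟫) (spaceTime d τ) := by
  simp only [inner_eq_sum]
  exact integrable_finsetSum _ fun i _ => integrable_coord_mul h.memLp h.force_memLp i i

theorem IsLeraySolution.integrable_norm_sq (h : IsLeraySolution τ ν u₀ f u A p) :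
    Integrable (fun z : ℝ × Euc d => ‖u z.1 z.2‖ ^ 2) (spaceTime d τ) :=
  h.memLp.integrable_norm_pow (by simp)

theorem IsLeraySolution.integrableOn_power (h : IsLeraySolution τ ν u₀ f u A p) :
    IntegrableOn (fun t => ∫ x, ⟪u t x, f t x⟫ ∂(torusMeasure d)) (Ioo 0 τ) :=
  h.integrable_inner.integral_prod_left

/-- The energy that the averaged velocity does not see. -/
theorem IsLeraySolution.energy_deficit_le (h : IsLeraySolution τ ν u₀ f u A p) (hτ : 0 < τ)
    {ℓ M : ℝ} (hk : IsMollifier ℓ M k) :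
    ∀ᵐ t ∂(volume.restrict (Ioo 0 τ)),
      1 / 2 * ∫ x, ‖u₀ x‖ ^ 2 ∂(torusMeasure d)
        - (1 / 2 * (∫ x, ‖u t x‖ ^ 2 ∂(torusMeasure d))
          - ∫ s in (0 : ℝ)..t, ∫ x, ⟪u s x, f s x⟫ ∂(torusMeasure d))
      ≤ 1 / 2 * energyDefect k u₀ + ∫ s in Ioo 0 t,
        ((∫ x, ⟪u s x, f s x⟫ ∂(torusMeasure d))
          - ∫ y, ∑ i, torusAvg k (fun x => u s x i) y
            * avgMomentum ν k (u s) (f s) (A s) (p s) i y ∂(torusMeasure d)) := by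
  have hW := h.integrableOn_avgPower hk.smooth hk.periodic
  filter_upwards [(h.hasWeakTimeDeriv_avgEnergy hτ hk.smooth hk.periodic).ae_eq hτ
    (h.integrableOn_avgEnergy hk.smooth hk.periodic) (hW.const_mul 2), ae_memLp_two h.memLp,
    ae_restrict_mem measurableSet_Ioo] with t ht hu hmem
  -- At time t only the sign of the defect matters: averaging cannot raise the energy. The defect at
  -- time 0 stays in the bound and has to be small.
  have hdef := hk.energyDefect_nonneg (h.periodic t) hu
  have hsub : Ioo 0 t ⊆ Ioo 0 τ := Ioo_subset_Ioo_right hmem.2.le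
  rw [integral_sub (h.integrableOn_power.mono_set hsub) (hW.mono_set hsub)]
  rw [intervalIntegral.integral_of_le hmem.1.le, integral_Ioc_eq_integral_Ioo,
    integral_const_mul] at ht
  rw [intervalIntegral.integral_of_le hmem.1.le, integral_Ioc_eq_integral_Ioo]
  simp only [energyDefect] at hdef ⊢
  linarith

end AvgEnergy

/-! ### Quantitative bounds for the energy deficit -/

/-- The velocity is controlled in L³ in time; this absorbs its quadratic contributions at the price
of a summand τ. -/
theorem sq_le_one_add_cube (b : ℝ≥0∞) : b ^ 2 ≤ 1 + b ^ 3 := by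
  rcases le_total b 1 with h | h
  · exact (pow_le_one₀ zero_le h).trans le_self_add
  · exact (pow_le_pow_right₀ h (by norm_num)).trans le_add_self

theorem lintegral_besovNorm_pow_le {d : ℕ} {τ : ℝ} {n : ℕ} (hn : n ≠ 0) {q : ℝ≥0∞} {σ : ℝ}
    {v : ℝ → Euc d → Euc d} {B : ℝ≥0} (h : timeBesovNorm τ n q σ v ≤ B) :
    ∫⁻ t in Ioo 0 τ, besovNorm q σ (v t) ^ n ≤ (B : ℝ≥0∞) ^ n := by
  have h1 := pow_le_pow_left' h n
  rw [timeBesovNorm, ← ENNReal.rpow_natCast (_ ^ (1 / (n : ℝ))), ← ENNReal.rpow_mul,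
    one_div_mul_cancel (by exact_mod_cast hn), ENNReal.rpow_one] at h1
  simpa only [ENNReal.rpow_natCast] using h1

theorem ofReal_mul_pow_mul {x y : ℝ} (hx : 0 ≤ x) (hy : 0 ≤ y) (b : ℝ≥0∞) (n : ℕ) :
    ENNReal.ofReal x * (ENNReal.ofReal y * b) ^ n = ENNReal.ofReal (x * y ^ n) * b ^ n := by
  rw [mul_pow, ← mul_assoc, ENNReal.ofReal_mul hx, ENNReal.ofReal_pow hy]

theorem lintegral_enorm_sq_eq {d : ℕ} (v : Euc d → Euc d) :
    ∫⁻ x, ‖v x‖ₑ ^ 2 ∂(torusMeasure d) = eLpNorm v 2 (torusMeasure d) ^ 2 := by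
  have := eLpNorm_nnreal_pow_eq_lintegral (μ := torusMeasure d) (f := v) (p := 2) (by norm_num)
  simpa using this.symm

theorem lintegral_enorm_sq_le_besovNorm {d : ℕ} (σ : ℝ) (v : Euc d → Euc d) :
    ∫⁻ x, ‖v x‖ₑ ^ 2 ∂(torusMeasure d) ≤ besovNorm 2 σ v ^ 2 := by
  rw [lintegral_enorm_sq_eq]
  exact pow_le_pow_left' (eLpNorm_le_besovNorm _ _ _) 2

/-- The constant in the bound for the energy deficit. -/
noncomputable def deficitConst (d : ℕ) (σ M : ℝ) : ℝ :=
  d * d * (M * (M + M * M)) * (√d ^ σ) ^ 3 + d * d * (M * M) * (√d ^ σ) ^ 2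
    + d * (M + M * M) * (√d ^ σ) ^ 2

theorem deficitConst_nonneg (d : ℕ) (σ : ℝ) {M : ℝ} (hM : 0 ≤ M) : 0 ≤ deficitConst d σ M := by
  unfold deficitConst
  positivity

section Scaling

variable {d : ℕ} {ℓ σ M : ℝ}

theorem flux_scaling (hℓ : 0 < ℓ) :
    d * d * (M / ℓ * (M + M * M)) * (√d ^ σ * ℓ ^ σ) ^ 3
      = d * d * (M * (M + M * M)) * (√d ^ σ) ^ 3 * ℓ ^ (3 * σ - 1) := by
  have e : ℓ ^ (3 * σ - 1) = (ℓ ^ σ) ^ 3 / ℓ := by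
    rw [Real.rpow_sub hℓ, Real.rpow_one, mul_comm, Real.rpow_mul hℓ.le]
    norm_cast
  rw [e]
  field_simp

/-- The factor ℓ^(σ+1) is the viscosity, chosen such that the viscous term scales like the flux:
(σ+1) + (2σ-2) = 3σ-1. -/
theorem enstrophy_scaling (hℓ : 0 < ℓ) :
    ℓ ^ (σ + 1) * (d * d * (M / ℓ * (M / ℓ))) * (√d ^ σ * ℓ ^ σ) ^ 2
      = d * d * (M * M) * (√d ^ σ) ^ 2 * ℓ ^ (3 * σ - 1) := by
  have e : ℓ ^ (3 * σ - 1) = (ℓ ^ σ) ^ 3 / ℓ := by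
    rw [Real.rpow_sub hℓ, Real.rpow_one, mul_comm, Real.rpow_mul hℓ.le]
    norm_cast
  rw [e, Real.rpow_add hℓ, Real.rpow_one]
  field_simp

/-- 2σ ≥ 3σ - 1 is the condition σ ≤ 1, and for ℓ ≤ 1 the larger exponent gives the smaller power.
-/
theorem defect_scaling (hM : 0 ≤ M) (hℓ : 0 < ℓ) (hℓ1 : ℓ ≤ 1) (hσ1 : σ ≤ 1) :
    d * (M + M * M) * (√d ^ σ * ℓ ^ σ) ^ 2
      ≤ d * (M + M * M) * (√d ^ σ) ^ 2 * ℓ ^ (3 * σ - 1) := by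
  have e : (ℓ ^ σ) ^ 2 ≤ ℓ ^ (3 * σ - 1) := by
    rw [← Real.rpow_natCast, ← Real.rpow_mul hℓ.le]
    exact Real.rpow_le_rpow_of_exponent_ge hℓ hℓ1 (by push_cast; linarith)
  rw [mul_pow, ← mul_assoc]
  gcongr

theorem IsMollifier.ofReal_half_energyDefect_le {k : Euc d → ℝ} (hk : IsMollifier ℓ M k)
    (hM : 0 ≤ M) (hℓ : 0 < ℓ) (hℓ1 : ℓ ≤ 1) (hσ : 0 ≤ σ) (hσ1 : σ ≤ 1) {v : Euc d → Euc d}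
    (hp : TorusPeriodic v) (hv : MemLp v 2 (torusMeasure d)) :
    ENNReal.ofReal (1 / 2 * energyDefect k v)
      ≤ ENNReal.ofReal (d * (M + M * M) * (√d ^ σ) ^ 2 * ℓ ^ (3 * σ - 1))
        * besovNorm 2 σ v ^ 2 := by
  have h0 := hk.energyDefect_nonneg hp hv
  refine (ENNReal.ofReal_le_ofReal (by linarith)).trans
    ((hk.ofReal_energyDefect_le hM hℓ hℓ1 hσ hp hv).trans ?_)
  rw [ofReal_mul_pow_mul (by positivity) (by positivity)]
  exact mul_le_mul' (ENNReal.ofReal_le_ofReal (defect_scaling hM hℓ hℓ1 hσ1)) le_rfl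

theorem defectConst_le_deficitConst (hM : 0 ≤ M) (hℓ : 0 < ℓ) :
    d * (M + M * M) * (√d ^ σ) ^ 2 * ℓ ^ (3 * σ - 1) ≤ deficitConst d σ M * ℓ ^ (3 * σ - 1) := by
  unfold deficitConst
  gcongr
  have : 0 ≤ d * d * (M * (M + M * M)) * (√d ^ σ) ^ 3 + d * d * (M * M) * (√d ^ σ) ^ 2 := by
    positivity
  linarith

/-- The power that is lost by averaging, at a fixed time. -/
theorem IsMollifier.ofReal_power_deficit_le {k : Euc d → ℝ} (hk : IsMollifier ℓ M k)
    (hM : 0 ≤ M) (hℓ : 0 < ℓ) (hℓ1 : ℓ ≤ 1) (hσ : 0 ≤ σ) (hσ1 : σ ≤ 1) {v f : Euc d → Euc d}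
    {A : Euc d → Fin d → Fin d → ℝ} {p : Euc d → ℝ}
    (hp : TorusPeriodic v) (hv : MemLp v 2 (torusMeasure d)) (hdiv : WeaklyDivFree v)
    (hA : ∀ i j, Integrable (fun x => A x i j) (torusMeasure d)) (hgrad : IsWeakGradient v A)
    (hpi : Integrable p (torusMeasure d)) (hfp : TorusPeriodic f)
    (hf : MemLp f 2 (torusMeasure d)) :
    ENNReal.ofReal ((∫ x, ⟪v x, f x⟫ ∂(torusMeasure d))
        - ∫ y, ∑ i, torusAvg k (fun x => v x i) y
          * avgMomentum (ℓ ^ (σ + 1)) k v f A p i y ∂(torusMeasure d))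
      ≤ ENNReal.ofReal (deficitConst d σ M * ℓ ^ (3 * σ - 1)) * (1 + besovNorm 3 σ v ^ 3)
        + ENNReal.ofReal (1 / 2 * energyDefect k f) := by
  set b := besovNorm 3 σ v with hb
  have hb2 : besovNorm 2 σ v ^ 2 ≤ 1 + b ^ 3 :=
    (pow_le_pow_left' (besovNorm_mono_exponent (by norm_num) σ hp hv.1) 2).trans
      (sq_le_one_add_cube b)
  have hν : 0 ≤ ℓ ^ (σ + 1) := by positivity
  -- The exact balance of the averaged field isolates the flux and the viscous term; what remains is
  -- the covariance of v and f, at most half the sum of their defects.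
  have h1 : (∫ x, ⟪v x, f x⟫ ∂(torusMeasure d))
        - ∫ y, ∑ i, torusAvg k (fun x => v x i) y
          * avgMomentum (ℓ ^ (σ + 1)) k v f A p i y ∂(torusMeasure d)
      ≤ |energyFlux k v| + ℓ ^ (σ + 1) * avgEnstrophy k v + 1 / 2 * energyDefect k v
        + 1 / 2 * energyDefect k f := by
    rw [hk.integral_avg_mul_avgMomentum _ hp hv hdiv hA hgrad hpi hf]
    have h2 := hk.integral_inner_sub_le hp hv hfp hf
    have h3 := le_abs_self (energyFlux k v)
    linarith
  refine (ENNReal.ofReal_le_ofReal h1).trans (ENNReal.ofReal_add_le.trans (add_le_add ?_ le_rfl))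
  refine ENNReal.ofReal_add_le.trans ((add_le_add ENNReal.ofReal_add_le le_rfl).trans ?_)
  have c1 : ENNReal.ofReal |energyFlux k v|
      ≤ ENNReal.ofReal (d * d * (M * (M + M * M)) * (√d ^ σ) ^ 3 * ℓ ^ (3 * σ - 1))
        * (1 + b ^ 3) := by
    rw [← Real.enorm_eq_ofReal_abs]
    refine (hk.enorm_energyFlux_le hM hℓ hℓ1 hσ hp hv).trans ?_
    rw [ofReal_mul_pow_mul (by positivity) (by positivity), flux_scaling hℓ]
    gcongr
    exact le_add_self
  have c2 : ENNReal.ofReal (ℓ ^ (σ + 1) * avgEnstrophy k v)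
      ≤ ENNReal.ofReal (d * d * (M * M) * (√d ^ σ) ^ 2 * ℓ ^ (3 * σ - 1)) * (1 + b ^ 3) := by
    rw [ENNReal.ofReal_mul hν]
    refine (mul_le_mul' le_rfl (hk.ofReal_avgEnstrophy_le hM hℓ hℓ1 hσ hp hv)).trans ?_
    rw [← mul_assoc, ← ENNReal.ofReal_mul hν, ofReal_mul_pow_mul (by positivity) (by positivity),
      enstrophy_scaling hℓ]
    gcongr
  have c3 : ENNReal.ofReal (1 / 2 * energyDefect k v)
      ≤ ENNReal.ofReal (d * (M + M * M) * (√d ^ σ) ^ 2 * ℓ ^ (3 * σ - 1)) * (1 + b ^ 3) :=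
    (hk.ofReal_half_energyDefect_le hM hℓ hℓ1 hσ hσ1 hp hv).trans (by gcongr)
  refine (add_le_add (add_le_add c1 c2) c3).trans (le_of_eq ?_)
  rw [← add_mul, ← add_mul, ← ENNReal.ofReal_add (by positivity) (by positivity),
    ← ENNReal.ofReal_add (by positivity) (by positivity), deficitConst]
  congr 2
  ring

end Scaling

section Deficit

variable {d : ℕ} {τ ν σ ℓ M : ℝ} {u₀ : Euc d → Euc d} {f u : ℝ → Euc d → Euc d}
  {A : ℝ → Euc d → Fin d → Fin d → ℝ} {p : ℝ → Euc d → ℝ} {k : Euc d → ℝ} {B₀ B₂ B₃ : ℝ≥0}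

/-- The energy minus the work of the force, a nonincreasing function of time. -/
noncomputable def netEnergy (f u : ℝ → Euc d → Euc d) (t : ℝ) : ℝ :=
  1 / 2 * (∫ x, ‖u t x‖ ^ 2 ∂(torusMeasure d))
    - ∫ s in (0 : ℝ)..t, ∫ x, ⟪u s x, f s x⟫ ∂(torusMeasure d)

theorem aemeasurable_energyDefect {g : ℝ → Euc d → Euc d} (hk : IsMollifier ℓ M k)
    (hg : MemLp (fun z : ℝ × Euc d => g z.1 z.2) 2 (spaceTime d τ)) :
    AEMeasurable (fun t => energyDefect k (g t)) (volume.restrict (Ioo 0 τ)) := by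
  have h1 : Integrable (fun z : ℝ × Euc d => ‖g z.1 z.2‖ ^ 2) (spaceTime d τ) :=
    hg.integrable_norm_pow (by simp)
  have h2 : AEStronglyMeasurable
      (fun z : ℝ × Euc d => ∑ i, torusAvg k (fun x => g z.1 x i) z.2 ^ 2) (spaceTime d τ) :=
    Finset.aestronglyMeasurable_fun_sum _ fun i _ =>
      (integrable_torusAvg hk.smooth.continuous hk.periodic (g := fun t x => g t x i)
        ((memLp_coord hg i).integrable (by norm_num))).1.pow 2
  exact (h1.integral_prod_left.1.sub h2.integral_prod_right').aemeasurable

theorem lintegral_one_add_besovNorm_le (hu : timeBesovNorm τ 3 3 σ u ≤ B₃) :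
    ∫⁻ t in Ioo 0 τ, (1 + besovNorm 3 σ (u t) ^ 3) ≤ ENNReal.ofReal τ + (B₃ : ℝ≥0∞) ^ 3 := by
  rw [lintegral_add_left measurable_const]
  refine add_le_add ?_ (lintegral_besovNorm_pow_le (n := 3) (by norm_num) (by exact_mod_cast hu))
  simp

theorem toReal_bound_eq (hτ : 0 < τ) :
    ((B₀ : ℝ≥0∞) ^ 2 + (ENNReal.ofReal τ + (B₃ : ℝ≥0∞) ^ 3 + (B₂ : ℝ≥0∞) ^ 2))
      = ENNReal.ofReal ((B₀ : ℝ) ^ 2 + (τ + (B₃ : ℝ) ^ 3 + (B₂ : ℝ) ^ 2)) := by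
  rw [ENNReal.ofReal_add (by positivity) (by positivity),
    ENNReal.ofReal_add (by positivity) (by positivity), ENNReal.ofReal_add hτ.le (by positivity),
    ENNReal.ofReal_pow (by positivity), ENNReal.ofReal_pow (by positivity),
    ENNReal.ofReal_pow (by positivity), ENNReal.ofReal_coe_nnreal, ENNReal.ofReal_coe_nnreal,
    ENNReal.ofReal_coe_nnreal]

/-- The energy deficit at the viscosity that matches the scale of the mollifier. -/
theorem IsLeraySolution.netEnergy_deficit_le
    (h : IsLeraySolution τ (ℓ ^ (σ + 1)) u₀ f u A p) (hτ : 0 < τ) (hk : IsMollifier ℓ M k)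
    (hM : 0 ≤ M) (hℓ : 0 < ℓ) (hℓ1 : ℓ ≤ 1) (hσ : 0 ≤ σ) (hσ1 : σ ≤ 1)
    (hu₀ : besovNorm 2 σ u₀ ≤ B₀) (hf : timeBesovNorm τ 2 2 σ f ≤ B₂)
    (hu : timeBesovNorm τ 3 3 σ u ≤ B₃) :
    ∀ᵐ t ∂(volume.restrict (Ioo 0 τ)),
      1 / 2 * ∫ x, ‖u₀ x‖ ^ 2 ∂(torusMeasure d)
        - deficitConst d σ M * ℓ ^ (3 * σ - 1)
          * ((B₀ : ℝ) ^ 2 + (τ + (B₃ : ℝ) ^ 3 + (B₂ : ℝ) ^ 2)) ≤ netEnergy f u t := by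
  set c := deficitConst d σ M * ℓ ^ (3 * σ - 1) with hc
  have hc0 : 0 ≤ c := mul_nonneg (deficitConst_nonneg d σ hM) (by positivity)
  have hA : ∀ᵐ s ∂(volume.restrict (Ioo 0 τ)), ∀ i j,
      Integrable (fun x => A s x i j) (torusMeasure d) :=
    ae_all_iff.2 fun i => ae_all_iff.2 fun j => (h.integrable_grad i j).prod_right_ae
  have hpt : ∀ᵐ s ∂(volume.restrict (Ioo 0 τ)),
      ENNReal.ofReal ((∫ x, ⟪u s x, f s x⟫ ∂(torusMeasure d))
        - ∫ y, ∑ i, torusAvg k (fun x => u s x i) y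
          * avgMomentum (ℓ ^ (σ + 1)) k (u s) (f s) (A s) (p s) i y ∂(torusMeasure d))
      ≤ ENNReal.ofReal c * (1 + besovNorm 3 σ (u s) ^ 3)
        + ENNReal.ofReal (1 / 2 * energyDefect k (f s)) := by
    filter_upwards [ae_memLp_two h.memLp, h.divFree, hA, h.grad_eq,
      h.pressure_integrable.prod_right_ae, ae_memLp_two h.force_memLp] with s s1 s2 s3 s4 s5 s6
    exact hk.ofReal_power_deficit_le hM hℓ hℓ1 hσ hσ1 (h.periodic s) s1 s2 s3 s4 s5
      (h.force_periodic s) s6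
  have hforce : ∫⁻ s in Ioo 0 τ, ENNReal.ofReal (1 / 2 * energyDefect k (f s))
      ≤ ENNReal.ofReal c * (B₂ : ℝ≥0∞) ^ 2 := by
    refine (lintegral_mono_ae (g := fun s => ENNReal.ofReal c * besovNorm 2 σ (f s) ^ 2)
      ?_).trans ?_
    · filter_upwards [ae_memLp_two h.force_memLp] with s s1
      refine (hk.ofReal_half_energyDefect_le hM hℓ hℓ1 hσ hσ1 (h.force_periodic s) s1).trans ?_
      gcongr
      exact defectConst_le_deficitConst hM hℓ
    · rw [lintegral_const_mul' _ _ ENNReal.ofReal_ne_top]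
      gcongr
      exact lintegral_besovNorm_pow_le (n := 2) (by norm_num) (by exact_mod_cast hf)
  have htot : ∫⁻ s in Ioo 0 τ, ENNReal.ofReal ((∫ x, ⟪u s x, f s x⟫ ∂(torusMeasure d))
        - ∫ y, ∑ i, torusAvg k (fun x => u s x i) y
          * avgMomentum (ℓ ^ (σ + 1)) k (u s) (f s) (A s) (p s) i y ∂(torusMeasure d))
      ≤ ENNReal.ofReal c * (ENNReal.ofReal τ + (B₃ : ℝ≥0∞) ^ 3 + (B₂ : ℝ≥0∞) ^ 2) := by
    refine (lintegral_mono_ae hpt).trans ?_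
    rw [lintegral_add_right' _
      ((aemeasurable_energyDefect hk h.force_memLp).const_mul _).ennreal_ofReal,
      lintegral_const_mul' _ _ ENNReal.ofReal_ne_top, mul_add]
    exact add_le_add (mul_le_mul' le_rfl (lintegral_one_add_besovNorm_le hu)) hforce
  have hinit : ENNReal.ofReal (1 / 2 * energyDefect k u₀) ≤ ENNReal.ofReal c * (B₀ : ℝ≥0∞) ^ 2 := by
    refine (hk.ofReal_half_energyDefect_le hM hℓ hℓ1 hσ hσ1 h.data_periodic h.data_memLp).trans ?_
    gcongr
    exact defectConst_le_deficitConst hM hℓ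
  filter_upwards [h.energy_deficit_le hτ hk, ae_restrict_mem measurableSet_Ioo] with t ht hmem
  have hw : IntegrableOn (fun s => (∫ x, ⟪u s x, f s x⟫ ∂(torusMeasure d))
        - ∫ y, ∑ i, torusAvg k (fun x => u s x i) y
          * avgMomentum (ℓ ^ (σ + 1)) k (u s) (f s) (A s) (p s) i y ∂(torusMeasure d)) (Ioo 0 t) :=
    (h.integrableOn_power.sub (h.integrableOn_avgPower hk.smooth hk.periodic)).mono_set
      (Ioo_subset_Ioo_right hmem.2.le)
  have h1 : ENNReal.ofReal (1 / 2 * energyDefect k u₀ + ∫ s in Ioo 0 t,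
        ((∫ x, ⟪u s x, f s x⟫ ∂(torusMeasure d))
          - ∫ y, ∑ i, torusAvg k (fun x => u s x i) y
            * avgMomentum (ℓ ^ (σ + 1)) k (u s) (f s) (A s) (p s) i y ∂(torusMeasure d)))
      ≤ ENNReal.ofReal (c * ((B₀ : ℝ) ^ 2 + (τ + (B₃ : ℝ) ^ 3 + (B₂ : ℝ) ^ 2))) := by
    rw [ENNReal.ofReal_mul hc0, ← toReal_bound_eq hτ, mul_add]
    refine ENNReal.ofReal_add_le.trans (add_le_add hinit ?_)
    -- The integrand has no sign. Its integral up to t is at most that of its positive part over all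
    -- of (0,τ), which makes the bound uniform in t.
    have h2 : ENNReal.ofReal (∫ s in Ioo 0 t,
        ((∫ x, ⟪u s x, f s x⟫ ∂(torusMeasure d))
          - ∫ y, ∑ i, torusAvg k (fun x => u s x i) y
            * avgMomentum (ℓ ^ (σ + 1)) k (u s) (f s) (A s) (p s) i y ∂(torusMeasure d)))
        ≤ ∫⁻ s in Ioo 0 t, ENNReal.ofReal ((∫ x, ⟪u s x, f s x⟫ ∂(torusMeasure d))
          - ∫ y, ∑ i, torusAvg k (fun x => u s x i) y
            * avgMomentum (ℓ ^ (σ + 1)) k (u s) (f s) (A s) (p s) i y ∂(torusMeasure d)) := by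
      rw [integral_eq_lintegral_pos_part_sub_lintegral_neg_part hw]
      refine (ENNReal.ofReal_le_ofReal (sub_le_self _ ENNReal.toReal_nonneg)).trans ?_
      exact ENNReal.ofReal_toReal_le
    exact h2.trans ((lintegral_mono_set (Ioo_subset_Ioo_right hmem.2.le)).trans htot)
  have h3 := (ENNReal.ofReal_le_ofReal_iff (by positivity)).1 h1
  rw [netEnergy]
  linarith

/-- The energy deficit is bounded for every viscosity. -/
theorem IsLeraySolution.netEnergy_deficit_le_const
    (h : IsLeraySolution τ ν u₀ f u A p) (hτ : 0 < τ)
    (hu₀ : besovNorm 2 σ u₀ ≤ B₀) (hf : timeBesovNorm τ 2 2 σ f ≤ B₂)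
    (hu : timeBesovNorm τ 3 3 σ u ≤ B₃) :
    ∀ᵐ t ∂(volume.restrict (Ioo 0 τ)),
      1 / 2 * ∫ x, ‖u₀ x‖ ^ 2 ∂(torusMeasure d)
        - ((B₀ : ℝ) ^ 2 + (τ + (B₃ : ℝ) ^ 3 + (B₂ : ℝ) ^ 2)) ≤ netEnergy f u t := by
  have hinit : ENNReal.ofReal (1 / 2 * ∫ x, ‖u₀ x‖ ^ 2 ∂(torusMeasure d)) ≤ (B₀ : ℝ≥0∞) ^ 2 := by
    have h0 : 0 ≤ ∫ x, ‖u₀ x‖ ^ 2 ∂(torusMeasure d) := integral_nonneg fun x => sq_nonneg _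
    have h1 : 1 / 2 * ∫ x, ‖u₀ x‖ ^ 2 ∂(torusMeasure d) ≤ ∫ x, ‖u₀ x‖ ^ 2 ∂(torusMeasure d) := by
      linarith
    refine (ENNReal.ofReal_le_ofReal h1).trans
      ((ofReal_integral_le_lintegral fun x => ‖u₀ x‖ ^ 2).trans ?_)
    simp only [enorm_pow, enorm_norm]
    exact (lintegral_enorm_sq_le_besovNorm σ u₀).trans (pow_le_pow_left' hu₀ 2)
  -- No smallness is sought here: the work is bounded by |u|² + |f|², and the kinetic energy at time
  -- t is simply dropped at the end.
  have hpow : ∫⁻ s in Ioo 0 τ, ‖∫ x, ⟪u s x, f s x⟫ ∂(torusMeasure d)‖ₑ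
      ≤ ENNReal.ofReal τ + (B₃ : ℝ≥0∞) ^ 3 + (B₂ : ℝ≥0∞) ^ 2 := by
    refine (lintegral_mono_ae (g := fun s => (1 + besovNorm 3 σ (u s) ^ 3)
      + ∫⁻ x, ‖f s x‖ₑ ^ 2 ∂(torusMeasure d)) ?_).trans ?_
    · filter_upwards [ae_memLp_two h.memLp, ae_memLp_two h.force_memLp] with s s1 s2
      refine (enorm_integral_le_lintegral_enorm _).trans ?_
      refine (lintegral_mono (g := fun x => ‖u s x‖ₑ ^ 2 + ‖f s x‖ₑ ^ 2) fun x => ?_).trans ?_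
      · have h1 : ‖⟪u s x, f s x⟫‖ₑ ≤ ‖u s x‖ₑ * ‖f s x‖ₑ := by
          rw [← enorm_norm (u s x), ← enorm_norm (f s x), ← enorm_mul, enorm_le_iff_norm_le]
          simpa using abs_real_inner_le_norm (u s x) (f s x)
        refine h1.trans ?_
        rcases le_total ‖u s x‖ₑ ‖f s x‖ₑ with h2 | h2
        · exact (mul_le_mul' h2 le_rfl).trans ((sq _).symm.le.trans le_add_self)
        · exact (mul_le_mul' le_rfl h2).trans ((sq _).symm.le.trans le_self_add)
      · rw [lintegral_add_left' (s1.1.enorm.pow_const 2)]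
        refine add_le_add ((lintegral_enorm_sq_le_besovNorm σ (u s)).trans ?_) le_rfl
        exact (pow_le_pow_left' (besovNorm_mono_exponent (by norm_num) σ (h.periodic s) s1.1)
          2).trans (sq_le_one_add_cube _)
    · have hmeas : AEMeasurable (fun s => ∫⁻ x, ‖f s x‖ₑ ^ 2 ∂(torusMeasure d))
          (volume.restrict (Ioo 0 τ)) :=
        (h.force_memLp.1.enorm.pow_const 2).lintegral_prod_right'
      rw [lintegral_add_right' _ hmeas]
      refine add_le_add (lintegral_one_add_besovNorm_le hu) ?_
      refine (lintegral_mono fun s => lintegral_enorm_sq_le_besovNorm σ (f s)).trans ?_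
      exact lintegral_besovNorm_pow_le (n := 2) (by norm_num) (by exact_mod_cast hf)
  filter_upwards [ae_restrict_mem measurableSet_Ioo] with t hmem
  have h1 : ENNReal.ofReal (1 / 2 * (∫ x, ‖u₀ x‖ ^ 2 ∂(torusMeasure d))
        + ∫ s in Ioo 0 t, ∫ x, ⟪u s x, f s x⟫ ∂(torusMeasure d))
      ≤ ENNReal.ofReal ((B₀ : ℝ) ^ 2 + (τ + (B₃ : ℝ) ^ 3 + (B₂ : ℝ) ^ 2)) := by
    rw [← toReal_bound_eq hτ]
    refine ENNReal.ofReal_add_le.trans (add_le_add hinit ?_)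
    exact (ofReal_integral_le_lintegral _).trans
      ((lintegral_mono_set (Ioo_subset_Ioo_right hmem.2.le)).trans hpow)
  have h3 := (ENNReal.ofReal_le_ofReal_iff (by positivity)).1 h1
  have h4 : 0 ≤ ∫ x, ‖u t x‖ ^ 2 ∂(torusMeasure d) := integral_nonneg fun x => sq_nonneg _
  rw [netEnergy, intervalIntegral.integral_of_le hmem.1.le, integral_Ioc_eq_integral_Ioo]
  linarith

end Deficit

/-! ### The total dissipation -/

section Dissipation

variable {d : ℕ} {τ ν R : ℝ} {u₀ : Euc d → Euc d} {f u : ℝ → Euc d → Euc d}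
  {A : ℝ → Euc d → Fin d → Fin d → ℝ} {p : ℝ → Euc d → ℝ}

theorem gradSq_nonneg (a : Fin d → Fin d → ℝ) : 0 ≤ gradSq a :=
  Finset.sum_nonneg fun _ _ => Finset.sum_nonneg fun _ _ => sq_nonneg _

theorem IsLeraySolution.integrable_gradSq (h : IsLeraySolution τ ν u₀ f u A p) :
    Integrable (fun z : ℝ × Euc d => gradSq (A z.1 z.2)) (spaceTime d τ) := by
  refine integrable_finsetSum _ fun i _ => integrable_finsetSum _ fun j _ => ?_
  have hm : MemLp (fun z : ℝ × Euc d => A z.1 z.2 i j) 2 (spaceTime d τ) :=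
    h.grad_memLp.of_le (h.integrable_grad i j).1 (Filter.Eventually.of_forall fun z =>
      (norm_le_pi_norm (A z.1 z.2 i) j).trans (norm_le_pi_norm (A z.1 z.2) i))
  exact hm.integrable_sq

theorem IsLeraySolution.integrableOn_enstrophy (h : IsLeraySolution τ ν u₀ f u A p) :
    IntegrableOn (fun t => ∫ x, gradSq (A t x) ∂(torusMeasure d)) (Ioo 0 τ) :=
  h.integrable_gradSq.integral_prod_left

theorem IsLeraySolution.integrableOn_energy (h : IsLeraySolution τ ν u₀ f u A p) :
    IntegrableOn (fun t => ∫ x, ‖u t x‖ ^ 2 ∂(torusMeasure d)) (Ioo 0 τ) :=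
  h.integrable_norm_sq.integral_prod_left

theorem IsLeraySolution.integrableOn_work (h : IsLeraySolution τ ν u₀ f u A p) (hτ : 0 < τ) :
    IntegrableOn (fun t => ∫ s in (0 : ℝ)..t, ∫ x, ⟪u s x, f s x⟫ ∂(torusMeasure d)) (Ioo 0 τ) := by
  have hc := (absolutelyContinuous_primitive hτ h.integrableOn_power 0).1.continuousOn
  rw [uIcc_of_le hτ.le] at hc
  simpa only [zero_add] using hc.integrableOn_Icc.mono_set Ioo_subset_Icc_self

theorem IsLeraySolution.integrableOn_netEnergy (h : IsLeraySolution τ ν u₀ f u A p) (hτ : 0 < τ) :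
    IntegrableOn (netEnergy f u) (Ioo 0 τ) :=
  (h.integrableOn_energy.const_mul (1 / 2)).sub (h.integrableOn_work hτ)

/-- The energy inequality from time s with the nonnegative viscous term discarded; the work between
s and t is the difference of the two primitives. -/
theorem IsLeraySolution.netEnergy_antitone (h : IsLeraySolution τ ν u₀ f u A p) (hν : 0 < ν) :
    ∀ᵐ s ∂(volume.restrict (Ioo 0 τ)), ∀ᵐ t ∂(volume.restrict (Ioo 0 τ)),
      s < t → netEnergy f u t ≤ netEnergy f u s := by
  filter_upwards [h.energy, ae_restrict_mem measurableSet_Ioo] with s hs hsm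
  filter_upwards [hs, ae_restrict_mem measurableSet_Ioo] with t ht htm hst
  have h1 := ht hst
  have h2 : 0 ≤ ν * ∫ r in Ioo s t, ∫ x, gradSq (A r x) ∂(torusMeasure d) :=
    mul_nonneg hν.le (integral_nonneg fun r => integral_nonneg fun x => gradSq_nonneg _)
  have hF := h.integrableOn_power
  have hi : ∀ a ∈ Ioo 0 τ, ∀ b ∈ Ioo 0 τ, IntervalIntegrable
      (fun s => ∫ x, ⟪u s x, f s x⟫ ∂(torusMeasure d)) volume a b := fun a ha b hb =>
    (intervalIntegrable_iff.2 (hF.mono_set fun r hr =>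
      ⟨(lt_min ha.1 hb.1).trans hr.1, hr.2.trans_lt (max_lt ha.2 hb.2)⟩))
  have hi0 : IntervalIntegrable
      (fun s => ∫ x, ⟪u s x, f s x⟫ ∂(torusMeasure d)) volume 0 s :=
    (intervalIntegrable_iff_integrableOn_Ioo_of_le hsm.1.le).2
      (hF.mono_set (Ioo_subset_Ioo_right hsm.2.le))
  have h3 := intervalIntegral.integral_add_adjacent_intervals hi0 (hi s hsm t htm)
  rw [intervalIntegral.integral_of_le hst.le, integral_Ioc_eq_integral_Ioo] at h3
  simp only [netEnergy]
  linarith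

theorem IsLeraySolution.netEnergy_le (h : IsLeraySolution τ ν u₀ f u A p) (hν : 0 < ν) :
    ∀ᵐ t ∂(volume.restrict (Ioo 0 τ)),
      netEnergy f u t ≤ 1 / 2 * ∫ x, ‖u₀ x‖ ^ 2 ∂(torusMeasure d) := by
  filter_upwards [h.energy_zero, ae_restrict_mem measurableSet_Ioo] with t ht htm
  have h2 : 0 ≤ ν * ∫ r in Ioo 0 t, ∫ x, gradSq (A r x) ∂(torusMeasure d) :=
    mul_nonneg hν.le (integral_nonneg fun r => integral_nonneg fun x => gradSq_nonneg _)
  rw [netEnergy, intervalIntegral.integral_of_le htm.1.le, integral_Ioc_eq_integral_Ioo]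
  linarith

theorem IsTimeCutoff.isTimeTest {ψ : ℝ → ℝ} (hψ : IsTimeCutoff τ ψ) : IsTimeTest τ ψ := by
  obtain ⟨hs, _, a, b, _, hb, h⟩ := hψ
  refine ⟨hs, (b + τ) / 2, by linarith, fun t ht => h t fun hmem => ?_⟩
  linarith [hmem.2]

/-- The dissipation measures the decrease of the net energy. -/
theorem IsLeraySolution.dissipation_eq (h : IsLeraySolution τ ν u₀ f u A p) (hτ : 0 < τ)
    {ψ : ℝ → ℝ} (hψ : IsTimeTest τ ψ) (hψ0 : ψ 0 = 0) :
    dissipation τ ν f u A p (fun t _ => ψ t) = ∫ t in Ioo 0 τ, deriv ψ t * netEnergy f u t := by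
  obtain ⟨b, hb⟩ := hψ.exists_bound
  have hd := hψ.smooth.continuous_deriv (by simp)
  have I1 := integrable_time_mul hψ.smooth.continuous (fun t ht => (hb t ht).1)
    (h.integrable_gradSq.const_mul ν)
  have I2 := integrable_time_mul hd (fun t ht => (hb t ht).2)
    (h.integrable_norm_sq.const_mul (1 / 2))
  have I3 := integrable_time_mul hψ.smooth.continuous (fun t ht => (hb t ht).1) h.integrable_inner
  have e1 : dissipation τ ν f u A p (fun t _ => ψ t)
      = ∫ z, (deriv ψ z.1 * (1 / 2 * ‖u z.1 z.2‖ ^ 2) + ψ z.1 * ⟪u z.1 z.2, f z.1 z.2⟫)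
        ∂(spaceTime d τ) := by
    -- A test function constant in space kills the transport, pressure and diffusion fluxes. The
    -- remaining viscous term cancels against the one added in `dissipation`.
    have e2 : singularDissipation τ ν f u A p (fun t _ => ψ t)
        = ∫ z, (deriv ψ z.1 * (1 / 2 * ‖u z.1 z.2‖ ^ 2) + ψ z.1 * ⟪u z.1 z.2, f z.1 z.2⟫
          - ψ z.1 * (ν * gradSq (A z.1 z.2))) ∂(spaceTime d τ) := by
      refine integral_congr_ae (Filter.Eventually.of_forall fun z => ?_)
      simp only [partialDeriv, fderiv_fun_const, Pi.zero_apply, zero_apply, mul_zero,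
        Finset.sum_const_zero, add_zero, sub_zero]
      ring
    rw [dissipation, e2, integral_sub (I2.fun_add I3) I1]
    have e3 : ∫ z, ν * gradSq (A z.1 z.2) * ψ z.1 ∂(spaceTime d τ)
        = ∫ z, ψ z.1 * (ν * gradSq (A z.1 z.2)) ∂(spaceTime d τ) := by
      simp only [mul_comm (ψ _)]
    rw [e3]
    ring
  have I4 : IntegrableOn (fun t => deriv ψ t
      * ∫ s in (0 : ℝ)..t, ∫ x, ⟪u s x, f s x⟫ ∂(torusMeasure d)) (Ioo 0 τ) :=
    (h.integrableOn_work hτ).bdd_mul hd.aestronglyMeasurable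
      (ae_restrict_of_forall_mem measurableSet_Ioo fun t ht => (hb t ht).2)
  have I5 : IntegrableOn (fun t => ψ t * ∫ x, ⟪u t x, f t x⟫ ∂(torusMeasure d)) (Ioo 0 τ) :=
    h.integrableOn_power.bdd_mul hψ.smooth.continuous.aestronglyMeasurable
      (ae_restrict_of_forall_mem measurableSet_Ioo fun t ht => (hb t ht).1)
  have I6 : IntegrableOn (fun t => deriv ψ t * (1 / 2 * ∫ x, ‖u t x‖ ^ 2 ∂(torusMeasure d)))
      (Ioo 0 τ) :=
    (h.integrableOn_energy.const_mul (1 / 2)).bdd_mul hd.aestronglyMeasurable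
      (ae_restrict_of_forall_mem measurableSet_Ioo fun t ht => (hb t ht).2)
  obtain ⟨hac, hder⟩ := absolutelyContinuous_primitive hτ h.integrableOn_power 0
  -- The work is absolutely continuous and ψ vanishes at 0 and near τ, so the power tested with ψ is
  -- minus the work tested with ψ'.
  have hw := hasWeakTimeDeriv_of_absolutelyContinuous hτ hac hder ψ hψ
  simp only [zero_add, hψ0, zero_mul, add_zero] at hw
  rw [integral_add I4 I5] at hw
  rw [e1, spaceTime, integral_prod _ (I2.fun_add I3)]
  have e4 : ∫ t in Ioo 0 τ, deriv ψ t * netEnergy f u t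
      = (∫ t in Ioo 0 τ, deriv ψ t * (1 / 2 * ∫ x, ‖u t x‖ ^ 2 ∂(torusMeasure d)))
        - ∫ t in Ioo 0 τ, deriv ψ t
          * ∫ s in (0 : ℝ)..t, ∫ x, ⟪u s x, f s x⟫ ∂(torusMeasure d) := by
    rw [← integral_sub I6 I4]
    simp only [netEnergy, mul_sub]
  have e5 : ∫ t in Ioo 0 τ, ∫ x, (deriv ψ t * (1 / 2 * ‖u t x‖ ^ 2) + ψ t * ⟪u t x, f t x⟫)
        ∂(torusMeasure d)
      = (∫ t in Ioo 0 τ, deriv ψ t * (1 / 2 * ∫ x, ‖u t x‖ ^ 2 ∂(torusMeasure d)))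
        + ∫ t in Ioo 0 τ, ψ t * ∫ x, ⟪u t x, f t x⟫ ∂(torusMeasure d) := by
    rw [← integral_add I6 I5]
    refine integral_congr_ae ?_
    filter_upwards [h.integrable_norm_sq.prod_right_ae, h.integrable_inner.prod_right_ae]
      with t t1 t2
    rw [integral_add ((t1.const_mul _).const_mul _) (t2.const_mul _), integral_const_mul,
      integral_const_mul, integral_const_mul]
  refine e5.trans ?_
  rw [e4]
  linarith

/-- The pairing is ∫ ψ' G for the net energy G, which is nonincreasing and confined to an interval
of length R below the initial energy. -/
theorem IsLeraySolution.dissipation_le (h : IsLeraySolution τ ν u₀ f u A p) (hτ : 0 < τ)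
    (hν : 0 < ν) (hR : 0 ≤ R)
    (hlow : ∀ᵐ t ∂(volume.restrict (Ioo 0 τ)),
      1 / 2 * ∫ x, ‖u₀ x‖ ^ 2 ∂(torusMeasure d) - R ≤ netEnergy f u t)
    {ψ : ℝ → ℝ} (hψ : IsTimeCutoff τ ψ) : dissipation τ ν f u A p (fun t _ => ψ t) ≤ R := by
  have hψ0 : ψ 0 = 0 := by
    obtain ⟨_, _, a, b, ha, _, h0⟩ := hψ
    exact h0 0 fun hmem => by linarith [hmem.1]
  rw [h.dissipation_eq hτ hψ.isTimeTest hψ0]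
  exact integral_deriv_cutoff_mul_le (h.integrableOn_netEnergy hτ) (h.netEnergy_antitone hν)
    (h.netEnergy_le hν) hlow hR hψ

/-! ### Singular dissipation given by a measure -/

theorem exists_isTimeCutoff {a T : ℝ} (ha : 0 < a) (haT : a < T) (hT : T < τ) :
    ∃ ψ, IsTimeCutoff τ ψ ∧ ∀ t ∈ Icc a T, ψ t = 1 := by
  -- At most half of each gap is used for the descent of the cutoff, which keeps its support inside
  -- (0,τ).
  have hδ : 0 < min (a / 2) ((τ - T) / 2) := lt_min (by linarith) (by linarith)
  have hδ1 := min_le_left (a / 2) ((τ - T) / 2)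
  have hδ2 := min_le_right (a / 2) ((τ - T) / 2)
  set δ := min (a / 2) ((τ - T) / 2)
  let g : ContDiffBump ((a + T) / 2) := ⟨(T - a) / 2, (T - a) / 2 + δ, by linarith, by linarith⟩
  refine ⟨g, ⟨g.contDiff, fun t => ⟨g.nonneg, g.le_one⟩, a - δ, T + δ, by linarith, by linarith,
    fun t ht => g.zero_of_le_dist ?_⟩, fun t ht => g.one_of_mem_closedBall ?_⟩
  · rw [Real.dist_eq]
    change (T - a) / 2 + δ ≤ _
    by_contra! hlt
    rw [abs_lt] at hlt
    exact ht ⟨by linarith [hlt.1], by linarith [hlt.2]⟩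
  · rw [Metric.mem_closedBall, Real.dist_eq]
    change _ ≤ (T - a) / 2
    rw [abs_le]
    exact ⟨by linarith [ht.1], by linarith [ht.2]⟩

/-- The bound for a singular dissipation measure on a compact time interval. -/
theorem IsLeraySolution.dissipation_measure_Icc_le (h : IsLeraySolution τ ν u₀ f u A p)
    (hτ : 0 < τ) (hν : 0 < ν) (hR : 0 ≤ R)
    (hlow : ∀ᵐ t ∂(volume.restrict (Ioo 0 τ)),
      1 / 2 * ∫ x, ‖u₀ x‖ ^ 2 ∂(torusMeasure d) - R ≤ netEnergy f u t)
    {D : Measure (ℝ × Euc d)} (hD : IsSingularDissipationMeasure τ ν f u A p D)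
    {a T : ℝ} (ha : 0 < a) (haT : a < T) (hT : T < τ) :
    ENNReal.ofReal (ν * ∫ t in Ioo a T, ∫ x, gradSq (A t x) ∂(torusMeasure d))
      + D (Icc a T ×ˢ cell d) ≤ ENNReal.ofReal R := by
  -- The cutoff may extend beyond T, so the closed endpoint T is included. Both dissipation
  -- densities are nonnegative, so their masses on [a,T] are at most their pairings with ψ.
  obtain ⟨ψ, hψ, hψ1⟩ := exists_isTimeCutoff ha haT hT
  have hle := h.dissipation_le hτ hν hR hlow hψ
  have htest := hψ.isTimeTest
  obtain ⟨hs, h01, a', b', ha', hb', h0⟩ := hψ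
  obtain ⟨b, hb⟩ := htest.exists_bound
  rw [dissipation, ← hD.2 (fun t _ => ψ t) ⟨hs.comp contDiff_fst, fun _ _ _ => rfl,
    a', b', ha', hb', fun t ht _ => h0 t ht⟩] at hle
  have hsub : Ioo a T ⊆ Ioo 0 τ := Ioo_subset_Ioo ha.le hT.le
  -- the viscous part
  have I1 := integrable_time_mul hs.continuous (fun t ht => (hb t ht).1)
    (h.integrable_gradSq.const_mul ν)
  have hvisc : ν * ∫ t in Ioo a T, ∫ x, gradSq (A t x) ∂(torusMeasure d)
      ≤ ∫ z, ν * gradSq (A z.1 z.2) * ψ z.1 ∂(spaceTime d τ) := by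
    simp only [mul_comm (ν * _)]
    rw [spaceTime, integral_prod _ I1]
    simp only [integral_const_mul]
    rw [← integral_const_mul]
    have hi : IntegrableOn (fun t => ψ t * (ν * ∫ x, gradSq (A t x) ∂(torusMeasure d)))
        (Ioo 0 τ) :=
      (h.integrableOn_enstrophy.const_mul ν).bdd_mul hs.continuous.aestronglyMeasurable
        (ae_restrict_of_forall_mem measurableSet_Ioo fun t ht => (hb t ht).1)
    have e : ∫ t in Ioo a T, ν * ∫ x, gradSq (A t x) ∂(torusMeasure d)
        = ∫ t in Ioo a T, ψ t * (ν * ∫ x, gradSq (A t x) ∂(torusMeasure d)) :=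
      setIntegral_congr_fun measurableSet_Ioo fun t ht => by
        simp only [hψ1 t (Ioo_subset_Icc_self ht), one_mul]
    rw [e]
    exact setIntegral_mono_set hi (Filter.Eventually.of_forall fun t => mul_nonneg (h01 t).1
      (mul_nonneg hν.le (integral_nonneg fun x => gradSq_nonneg _))) hsub.eventuallyLE
  -- the singular part
  have hint : IntegrableOn (fun z : ℝ × Euc d => ψ z.1) (Ioo 0 τ ×ˢ cell d) D := by
    -- D is assumed finite on compact time intervals only; the support of ψ lies in one.
    have h1 : IntegrableOn (fun z : ℝ × Euc d => ψ z.1) (Icc a' b' ×ˢ cell d) D :=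
      Measure.integrableOn_of_bounded (M := 1) (hD.1 a' b' ha' hb').ne
        (hs.continuous.comp continuous_fst).aestronglyMeasurable
        (Filter.Eventually.of_forall fun z => by
          rw [Real.norm_eq_abs, abs_of_nonneg (h01 z.1).1]; exact (h01 z.1).2)
    refine h1.of_forall_sdiff_eq_zero (measurableSet_Ioo.prod (measurableSet_cell d)) fun z hz => ?_
    exact h0 _ fun hmem => hz.2 ⟨hmem, hz.1.2⟩
  have hsing : D (Icc a T ×ˢ cell d)
      ≤ ENNReal.ofReal (∫ z in Ioo 0 τ ×ˢ cell d, ψ z.1 ∂D) := by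
    rw [ofReal_integral_eq_lintegral_ofReal hint
      (Filter.Eventually.of_forall fun z => (h01 z.1).1)]
    have hmeas : MeasurableSet (Icc a T ×ˢ cell d) := measurableSet_Icc.prod (measurableSet_cell d)
    calc D (Icc a T ×ˢ cell d) = ∫⁻ z in Icc a T ×ˢ cell d, ENNReal.ofReal (ψ z.1) ∂D := by
          rw [← setLIntegral_one]
          exact setLIntegral_congr_fun hmeas fun z hz => by
            simp only [hψ1 z.1 hz.1, ENNReal.ofReal_one]
      _ ≤ _ := lintegral_mono_set (prod_mono (Icc_subset_Ioo ha hT) Subset.rfl)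
  have hpos : 0 ≤ ν * ∫ t in Ioo a T, ∫ x, gradSq (A t x) ∂(torusMeasure d) :=
    mul_nonneg hν.le (integral_nonneg fun r => integral_nonneg fun x => gradSq_nonneg _)
  have hpos2 : 0 ≤ ∫ z in Ioo 0 τ ×ˢ cell d, ψ z.1 ∂D := integral_nonneg fun z => (h01 z.1).1
  refine (add_le_add le_rfl hsing).trans ?_
  rw [← ENNReal.ofReal_add hpos hpos2]
  exact ENNReal.ofReal_le_ofReal ((add_le_add hvisc le_rfl).trans hle)

theorem antitone_div_nat_add_two {T : ℝ} (hT : 0 < T) : Antitone fun n : ℕ => T / (n + 2) :=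
  fun m n hmn => by
    have : (m : ℝ) ≤ n := by exact_mod_cast hmn
    simp only
    gcongr

theorem exists_div_nat_add_two_lt {T t : ℝ} (ht : 0 < t) :
    ∃ n : ℕ, T / (n + 2) < t := by
  obtain ⟨n, hn⟩ := exists_nat_gt (T / t)
  refine ⟨n, ?_⟩
  rw [div_lt_iff₀ (by positivity)]
  rw [div_lt_iff₀ ht] at hn
  nlinarith

/-- The intervals [T/(n+2), T] increase to (0,T], and both summands pass to the limit by
monotonicity. The shift by 2 keeps the left endpoint below T already for n = 0. -/
theorem IsLeraySolution.dissipation_measure_le (h : IsLeraySolution τ ν u₀ f u A p)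
    (hτ : 0 < τ) (hν : 0 < ν) (hR : 0 ≤ R)
    (hlow : ∀ᵐ t ∂(volume.restrict (Ioo 0 τ)),
      1 / 2 * ∫ x, ‖u₀ x‖ ^ 2 ∂(torusMeasure d) - R ≤ netEnergy f u t)
    {D : Measure (ℝ × Euc d)} (hD : IsSingularDissipationMeasure τ ν f u A p D)
    {T : ℝ} (hT0 : 0 < T) (hT : T < τ) :
    ENNReal.ofReal (ν * ∫ t in Ioo 0 T, ∫ x, gradSq (A t x) ∂(torusMeasure d))
      + D (Ioc 0 T ×ˢ cell d) ≤ ENNReal.ofReal R := by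
  have hanti := antitone_div_nat_add_two hT0
  have hpos : ∀ n : ℕ, 0 < T / ((n : ℝ) + 2) := fun n => by positivity
  have hlt : ∀ n : ℕ, T / ((n : ℝ) + 2) < T := fun n =>
    div_lt_self hT0 (by have : (0 : ℝ) ≤ n := n.cast_nonneg; linarith)
  have u1 : ⋃ n : ℕ, Ioo (T / ((n : ℝ) + 2)) T = Ioo 0 T := by
    ext t
    simp only [mem_iUnion, mem_Ioo]
    constructor
    · rintro ⟨n, h1, h2⟩
      exact ⟨(hpos n).trans h1, h2⟩
    · rintro ⟨h1, h2⟩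
      obtain ⟨n, hn⟩ := exists_div_nat_add_two_lt (T := T) h1
      exact ⟨n, hn, h2⟩
  have u2 : ⋃ n : ℕ, (Icc (T / ((n : ℝ) + 2)) T ×ˢ cell d) = Ioc 0 T ×ˢ cell d := by
    ext z
    simp only [mem_iUnion, mem_prod, mem_Icc, mem_Ioc]
    constructor
    · rintro ⟨n, ⟨h1, h2⟩, h3⟩
      exact ⟨⟨(hpos n).trans_le h1, h2⟩, h3⟩
    · rintro ⟨⟨h1, h2⟩, h3⟩
      obtain ⟨n, hn⟩ := exists_div_nat_add_two_lt (T := T) h1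
      exact ⟨n, ⟨hn.le, h2⟩, h3⟩
  have t1 : Filter.Tendsto (fun n : ℕ =>
      ∫ t in Ioo (T / ((n : ℝ) + 2)) T, ∫ x, gradSq (A t x) ∂(torusMeasure d)) Filter.atTop
      (nhds (∫ t in Ioo 0 T, ∫ x, gradSq (A t x) ∂(torusMeasure d))) := by
    rw [← u1]
    refine tendsto_setIntegral_of_monotone (fun n => measurableSet_Ioo)
      (fun m n hmn => Ioo_subset_Ioo_left (hanti hmn)) ?_
    rw [u1]
    exact h.integrableOn_enstrophy.mono_set (Ioo_subset_Ioo_right hT.le)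
  have t2 : Filter.Tendsto (fun n : ℕ => D (Icc (T / ((n : ℝ) + 2)) T ×ˢ cell d)) Filter.atTop
      (nhds (D (Ioc 0 T ×ˢ cell d))) := by
    rw [← u2]
    exact tendsto_measure_iUnion_atTop fun m n hmn =>
      prod_mono (Icc_subset_Icc_left (hanti hmn)) Subset.rfl
  have t3 := (ENNReal.tendsto_ofReal (t1.const_mul ν)).add t2
  exact le_of_tendsto' t3 fun n =>
    h.dissipation_measure_Icc_le hτ hν hR hlow hD (hpos n) (hlt n) hT

theorem IsTimeCutoff.mono {T T' : ℝ} (hT : T ≤ T') {ψ : ℝ → ℝ} (hψ : IsTimeCutoff T ψ) :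
    IsTimeCutoff T' ψ := by
  obtain ⟨hs, h01, a, b, ha, hb, h0⟩ := hψ
  exact ⟨hs, h01, a, b, ha, hb.trans_le hT, h0⟩

/-! ### Choice of the scale and of the constant -/

/-- The energy deficit in terms of the viscosity. -/
theorem IsLeraySolution.netEnergy_deficit_le_rpow {σ M C : ℝ} {B₀ B₂ B₃ : ℝ≥0}
    (h : IsLeraySolution τ ν u₀ f u A p) (hτ : 0 < τ) (hν : 0 < ν) (hσ : 0 < σ) (hσ1 : σ ≤ 1)
    (hM : 0 ≤ M) (hex : ∀ ℓ : ℝ, 0 < ℓ → ℓ ≤ 1 → ∃ k : Euc d → ℝ, IsMollifier ℓ M k)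
    (hu₀ : besovNorm 2 σ u₀ ≤ B₀) (hf : timeBesovNorm τ 2 2 σ f ≤ B₂)
    (hu : timeBesovNorm τ 3 3 σ u ≤ B₃)
    (hC : deficitConst d σ M * ((B₀ : ℝ) ^ 2 + (τ + (B₃ : ℝ) ^ 3 + (B₂ : ℝ) ^ 2)) ≤ C)
    (hC' : 1 < ν → ((B₀ : ℝ) ^ 2 + (τ + (B₃ : ℝ) ^ 3 + (B₂ : ℝ) ^ 2))
      ≤ C * ν ^ ((3 * σ - 1) / (σ + 1))) :
    ∀ᵐ t ∂(volume.restrict (Ioo 0 τ)), 1 / 2 * ∫ x, ‖u₀ x‖ ^ 2 ∂(torusMeasure d)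
      - C * ν ^ ((3 * σ - 1) / (σ + 1)) ≤ netEnergy f u t := by
  -- The scale ν^(1/(σ+1)) is admissible only if it is at most 1, that is, for ν ≤ 1; larger
  -- viscosities use the crude bound.
  rcases lt_or_ge 1 ν with h1 | h1
  · filter_upwards [h.netEnergy_deficit_le_const hτ hu₀ hf hu] with t ht
    linarith [hC' h1]
  · obtain ⟨ℓ, hℓ, hℓν⟩ : ∃ ℓ : ℝ, ℓ = ν ^ (1 / (σ + 1)) ∧ ν = ℓ ^ (σ + 1) := by
      refine ⟨_, rfl, ?_⟩
      rw [← Real.rpow_mul hν.le, one_div_mul_cancel (by positivity), Real.rpow_one]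
    have hℓ0 : 0 < ℓ := hℓ ▸ Real.rpow_pos_of_pos hν _
    have hℓ1 : ℓ ≤ 1 := hℓ ▸ Real.rpow_le_one hν.le h1 (by positivity)
    have hα : ν ^ ((3 * σ - 1) / (σ + 1)) = ℓ ^ (3 * σ - 1) := by
      rw [hℓ, ← Real.rpow_mul hν.le, one_div_mul_eq_div]
    obtain ⟨k, hk⟩ := hex ℓ hℓ0 hℓ1
    rw [hα]
    subst hℓν
    filter_upwards [h.netEnergy_deficit_le hτ hk hM hℓ0 hℓ1 hσ.le hσ1 hu₀ hf hu] with t ht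
    refine le_trans ?_ ht
    have := mul_le_mul_of_nonneg_right hC (Real.rpow_pos_of_pos hℓ0 (3 * σ - 1)).le
    linarith

end Dissipation

/-- For ν > 1 and α ≥ 0 the power ν^α is at least 1, and C ≥ Q is enough. For α < 0 it decays, but ν
≤ ν₀ keeps it above max(ν₀,1)^α, which the third candidate compensates. -/
theorem exists_rate_constant {α ν₀ K Q : ℝ} (hK : 0 ≤ K) :
    ∃ C : ℝ, 0 ≤ C ∧ K ≤ C ∧ ∀ ν : ℝ, 1 < ν → (ν ≤ ν₀ ∨ 0 ≤ α) → Q ≤ C * ν ^ α := by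
  refine ⟨max K (max Q (Q * (max ν₀ 1) ^ (-α))), hK.trans (le_max_left _ _), le_max_left _ _,
    fun ν hν hcase => ?_⟩
  have hν0 : 0 < ν := by linarith
  rcases le_or_gt 0 α with hα | hα
  · have h1 : 1 ≤ ν ^ α := Real.one_le_rpow hν.le hα
    calc Q = Q * 1 := (mul_one Q).symm
      _ ≤ _ := mul_le_mul ((le_max_left _ _).trans (le_max_right _ _)) h1 zero_le_one
        (hK.trans (le_max_left _ _))
  · have hle : ν ≤ max ν₀ 1 := (hcase.resolve_right (not_le.2 hα)).trans (le_max_left _ _)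
    have h1 : (max ν₀ 1) ^ α ≤ ν ^ α := Real.rpow_le_rpow_of_nonpos hν0 hle hα.le
    have hpos : 0 < max ν₀ 1 := lt_max_of_lt_right one_pos
    calc Q = Q * (max ν₀ 1) ^ (-α) * (max ν₀ 1) ^ α := by
          rw [mul_assoc, ← Real.rpow_add hpos, neg_add_cancel, Real.rpow_zero, mul_one]
      _ ≤ _ := mul_le_mul ((le_max_right _ _).trans (le_max_right _ _)) h1
        (Real.rpow_pos_of_pos hpos _).le (hK.trans (le_max_left _ _))

theorem lemma1 (d : ℕ) (τ σ : ℝ) (hτ : 0 < τ) (hσ : σ ∈ Set.Ioc (0 : ℝ) 1)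
    (u₀ : ℝ → Euc d → Euc d) (f u : ℝ → ℝ → Euc d → Euc d)
    (A : ℝ → ℝ → Euc d → Fin d → Fin d → ℝ) (p : ℝ → ℝ → Euc d → ℝ)
    (hu : ∀ ν, 0 < ν → IsLeraySolution τ ν (u₀ ν) (f ν) (u ν) (A ν) (p ν))
    (hu₀_bdd : ∃ B : ℝ≥0, ∀ ν, 0 < ν → besovNorm 2 σ (u₀ ν) ≤ B)
    (hf_bdd : ∃ B : ℝ≥0, ∀ ν, 0 < ν → timeBesovNorm τ 2 2 σ (f ν) ≤ B)
    (hu_bdd : ∃ B : ℝ≥0, ∀ ν, 0 < ν → timeBesovNorm τ 3 3 σ (u ν) ≤ B) :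
    ∀ ν₀ : ℝ, ∃ C : ℝ, ∀ᵐ T ∂(volume.restrict (Set.Icc 0 τ)),
      ∀ ν, 0 < ν → (ν ≤ ν₀ ∨ 1 / 3 ≤ σ) →
        totalDissipation τ ν (f ν) (u ν) (A ν) (p ν) T
            ≤ ((C * ν ^ ((3 * σ - 1) / (σ + 1)) : ℝ) : EReal) ∧
        ∀ D : Measure (ℝ × Euc d),
          IsSingularDissipationMeasure τ ν (f ν) (u ν) (A ν) (p ν) D →
            ENNReal.ofReal (ν * ∫ t in Set.Ioo 0 T, ∫ x, gradSq (A ν t x) ∂(torusMeasure d))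
                + D (Set.Ioc 0 T ×ˢ cell d)
              ≤ ENNReal.ofReal (C * ν ^ ((3 * σ - 1) / (σ + 1))) := by
  intro ν₀
  obtain ⟨B₀, hB₀⟩ := hu₀_bdd
  obtain ⟨B₂, hB₂⟩ := hf_bdd
  obtain ⟨B₃, hB₃⟩ := hu_bdd
  obtain ⟨M, hM, hex⟩ := exists_isMollifier d
  have hQ : 0 ≤ (B₀ : ℝ) ^ 2 + (τ + (B₃ : ℝ) ^ 3 + (B₂ : ℝ) ^ 2) := by positivity
  obtain ⟨C, hC0, hKC, hC⟩ := exists_rate_constant (α := (3 * σ - 1) / (σ + 1)) (ν₀ := ν₀)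
    (mul_nonneg (deficitConst_nonneg d σ hM) hQ)
  have hσ1 : 0 < σ + 1 := by linarith [hσ.1]
  refine ⟨C, ?_⟩
  -- The bound holds for every T strictly between 0 and τ, so one null set of times serves all
  -- viscosities.
  filter_upwards [ae_restrict_mem measurableSet_Icc,
    ae_restrict_of_ae (Measure.ae_ne (volume : Measure ℝ) 0),
    ae_restrict_of_ae (Measure.ae_ne (volume : Measure ℝ) τ)] with T hT hT0 hTτ ν hν hcase
  have hT0' : 0 < T := lt_of_le_of_ne hT.1 (Ne.symm hT0)
  have hTτ' : T < τ := lt_of_le_of_ne hT.2 hTτ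
  have hR : 0 ≤ C * ν ^ ((3 * σ - 1) / (σ + 1)) := mul_nonneg hC0 (Real.rpow_pos_of_pos hν _).le
  have hlow := (hu ν hν).netEnergy_deficit_le_rpow hτ hν hσ.1 hσ.2 hM hex (hB₀ ν hν) (hB₂ ν hν)
    (hB₃ ν hν) hKC fun h1 => hC ν h1 (hcase.imp id fun h => div_nonneg (by linarith) hσ1.le)
  refine ⟨iSup₂_le fun ψ hψ => ?_, fun D hD => ?_⟩
  -- A cutoff on (0,T) is also one on (0,τ), so the constant does not depend on T.
  · exact EReal.coe_le_coe_iff.2 ((hu ν hν).dissipation_le hτ hν hR hlow (hψ.mono hT.2))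
  · exact (hu ν hν).dissipation_measure_le hτ hν hR hlow hD hT0' hTτ'
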